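/- Let $\Bbbk$ be a field of characteristic zero, $\mathfrak g$ a Lie algebra over $\Bbbk$ (of any dimension) with a symmetric invariant bilinear form $\langle\cdot|\cdot\rangle$, i.e. $\langle a|b\rangle=\langle b|a\rangle$ and $\langle [a,b]|c\rangle=\langle a|[b,c]\rangle$. Let $X_1$ be a linear basis of $\mathfrak g$ equipped with a well-order, and let $X=X_1\cup\{e\}$ with $e<X_1$. Consider the alphabet $B=\{\partial,\,L_n^a,\,R_n^a : a\in X_1,\ n\ge 0\}$. For $v=\sum_i\alpha_i a_i\in\mathfrak g$ with $a_i\in X_1$, expressions such as $L_n^{v}$, $L_n^a v$, $\partial^s v$ are understood linearly: $L_n^v=\sum_i\alpha_iL_n^{a_i}$, etc. Let $A$ be the associative unital algebra generated by $B$ with the relations (for all $a,b\in X_1$, $n,m\ge0$) $$L_n^a\partial=\partial L_n^a+nL_{n-1}^a,\quad R_n^a\partial=\partial R_n^a+nR_{n-1}^a,\quad R_n^aL_m^b=L_m^bR_n^a,\quad L_n^aL_m^b=L_m^bL_n^a+L_{n+m}^{[a,b]}.$$ Let $U=U(K(\mathfrak g);X,3)$ be the left $A$-module generated by $X$ with the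 relations (for all $a,b\in X_1$) $$L_n^ab=R_n^ab=0\ (n\ge3),\qquad L_n^ae=R_n^ae=0\ (n\ge0),\qquad \partial e=0,$$ $$R_2^ab=L_2^ba,\quad R_1^ab=-L_1^ba+\partial L_2^ba,\quad R_0^ab=L_0^ba-\partial L_1^ba+\tfrac12\partial^2L_2^ba,$$ $$R_0^ab=L_0^ab-[a,b],\quad R_1^ab=L_1^ab-\langle a|b\rangle e,\quad R_2^ab=L_2^ab.$$ (This is the module presentation of the universal associative conformal envelope, at locality $N=3$ on $X$, of the Kac–Moody conformal algebra $K(\mathfrak g)=(\Bbbk[\partial]\otimes\mathfrak g)\oplus\Bbbk e$, $\partial e=0$, $[a_\lambda b]=[a,b]+\lambda\langle a|b\rangle e$, with $e$ central; here $L_n^a$ and $R_n^a$ are the operators of left and right multiplication by $a$.) Order $B$ by $L_0^\bullet<L_1^\bullet<\partial<L_2^\bullet<L_3^\bullet<\dots<R_0^\bullet<R_1^\bullet<\dots$, where letters of the same kind with the same index $n$ are compared by their superscripts. Order the words in $B$ by deg-lex (first by length, then lexicographically), and order the monomials $uy$ ($u\in B^*$, $y\in X$) of the free left $\Bbbk\langle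 B\rangle$-module $\Bbbk\langle B\rangle X$ by comparing the pairs $(u,y)$ lexicographically. Consider the following rewriting rules; superscripts $a,b$ and $a,b,c$ run over $X_1$. Rules of $A$, applicable at any place of a word in $B$: $$\partial L_0^a\to L_0^a\partial,\qquad \partial L_1^a\to L_1^a\partial-L_0^a,\qquad L_n^a\partial\to\partial L_n^a+nL_{n-1}^a\ (n\ge2),$$ $$R_n^a\partial\to\partial R_n^a+nR_{n-1}^a,\qquad R_m^aL_n^b\to L_n^bR_m^a,\qquad L_n^aL_m^b\to L_m^bL_n^a+L_{n+m}^{[a,b]}\ \text{ if }(n,a)>_{lex}(m,b).$$ Rules of the module, applicable at the right end of a monomial: $$L_n^ab\to0,\ \ R_n^ab\to0\ (n\ge3),\qquad L_n^ae\to0,\ \ R_n^ae\to0\ (n\ge0),\qquad \partial e\to0,$$ $$R_2^ab\to L_2^ab,\qquad R_1^ab\to L_1^ab-\langle a|b\rangle e,\qquad R_0^ab\to L_0^ab-[a,b],$$ $$L_2^ab\to L_2^ba\ (a>b),\qquad \partial L_2^ab\to L_1^ab+L_1^ba-\langle a|b\rangle e,$$ $$L_1^a\partial b\to L_1^b\partial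 a+3L_0^ab-3L_0^ba-2[a,b]\ (a>b),$$ $$L_1^a\partial^sb\to L_1^b\partial^sa-(s+2)L_0^b\partial^{s-1}a+(s+2)L_0^a\partial^{s-1}b-2\partial^{s-1}[a,b]\ (s\ge2,\ a>b),$$ $$L_2^aL_2^bc\to0,\qquad L_1^aL_2^bc\to L_1^bL_2^ca\ (b\le c<a),\qquad L_1^aL_2^bc\to L_1^bL_2^ac\ (b<a\le c),$$ $$L_1^aL_1^bc\to L_1^aL_1^cb+L_0^bL_2^ac-L_0^cL_2^ab+L_2^a[c,b]+L_2^b[c,a]+L_2^c[a,b]\ (a\le c<b),$$ $$L_1^aL_1^bc\to L_1^cL_1^ab+L_0^bL_2^ca-L_0^cL_2^ab+L_2^c[a,b]+L_2^a[c,b]\ (c<a\le b),$$ $$\begin{aligned}L_0^aL_1^bc\to{}& L_0^aL_1^cb+L_0^bL_1^ac+L_0^cL_1^ba-L_0^bL_1^ca-L_0^cL_1^ab+L_1^{[c,a]}b+L_1^{[a,b]}c+L_1^{[b,c]}a\\&-L_1^c[a,b]-L_1^a[b,c]-L_1^b[c,a]+\langle a|[b,c]\rangle e\qquad(c<b<a).\end{aligned}$$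 Then this set of rewriting rules is a Gröbner–Shirshov basis of $U$ with respect to the given order. That is: 1. in every rule the left-hand side is greater than every monomial of the right-hand side; 2. the kernel of the natural surjection $\Bbbk\langle B\rangle X\to U$ is the linear span of the elements (left-hand side) $-$ (right-hand side), for all rules placed in all monomial contexts; 3. the leading monomial of every nonzero element of this kernel contains the left-hand side of one of the rules (at an admissible place); 4. the rewriting system on $\Bbbk\langle B\rangle X$ is terminating and confluent. -/

import Mathlib

namespace KacMoodyEnv

/-- The alphabet `B = {∂, L_n^a, R_n^a : n ≥ 0, a ∈ X₁}`, where the basis `X₁` of the Lie algebra is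
indexed by `ι`; `d` is the letter `∂`. -/
inductive Letter (ι : Type*) where
  | L (n : ℕ) (a : ι) : Letter ι
  | d : Letter ι
  | R (n : ℕ) (a : ι) : Letter ι

open Letter

/-- `L_0 < L_1 < ∂ < L_2 < L_3 < … < R_0 < R_1 < …`, letters of the same kind and the same index `n`
being compared by their superscripts. -/
def Letter.lt {ι : Type*} [LT ι] : Letter ι → Letter ι → Prop
  | L n a, L m b => n < m ∨ (n = m ∧ a < b)
  | L n _, d => n ≤ 1
  | L _ _, R _ _ => True
  | d, L n _ => 2 ≤ n
  | d, d => False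
  | d, R _ _ => True
  | R _ _, L _ _ => False
  | R _ _, d => False
  | R n a, R m b => n < m ∨ (n = m ∧ a < b)

/-- The module generators `X = X₁ ∪ {e}`, with `e < X₁`: the element `e` is `⊥`. -/
abbrev Gen (ι : Type*) := WithBot ι

/-- The torsion generator `e`. -/
abbrev e {ι : Type*} : Gen ι := ⊥

/-- The generator of `X₁` with index `a`. -/
abbrev x {ι : Type*} (a : ι) : Gen ι := (a : WithBot ι)

/-- Monomials `u y` (`u ∈ B*`, `y ∈ X`) of the free left `k⟨B⟩`-module generated by `X`. -/
abbrev Mon (ι : Type*) := List (Letter ι) × Gen ι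

/-- `u y < v z` iff `(u, y)` is lexicographically less than `(v, z)`, words being compared by
deg-lex (first length, then lexicographically). -/
def Mon.lt {ι : Type*} [LinearOrder ι] : Mon ι → Mon ι → Prop :=
  Prod.Lex (List.Shortlex Letter.lt) (· < ·)

section Rewriting

variable {k : Type*} [Field k] {M : Type*}

/-- One rewriting step: a monomial `m` occurring in `f` (with coefficient `f m ≠ 0`) is replaced by
the right-hand side `r` of a rule `m → r`. -/
def Step (rule : M → (M →₀ k) → Prop) (f g : M →₀ k) : Prop :=
  ∃ m r, rule m r ∧ f m ≠ 0 ∧ g = f - f m • (Finsupp.single m 1 - r)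

/-- There is no infinite chain of rewriting steps. -/
def IsTerminating (rule : M → (M →₀ k) → Prop) : Prop :=
  WellFounded fun g f => Step rule f g

/-- Any two reductions of the same element can be continued to a common element. -/
def IsConfluent (rule : M → (M →₀ k) → Prop) : Prop :=
  ∀ f g h, Relation.ReflTransGen (Step rule) f g → Relation.ReflTransGen (Step rule) f h →
    ∃ p, Relation.ReflTransGen (Step rule) g p ∧ Relation.ReflTransGen (Step rule) h p

/-- `rule` is a set of rewriting rules `m → r` on the vector space with basis `M` of monomials, closed
under multiplication by monomials. It is a Gröbner–Shirshov basis, relative to the monomial order `lt`, of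
the quotient `V` of this space by the kernel of `π`. -/
structure IsGroebnerShirshovBasis {V : Type*} [AddCommGroup V] [Module k V]
    (lt : M → M → Prop) (π : (M →₀ k) →ₗ[k] V) (rule : M → (M →₀ k) → Prop) : Prop where
  /-- `V` is the quotient of the space of polynomials. -/
  surjective : Function.Surjective π
  /-- The left-hand side of a rule is its principal part. -/
  principal : ∀ m r, rule m r → ∀ t ∈ r.support, lt t m
  /-- The rules are relations of `V`, and they imply all the relations of `V`. -/
  defines : Submodule.span k {f | ∃ m r, rule m r ∧ f = Finsupp.single m 1 - r} = LinearMap.ker π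
  /-- The leading monomial of every nonzero relation of `V` is the left-hand side of a rule. -/
  leading : ∀ f ∈ LinearMap.ker π, f ≠ 0 →
    ∃ m r, rule m r ∧ m ∈ f.support ∧ ∀ t ∈ f.support, t ≠ m → lt t m

end Rewriting

noncomputable section

variable {k : Type*} [Field k] {𝔤 : Type*} [LieRing 𝔤] [LieAlgebra k 𝔤] {ι : Type*}

/-! ### The module presentation of the envelope at locality `3` -/

/-- `L_n^v` in the free algebra `k⟨B⟩`, for an arbitrary `v ∈ 𝔤`, by linearity in `v`. -/
def freeL (b : Module.Basis ι k 𝔤) (n : ℕ) (v : 𝔤) : FreeAlgebra k (Letter ι) :=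
  (b.repr v).sum fun i c => c • FreeAlgebra.ι k (L n i)

/-- The defining relations (as equations) of the associative algebra `A`. -/
inductive AlgRel (b : Module.Basis ι k 𝔤) :
    FreeAlgebra k (Letter ι) → FreeAlgebra k (Letter ι) → Prop
  | L_d (n : ℕ) (a : ι) : AlgRel b
      (FreeAlgebra.ι k (L n a) * FreeAlgebra.ι k d)
      (FreeAlgebra.ι k d * FreeAlgebra.ι k (L n a) + (n : k) • FreeAlgebra.ι k (L (n - 1) a))
  | R_d (n : ℕ) (a : ι) : AlgRel b
      (FreeAlgebra.ι k (R n a) * FreeAlgebra.ι k d)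
      (FreeAlgebra.ι k d * FreeAlgebra.ι k (R n a) + (n : k) • FreeAlgebra.ι k (R (n - 1) a))
  | R_L (n m : ℕ) (a c : ι) : AlgRel b
      (FreeAlgebra.ι k (R n a) * FreeAlgebra.ι k (L m c))
      (FreeAlgebra.ι k (L m c) * FreeAlgebra.ι k (R n a))
  | L_L (n m : ℕ) (a c : ι) : AlgRel b
      (FreeAlgebra.ι k (L n a) * FreeAlgebra.ι k (L m c))
      (FreeAlgebra.ι k (L m c) * FreeAlgebra.ι k (L n a) + freeL b (n + m) ⁅b a, b c⁆)

/-- The associative algebra `A`, generated by `B` modulo the relations `AlgRel`. -/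
def Alg (b : Module.Basis ι k 𝔤) : Type _ := RingQuot (AlgRel b)

instance (b : Module.Basis ι k 𝔤) : Ring (Alg b) :=
  inferInstanceAs (Ring (RingQuot (AlgRel b)))

instance (b : Module.Basis ι k 𝔤) : Algebra k (Alg b) :=
  inferInstanceAs (Algebra k (RingQuot (AlgRel b)))

/-- The image of a letter in `A`. -/
def letter (b : Module.Basis ι k 𝔤) (l : Letter ι) : Alg b :=
  RingQuot.mkAlgHom k (AlgRel b) (FreeAlgebra.ι k l)

/-- The element `w y` of the free `A`-module generated by `X`. -/
def act (b : Module.Basis ι k 𝔤) (w : Alg b) (y : Gen ι) : Gen ι →₀ Alg b :=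
  Finsupp.single y w

/-- An element `v ∈ 𝔤`, written through the basis `X₁`, in the free `A`-module generated by `X`. -/
def vec (b : Module.Basis ι k 𝔤) (v : 𝔤) : Gen ι →₀ Alg b :=
  (b.repr v).sum fun i c => c • act b 1 (x i)

/-- The defining relations of the `A`-module `U`, in the free `A`-module generated by `X`. -/
inductive ModRel (b : Module.Basis ι k 𝔤) (φ : LinearMap.BilinForm k 𝔤) :
    (Gen ι →₀ Alg b) → Prop
  | locL (n : ℕ) (a c : ι) (hn : 3 ≤ n) : ModRel b φ (act b (letter b (L n a)) (x c))
  | locR (n : ℕ) (a c : ι) (hn : 3 ≤ n) : ModRel b φ (act b (letter b (R n a)) (x c))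
  | L_e (n : ℕ) (a : ι) : ModRel b φ (act b (letter b (L n a)) e)
  | R_e (n : ℕ) (a : ι) : ModRel b φ (act b (letter b (R n a)) e)
  | d_e : ModRel b φ (act b (letter b d) e)
  | RL2 (a c : ι) : ModRel b φ
      (act b (letter b (R 2 a)) (x c) - act b (letter b (L 2 c)) (x a))
  | RL1 (a c : ι) : ModRel b φ
      (act b (letter b (R 1 a)) (x c) + act b (letter b (L 1 c)) (x a)
        - act b (letter b d * letter b (L 2 c)) (x a))
  | RL0 (a c : ι) : ModRel b φ
      (act b (letter b (R 0 a)) (x c) - act b (letter b (L 0 c)) (x a)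
        + act b (letter b d * letter b (L 1 c)) (x a)
        - (1 / 2 : k) • act b (letter b d * letter b d * letter b (L 2 c)) (x a))
  | comm0 (a c : ι) : ModRel b φ
      (act b (letter b (R 0 a)) (x c) - act b (letter b (L 0 a)) (x c) + vec b ⁅b a, b c⁆)
  | comm1 (a c : ι) : ModRel b φ
      (act b (letter b (R 1 a)) (x c) - act b (letter b (L 1 a)) (x c)
        + φ (b a) (b c) • act b 1 e)
  | comm2 (a c : ι) : ModRel b φ
      (act b (letter b (R 2 a)) (x c) - act b (letter b (L 2 a)) (x c))

/-- The envelope `U = U(K(𝔤); X, 3)`: the `A`-module with generators `X` and relations `ModRel`. -/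
abbrev Envelope (b : Module.Basis ι k 𝔤) (φ : LinearMap.BilinForm k 𝔤) : Type _ :=
  (Gen ι →₀ Alg b) ⧸ Submodule.span (Alg b) {f | ModRel b φ f}

/-- The natural map of the free `k⟨B⟩`-module generated by `X`, the vector space with basis
`Mon ι`, onto `U`. -/
def toEnvelope (b : Module.Basis ι k 𝔤) (φ : LinearMap.BilinForm k 𝔤) :
    (Mon ι →₀ k) →ₗ[k] Envelope b φ :=
  Finsupp.linearCombination k fun m =>
    Submodule.Quotient.mk (act b ((m.1.map (letter b)).prod) m.2)

/-! ### The rewriting rules -/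

/-- The word `w` as an element of `k⟨B⟩`, the vector space with basis the words. -/
def word (k : Type*) [Field k] {ι : Type*} (w : List (Letter ι)) : List (Letter ι) →₀ k :=
  Finsupp.single w 1

/-- `L_n^v` for an arbitrary `v ∈ 𝔤`, by linearity in `v`. -/
def wordL (b : Module.Basis ι k 𝔤) (n : ℕ) (v : 𝔤) : List (Letter ι) →₀ k :=
  (b.repr v).sum fun i c => c • word k [L n i]

/-- The rewriting rules of the algebra `A`. -/
inductive AlgRule [LinearOrder ι] (b : Module.Basis ι k 𝔤) :
    List (Letter ι) → (List (Letter ι) →₀ k) → Prop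
  | d_L0 (a : ι) : AlgRule b [d, L 0 a] (word k [L 0 a, d])
  | d_L1 (a : ι) : AlgRule b [d, L 1 a] (word k [L 1 a, d] - word k [L 0 a])
  | L_d (n : ℕ) (a : ι) (hn : 2 ≤ n) :
      AlgRule b [L n a, d] (word k [d, L n a] + (n : k) • word k [L (n - 1) a])
  | R_d (n : ℕ) (a : ι) :
      AlgRule b [R n a, d] (word k [d, R n a] + (n : k) • word k [R (n - 1) a])
  | R_L (m n : ℕ) (a c : ι) : AlgRule b [R m a, L n c] (word k [L n c, R m a])
  | L_L (n m : ℕ) (a c : ι) (h : m < n ∨ (m = n ∧ c < a)) :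
      AlgRule b [L n a, L m c] (word k [L m c, L n a] + wordL b (n + m) ⁅b a, b c⁆)

/-- The monomial `w y` as an element of the free `k⟨B⟩`-module generated by `X`. -/
def mon (k : Type*) [Field k] {ι : Type*} (w : List (Letter ι)) (y : Gen ι) : Mon ι →₀ k :=
  Finsupp.single (w, y) 1

/-- `w v` for a word `w` and an arbitrary `v ∈ 𝔤`, by linearity in `v`. -/
def monV (b : Module.Basis ι k 𝔤) (w : List (Letter ι)) (v : 𝔤) : Mon ι →₀ k :=
  (b.repr v).sum fun i c => c • mon k w (x i)

/-- `L_n^v y` for an arbitrary `v ∈ 𝔤`, by linearity in `v`. -/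
def monL (b : Module.Basis ι k 𝔤) (n : ℕ) (v : 𝔤) (y : Gen ι) : Mon ι →₀ k :=
  (b.repr v).sum fun i c => c • mon k [L n i] y

/-- The rewriting rules of the module `U`; in the comments `a, b, c` are elements of `X₁`. -/
inductive ModRule [LinearOrder ι] (B : Module.Basis ι k 𝔤) (φ : LinearMap.BilinForm k 𝔤) :
    Mon ι → (Mon ι →₀ k) → Prop
  /-- `L_n^a b → 0`, `n ≥ 3` -/
  | locL (n : ℕ) (a b : ι) (hn : 3 ≤ n) : ModRule B φ ([L n a], x b) 0
  /-- `R_n^a b → 0`, `n ≥ 3` -/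
  | locR (n : ℕ) (a b : ι) (hn : 3 ≤ n) : ModRule B φ ([R n a], x b) 0
  /-- `L_n^a e → 0` -/
  | L_e (n : ℕ) (a : ι) : ModRule B φ ([L n a], e) 0
  /-- `R_n^a e → 0` -/
  | R_e (n : ℕ) (a : ι) : ModRule B φ ([R n a], e) 0
  /-- `∂ e → 0` -/
  | d_e : ModRule B φ ([d], e) 0
  /-- `R_2^a b → L_2^a b` -/
  | R2 (a b : ι) : ModRule B φ ([R 2 a], x b) (mon k [L 2 a] (x b))
  /-- `R_1^a b → L_1^a b - ⟨a|b⟩ e` -/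
  | R1 (a b : ι) : ModRule B φ ([R 1 a], x b) (mon k [L 1 a] (x b) - φ (B a) (B b) • mon k [] e)
  /-- `R_0^a b → L_0^a b - [a,b]` -/
  | R0 (a b : ι) : ModRule B φ ([R 0 a], x b) (mon k [L 0 a] (x b) - monV B [] ⁅B a, B b⁆)
  /-- `L_2^a b → L_2^b a`, `a > b` -/
  | L2 (a b : ι) (h : b < a) : ModRule B φ ([L 2 a], x b) (mon k [L 2 b] (x a))
  /-- `∂ L_2^a b → L_1^a b + L_1^b a - ⟨a|b⟩ e` -/
  | d_L2 (a b : ι) : ModRule B φ ([d, L 2 a], x b)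
      (mon k [L 1 a] (x b) + mon k [L 1 b] (x a) - φ (B a) (B b) • mon k [] e)
  /-- `L_1^a ∂ b → L_1^b ∂ a + 3 L_0^a b - 3 L_0^b a - 2 [a,b]`, `a > b` -/
  | L1_d (a b : ι) (h : b < a) : ModRule B φ ([L 1 a, d], x b)
      (mon k [L 1 b, d] (x a) + (3 : k) • mon k [L 0 a] (x b) - (3 : k) • mon k [L 0 b] (x a)
        - (2 : k) • monV B [] ⁅B a, B b⁆)
  /-- `L_1^a ∂^s b → L_1^b ∂^s a - (s+2) L_0^b ∂^{s-1} a + (s+2) L_0^a ∂^{s-1} b - 2 ∂^{s-1} [a,b]`,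
  `s ≥ 2`, `a > b` -/
  | L1_ds (s : ℕ) (a b : ι) (hs : 2 ≤ s) (h : b < a) :
      ModRule B φ (L 1 a :: List.replicate s d, x b)
      (mon k (L 1 b :: List.replicate s d) (x a)
        - ((s : k) + 2) • mon k (L 0 b :: List.replicate (s - 1) d) (x a)
        + ((s : k) + 2) • mon k (L 0 a :: List.replicate (s - 1) d) (x b)
        - (2 : k) • monV B (List.replicate (s - 1) d) ⁅B a, B b⁆)
  /-- `L_2^a L_2^b c → 0` -/
  | L2_L2 (a b c : ι) : ModRule B φ ([L 2 a, L 2 b], x c) 0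
  /-- `L_1^a L_2^b c → L_1^b L_2^c a`, `b ≤ c < a` -/
  | L1_L2 (a b c : ι) (h₁ : b ≤ c) (h₂ : c < a) : ModRule B φ ([L 1 a, L 2 b], x c)
      (mon k [L 1 b, L 2 c] (x a))
  /-- `L_1^a L_2^b c → L_1^b L_2^a c`, `b < a ≤ c` -/
  | L1_L2' (a b c : ι) (h₁ : b < a) (h₂ : a ≤ c) : ModRule B φ ([L 1 a, L 2 b], x c)
      (mon k [L 1 b, L 2 a] (x c))
  /-- `L_1^a L_1^b c → L_1^a L_1^c b + L_0^b L_2^a c - L_0^c L_2^a b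
  + L_2^a [c,b] + L_2^b [c,a] + L_2^c [a,b]`, `a ≤ c < b` -/
  | L1_L1 (a b c : ι) (h₁ : a ≤ c) (h₂ : c < b) : ModRule B φ ([L 1 a, L 1 b], x c)
      (mon k [L 1 a, L 1 c] (x b) + mon k [L 0 b, L 2 a] (x c) - mon k [L 0 c, L 2 a] (x b)
        + monV B [L 2 a] ⁅B c, B b⁆ + monV B [L 2 b] ⁅B c, B a⁆ + monV B [L 2 c] ⁅B a, B b⁆)
  /-- `L_1^a L_1^b c → L_1^c L_1^a b + L_0^b L_2^c a - L_0^c L_2^a b + L_2^c [a,b] + L_2^a [c,b]`,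
  `c < a ≤ b` -/
  | L1_L1' (a b c : ι) (h₁ : c < a) (h₂ : a ≤ b) : ModRule B φ ([L 1 a, L 1 b], x c)
      (mon k [L 1 c, L 1 a] (x b) + mon k [L 0 b, L 2 c] (x a) - mon k [L 0 c, L 2 a] (x b)
        + monV B [L 2 c] ⁅B a, B b⁆ + monV B [L 2 a] ⁅B c, B b⁆)
  /-- `L_0^a L_1^b c → L_0^a L_1^c b + L_0^b L_1^a c + L_0^c L_1^b a - L_0^b L_1^c a - L_0^c L_1^a b
  + L_1^{[c,a]} b + L_1^{[a,b]} c + L_1^{[b,c]} a - L_1^c [a,b] - L_1^a [b,c] - L_1^b [c,a]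
  + ⟨a|[b,c]⟩ e`, `c < b < a` -/
  | L0_L1 (a b c : ι) (h₁ : c < b) (h₂ : b < a) : ModRule B φ ([L 0 a, L 1 b], x c)
      (mon k [L 0 a, L 1 c] (x b) + mon k [L 0 b, L 1 a] (x c) + mon k [L 0 c, L 1 b] (x a)
        - mon k [L 0 b, L 1 c] (x a) - mon k [L 0 c, L 1 a] (x b)
        + monL B 1 ⁅B c, B a⁆ (x b) + monL B 1 ⁅B a, B b⁆ (x c) + monL B 1 ⁅B b, B c⁆ (x a)
        - monV B [L 1 c] ⁅B a, B b⁆ - monV B [L 1 a] ⁅B b, B c⁆ - monV B [L 1 b] ⁅B c, B a⁆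
        + φ (B a) ⁅B b, B c⁆ • mon k [] e)

/-- All the rules of the free `k⟨B⟩`-module generated by `X`: a rule `w → r` of the algebra may be
applied at any place of a word (`u w v y → u r v y`), a rule `w y → r` of the module at its right
end (`u w y → u r`). -/
inductive Rule [LinearOrder ι] (b : Module.Basis ι k 𝔤) (φ : LinearMap.BilinForm k 𝔤) :
    Mon ι → (Mon ι →₀ k) → Prop
  | alg (u v w : List (Letter ι)) (y : Gen ι) (r : List (Letter ι) →₀ k) (h : AlgRule b w r) :
      Rule b φ (u ++ w ++ v, y) (r.mapDomain fun t => (u ++ t ++ v, y))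
  | mod (u w : List (Letter ι)) (y : Gen ι) (r : Mon ι →₀ k) (h : ModRule b φ (w, y) r) :
      Rule b φ (u ++ w, y) (r.mapDomain fun t => (u ++ t.1, t.2))

end

end KacMoodyEnv

/-!
No critical pair of the rewriting rules is computed. Suppose that rewriting rules decrease a
well-order, that they are relations of a space `V` spanned by the monomials, and that no nonzero
combination of irreducible monomials vanishes in `V`. Then every vector has a unique irreducible
form, and the rules are a terminating and confluent Gröbner–Shirshov basis
(`groebner_of_irreducible_independent`). It remains to verify these three hypotheses for the
envelope `U`.

*Order.* `Rule.lt` compares both sides of each rule.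

*Validity.* For `x, y ∈ 𝔤`, the relations of `U` contain two expressions for `R_1^x y` and for
`R_0^x y`. Comparing them gives `∂ L_2^x y = L_1^x y + L_1^y x - ⟨x|y⟩ e` and
`∂ (L_1^x y - L_1^y x) = 2 (L_0^x y - L_0^y x - [x, y])`. Applying `L_3`, `L_2` and `L_1` to these
two formulas produces all the remaining rules of the module (`L2_L2`, `L1_L2_comm`, `L1_L1_sub`,
`L0_L1_cyclic`, collected in `Rule.lin_eq`); this divides by `2` and `3`.

*Independence.* The irreducible monomials are `e` and the words `L_0^u L_1^v ∂^s c`,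
`L_0^u L_1^v L_2^a c`, `L_0^u L_1^a c` with the expected inequalities between their superscripts
(`exists_normalForm_of_irreducible`). They are separated by two models of the presentation, that
is, spaces with operators `L_n^x`, `R_n^x`, `∂` and vectors that satisfy the defining relations
of `U`; such a space receives a map from `U` (`Model.exists_lift`).

In the first model `e` acts as zero. Let `𝔤 ⊕ ε𝔤` with `ε² = 0` be the Takiff algebra. On the
sequences with values in its enveloping algebra, read as power series in `∂`, let `D = d/d∂`, let
`L_n^x` be `x D^n + n (εx) D^(n-1)` with left multiplications and `R_n^x` the same with right
multiplications, and send the generator `x` to `(∂ (εx) - x) / 2` (`algModel`). The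
Poincaré–Birkhoff–Witt theorem makes the images of all normal forms other than `e` independent
(`linearIndependent_eval_takModel`).

The second model shows that `e` is not zero in `U` (`toEnvelope_e_ne_zero`). The invariant form
gives the three-cocycle `φ(x, [y, z])`. Let `Q` be generated over `U(𝔤)` by an alternating family
`w(x, y)` and an invariant vector `e`, with
`x w(y, z) - w([y, z], x) + (cyclic permutations) = φ(x, [y, z]) e / 2`. Modulo `e` this is a syzygy
module of the trivial module, with the Chevalley–Eilenberg differential `δ : Q → U(𝔤) ⊗ 𝔤`. The
relations, solved for `a w(b, c)` with `c < b < a`, can be rewritten together with the commutation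
relations of `U(𝔤)`, and their overlaps are resolved by `d² = 0` for the Chevalley–Eilenberg
differential and the cocycle identity (`ExtRule.overlap`); hence `e` survives in `Q`
(`pmk_none_ne_zero`). Finally the power series over `Q ⊕ (U(𝔤) ⊗ 𝔤)` modulo `∂ q = δ(q)` form
a model in which the generator `x` is `1 ⊗ x` and `e` is `e ∈ Q` (`CocycleExtension.exists_model`).

Both the Poincaré–Birkhoff–Witt theorem (`exists_pbw_coordinates`) and the survival of `e` in `Q`
rest on one diamond lemma for modules over `U(𝔤)` given by generators and relations of the form
`a g = ρ` (`exists_normalForm_presented`).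
-/

namespace KacMoodyEnv

/-! ### Rewriting systems and Gröbner–Shirshov bases -/

section Abstract

variable {k : Type*} [Field k] {M : Type*} {V : Type*} [AddCommGroup V] [Module k V]
  {lt : M → M → Prop} {rule : M → (M →₀ k) → Prop}

/-- A monomial to which no rule applies. -/
def Irreducible (rule : M → (M →₀ k) → Prop) (m : M) : Prop := ∀ r, ¬ rule m r

/-- The span of the differences (left-hand side) − (right-hand side). -/
noncomputable def relSpan (rule : M → (M →₀ k) → Prop) : Submodule k (M →₀ k) :=
  Submodule.span k {f | ∃ m r, rule m r ∧ f = Finsupp.single m 1 - r}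

theorem sub_mem_relSpan {m : M} {r : M →₀ k} (h : rule m r) :
    Finsupp.single m 1 - r ∈ relSpan rule :=
  Submodule.subset_span ⟨m, r, h, rfl⟩

/-- Modulo the rules, a monomial is a combination of irreducible monomials, none of them greater. -/
theorem exists_irreducible_single (wf : WellFounded lt) [IsTrans M lt]
    (principal : ∀ m r, rule m r → ∀ t ∈ r.support, lt t m) (m : M) :
    ∃ p : M →₀ k, Finsupp.single m 1 - p ∈ relSpan rule ∧
      ∀ t ∈ p.support, Irreducible rule t ∧ (t = m ∨ lt t m) := by
  classical
  induction m using wf.induction with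
  | _ m ih =>
    by_cases hm : Irreducible rule m
    · refine ⟨Finsupp.single m 1, by simp, fun t ht => ?_⟩
      have : t = m := by simpa using Finsupp.support_single_subset ht
      exact ⟨this ▸ hm, Or.inl this⟩
    · obtain ⟨r, hr⟩ := not_forall_not.mp hm
      choose! p hp hp' using ih
      refine ⟨r.sum fun t c => c • p t, ?_, fun t ht => ?_⟩
      · have h : Finsupp.single m 1 - (r.sum fun t c => c • p t)
            = (Finsupp.single m 1 - r) + r.sum fun t c => c • (Finsupp.single t 1 - p t) := by
          have : r = r.sum fun t c => c • Finsupp.single t (1 : k) := by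
            simp [Finsupp.sum_single]
          rw [sub_add_eq_add_sub, eq_sub_iff_add_eq]
          nth_rewrite 2 [this]
          simp only [smul_sub, Finsupp.sum_sub]
          abel
        rw [h]
        refine Submodule.add_mem _ (sub_mem_relSpan hr) (Submodule.sum_mem _ fun t ht => ?_)
        exact Submodule.smul_mem _ _ (hp t (principal m r hr t ht))
      · obtain ⟨s, hs, hts⟩ := Finset.mem_biUnion.mp (Finsupp.support_sum ht)
        have hs' := principal m r hr s hs
        obtain ⟨h1, h2⟩ := hp' s hs' t (Finsupp.support_smul hts)
        refine ⟨h1, Or.inr ?_⟩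
        rcases h2 with rfl | h2
        · exact hs'
        · exact _root_.trans h2 hs'

theorem exists_irreducible (wf : WellFounded lt) [IsTrans M lt]
    (principal : ∀ m r, rule m r → ∀ t ∈ r.support, lt t m) (f : M →₀ k) :
    ∃ p : M →₀ k, f - p ∈ relSpan rule ∧
      ∀ t ∈ p.support, Irreducible rule t ∧ ∃ s ∈ f.support, t = s ∨ lt t s := by
  classical
  choose p hp hp' using exists_irreducible_single wf principal
  refine ⟨f.sum fun t c => c • p t, ?_, fun t ht => ?_⟩
  · have h : f - (f.sum fun t c => c • p t)
        = f.sum fun t c => c • (Finsupp.single t 1 - p t) := by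
      simp only [smul_sub, Finsupp.sum_sub]
      simp [Finsupp.sum_single]
    rw [h]
    exact Submodule.sum_mem _ fun t _ => Submodule.smul_mem _ _ (hp t)
  · obtain ⟨s, hs, hts⟩ := Finset.mem_biUnion.mp (Finsupp.support_sum ht)
    obtain ⟨h1, h2⟩ := hp' s t (Finsupp.support_smul hts)
    exact ⟨h1, s, hs, h2⟩

theorem exists_greatest [IsTrans M lt] (tri : ∀ s t, lt s t ∨ s = t ∨ lt t s) {s : Finset M}
    (hs : s.Nonempty) : ∃ m ∈ s, ∀ t ∈ s, t ≠ m → lt t m := by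
  classical
  induction hs using Finset.Nonempty.cons_induction with
  | singleton a => exact ⟨a, by simp, fun t ht h => absurd (by simpa using ht) h⟩
  | cons a s ha hs ih =>
    obtain ⟨m, hm, hmax⟩ := ih
    rcases tri a m with h | h | h
    · refine ⟨m, by simp [hm], fun t ht htm => ?_⟩
      rcases Finset.mem_cons.mp ht with rfl | ht
      · exact h
      · exact hmax t ht htm
    · exact absurd (h ▸ hm) ha
    · refine ⟨a, by simp, fun t ht hta => ?_⟩
      rcases Finset.mem_cons.mp ht with rfl | ht
      · exact absurd rfl hta
      · by_cases htm : t = m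
        · exact htm ▸ h
        · exact _root_.trans (hmax t ht htm) h

/-- A step deletes a monomial and changes the coefficients of smaller monomials only, so it
decreases the support in the lexicographic order that compares largest monomials first. -/
theorem isTerminating_of_principal (wf : WellFounded lt)
    (tri : ∀ s t, lt s t ∨ s = t ∨ lt t s)
    (principal : ∀ m r, rule m r → ∀ t ∈ r.support, lt t m) : IsTerminating rule := by
  have irr : ∀ m, ¬ lt m m := fun m h => wf.asymmetric _ _ h h
  have : Std.Trichotomous (Function.swap lt) :=
    ⟨fun a b h1 h2 => by
      rcases tri a b with h | h | h
      · exact absurd h h2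
      · exact h
      · exact absurd h h1⟩
  have hs : WellFounded fun x y : k => x = 0 ∧ y ≠ 0 :=
    ⟨fun y => ⟨y, fun x hx => ⟨x, fun z hz => absurd hx.1 hz.2⟩⟩⟩
  have key := Finsupp.Lex.wellFounded' (r := Function.swap lt) (s := fun x y : k => x = 0 ∧ y ≠ 0)
    (fun n h => h.2 rfl) hs wf
  refine Subrelation.wf (r := Finsupp.Lex (Function.swap lt) fun x y : k => x = 0 ∧ y ≠ 0) ?_ key
  rintro g f ⟨m, r, hr, hm, rfl⟩
  have hr0 : ∀ t, ¬ lt t m → r t = 0 := fun t ht => by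
    by_contra h
    exact ht (principal m r hr t (Finsupp.mem_support_iff.mpr h))
  refine ⟨m, fun t (ht : lt m t) => ?_, ?_, hm⟩
  · have h1 : m ≠ t := fun h => irr t (h ▸ ht)
    have h2 : r t = 0 := hr0 t fun h => wf.asymmetric _ _ h ht
    simp [h1, h2]
  · simp [hr0 m (irr m)]

theorem exists_reduction {rule : M → (M →₀ k) → Prop} (ht : IsTerminating rule) (f : M →₀ k) :
    ∃ p, Relation.ReflTransGen (Step rule) f p ∧ ∀ t ∈ p.support, Irreducible rule t := by
  induction f using WellFounded.induction ht with
  | _ f ih =>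
    by_cases h : ∀ t ∈ f.support, Irreducible rule t
    · exact ⟨f, .refl, h⟩
    · push Not at h
      obtain ⟨t, ht, h⟩ := h
      obtain ⟨r, hr⟩ := not_forall_not.mp h
      have hstep : Step rule f (f - f t • (Finsupp.single t 1 - r)) :=
        ⟨t, r, hr, Finsupp.mem_support_iff.mp ht, rfl⟩
      obtain ⟨p, hp, hp'⟩ := ih _ hstep
      exact ⟨p, .head hstep hp, hp'⟩

/-- If the rules decrease a well-order, are relations of `V`, and no nonzero relation of `V` is a
combination of irreducible monomials, then they form a terminating and confluent
Gröbner–Shirshov basis. -/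
theorem groebner_of_irreducible_independent (wf : WellFounded lt) [IsTrans M lt]
    (tri : ∀ s t, lt s t ∨ s = t ∨ lt t s) (π : (M →₀ k) →ₗ[k] V)
    (surj : Function.Surjective π)
    (principal : ∀ m r, rule m r → ∀ t ∈ r.support, lt t m)
    (holds : ∀ m r, rule m r → π (Finsupp.single m 1) = π r)
    (indep : ∀ p, π p = 0 → (∀ t ∈ p.support, Irreducible rule t) → p = 0) :
    IsGroebnerShirshovBasis lt π rule ∧ IsTerminating rule ∧ IsConfluent rule := by
  have irr : ∀ m, ¬ lt m m := fun m h => wf.asymmetric _ _ h h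
  have hle : relSpan rule ≤ LinearMap.ker π := by
    refine Submodule.span_le.mpr ?_
    rintro f ⟨m, r, hr, rfl⟩
    simp [holds m r hr]
  have hterm := isTerminating_of_principal wf tri principal
  refine ⟨⟨surj, principal, le_antisymm hle fun f hf => ?_, fun f hf hf0 => ?_⟩, hterm, ?_⟩
  · obtain ⟨p, hp, hp'⟩ := exists_irreducible wf principal f
    have : p = 0 := by
      refine indep p ?_ fun t ht => (hp' t ht).1
      have := hle hp
      simp only [LinearMap.mem_ker, map_sub] at this hf
      simpa [hf] using this
    simpa [this, relSpan] using hp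
  · obtain ⟨m, hm, hmax⟩ := exists_greatest (lt := lt) tri (Finsupp.support_nonempty_iff.mpr hf0)
    by_contra hcon
    push Not at hcon
    have hirr : Irreducible rule m := fun r hr => by
      obtain ⟨t, h1, h2, h3⟩ := hcon m r hr hm
      exact h3 (hmax t h1 h2)
    -- Reduce everything below the leading term: the result is an irreducible relation.
    obtain ⟨p, hp, hp'⟩ := exists_irreducible wf principal (f.erase m)
    have hpm : p m = 0 := by
      by_contra h
      obtain ⟨-, s, hs, h⟩ := hp' m (Finsupp.mem_support_iff.mpr h)
      have hs' : s ≠ m ∧ f s ≠ 0 := by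
        rw [Finsupp.mem_support_iff] at hs
        refine ⟨fun h => hs (by simp [h]), fun h => hs ?_⟩
        by_cases hsm : s = m
        · simp [hsm]
        · simp [Finsupp.erase_ne hsm, h]
      rcases h with h | h
      · exact hs'.1 h.symm
      · exact wf.asymmetric _ _ h (hmax s (Finsupp.mem_support_iff.mpr hs'.2) hs'.1)
    have h0 : Finsupp.single m (f m) + p = 0 := by
      refine indep _ ?_ fun t ht => ?_
      · have h1 := hle hp
        rw [LinearMap.mem_ker, map_sub, sub_eq_zero] at h1
        rw [map_add, ← h1, ← map_add, Finsupp.single_add_erase]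
        exact hf
      · by_cases htm : t = m
        · exact htm ▸ hirr
        · refine (hp' t ?_).1
          rw [Finsupp.mem_support_iff] at ht ⊢
          simpa [Finsupp.single_apply, Ne.symm htm] using ht
    have := DFunLike.congr_fun h0 m
    simp [hpm] at this
    exact Finsupp.mem_support_iff.mp hm this
  · have hred : ∀ f g, Relation.ReflTransGen (Step rule) f g → π f = π g := by
      intro f g h
      induction h with
      | refl => rfl
      | tail _ hs ih =>
        obtain ⟨m, r, hr, -, rfl⟩ := hs
        rw [ih, map_sub, map_smul, map_sub, holds m r hr, sub_self, smul_zero, sub_zero]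
    intro f g h hg hh
    obtain ⟨p, hp, hp'⟩ := exists_reduction hterm g
    obtain ⟨q, hq, hq'⟩ := exists_reduction hterm h
    have : p - q = 0 := by
      classical
      refine indep _ ?_ fun t ht => ?_
      · rw [map_sub, ← hred _ _ hp, ← hred _ _ hq, ← hred _ _ hg, ← hred _ _ hh, sub_self]
      · rcases Finset.mem_union.mp (Finsupp.support_sub ht) with ht | ht
        · exact hp' t ht
        · exact hq' t ht
    exact ⟨p, hp, by rwa [sub_eq_zero.mp this]⟩

/-- A well-founded rewriting system all of whose ambiguities are resolved (relative to the smaller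
rules) has a normal form map. -/
theorem exists_normalForm {lt : M → M → Prop} (wf : WellFounded lt)
    {rule : M → (M →₀ k) → Prop} (principal : ∀ m r, rule m r → ∀ t ∈ r.support, lt t m)
    (resolve : ∀ m r r', rule m r → rule m r' → ∀ N : (M →₀ k) →ₗ[k] (M →₀ k),
      (∀ t s, lt t m → rule t s → N (Finsupp.single t 1) = N s) → N r = N r') :
    ∃ N : (M →₀ k) →ₗ[k] (M →₀ k), (∀ m r, rule m r → N (Finsupp.single m 1) = N r) ∧
      ∀ m, Irreducible rule m → N (Finsupp.single m 1) = Finsupp.single m 1 := by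
  classical
  let F : (m : M) → ((t : M) → lt t m → (M →₀ k)) → (M →₀ k) := fun m ih =>
    if h : ∃ r, rule m r then
      (Classical.choose h).sum fun t c => if ht : lt t m then c • ih t ht else 0
    else Finsupp.single m 1
  let nf : M → (M →₀ k) := wf.fix F
  have hnf : ∀ m, nf m = F m fun t _ => nf t := fun m => wf.fix_eq F m
  let N : (M →₀ k) →ₗ[k] (M →₀ k) := Finsupp.linearCombination k nf
  have hN1 : ∀ m, N (Finsupp.single m 1) = nf m := fun m => by simp [N]
  have hirr : ∀ m, Irreducible rule m → N (Finsupp.single m 1) = Finsupp.single m 1 := by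
    intro m hm
    rw [hN1, hnf]
    exact dif_neg fun ⟨r, hr⟩ => hm r hr
  have hchoose : ∀ m (h : ∃ r, rule m r), N (Finsupp.single m 1) = N (Classical.choose h) := by
    intro m h
    rw [hN1, hnf]
    simp only [F, dif_pos h]
    rw [Finsupp.linearCombination_apply]
    refine Finsupp.sum_congr fun t ht => ?_
    rw [dif_pos (principal m _ (Classical.choose_spec h) t ht)]
  refine ⟨N, fun m => ?_, hirr⟩
  induction m using wf.induction with
  | _ m ih =>
    intro r hr
    rw [hchoose m ⟨r, hr⟩]
    exact resolve m _ _ (Classical.choose_spec ⟨r, hr⟩) hr N fun t s ht hs => ih t ht s hs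

end Abstract

/-! ### Rewriting in modules over enveloping algebras -/

section PresentedModules

noncomputable section

variable {k : Type*} [Field k] {𝔩 : Type*} [LieRing 𝔩] [LieAlgebra k 𝔩] {κ : Type*} {G : Type*}
  {V : Type*} [AddCommGroup V] [Module k V]

/-- Left multiplication of monomials by a word. -/
def pre (k : Type*) [Field k] {κ G : Type*} (w : List κ) :
    (List κ × G →₀ k) →ₗ[k] (List κ × G →₀ k) :=
  Finsupp.lmapDomain k k fun t => (w ++ t.1, t.2)

@[simp] theorem pre_single (w : List κ) (t : List κ × G) (c : k) :
    pre k w (Finsupp.single t c) = Finsupp.single (w ++ t.1, t.2) c := by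
  simp [pre, Finsupp.mapDomain_single]

theorem pre_pre (u v : List κ) (f : List κ × G →₀ k) : pre k u (pre k v f) = pre k (u ++ v) f := by
  have : (pre k u) ∘ₗ (pre k v) = pre (G := G) k (u ++ v) := by
    ext t : 2
    simp
  exact LinearMap.congr_fun this f

/-- `u x v` for an arbitrary `x ∈ 𝔩`, by linearity in `x`, where `f` is defined on words. -/
def slot (B : Module.Basis κ k 𝔩) (f : List κ → V) (u v : List κ) : 𝔩 →ₗ[k] V :=
  B.constr k fun i => f (u ++ i :: v)

/-- `u x y v` for arbitrary `x, y ∈ 𝔩`. -/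
def slot₂ (B : Module.Basis κ k 𝔩) (f : List κ → V) (u v : List κ) : 𝔩 →ₗ[k] 𝔩 →ₗ[k] V :=
  B.constr k fun i => slot B f (u ++ [i]) v

variable (B : Module.Basis κ k 𝔩)

@[simp] theorem slot_basis (f : List κ → V) (u v : List κ) (i : κ) :
    slot B f u v (B i) = f (u ++ i :: v) := by simp [slot]

@[simp] theorem slot₂_basis (f : List κ → V) (u v : List κ) (i : κ) (y : 𝔩) :
    slot₂ B f u v (B i) y = slot B f (u ++ [i]) v y := by simp [slot₂]

theorem slot₂_basis_right (f : List κ → V) (u v : List κ) (x : 𝔩) (j : κ) :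
    slot₂ B f u v x (B j) = slot B f u (j :: v) x := by
  have : (slot₂ B f u v).flip (B j) = slot B f u (j :: v) := by
    refine B.ext fun i => ?_
    simp
  exact LinearMap.congr_fun this x

theorem map_slot {W : Type*} [AddCommGroup W] [Module k W] (N : V →ₗ[k] W) (f : List κ → V)
    (u v : List κ) (x : 𝔩) : N (slot B f u v x) = slot B (fun w => N (f w)) u v x := by
  have : N ∘ₗ slot B f u v = slot B (fun w => N (f w)) u v := B.ext fun i => by simp
  exact LinearMap.congr_fun this x

theorem slot_congr {f g : List κ → V} {u v u' v' : List κ}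
    (h : ∀ i, f (u ++ i :: v) = g (u' ++ i :: v')) (x : 𝔩) : slot B f u v x = slot B g u' v' x := by
  have : slot B f u v = slot B g u' v' := B.ext fun i => by simp [h]
  rw [this]

theorem slot_mem_supported {u v : List κ} {g : G} (x : 𝔩) {t : List κ × G}
    (ht : t ∈ (slot B (fun w => Finsupp.single (w, g) (1 : k)) u v x).support) :
    ∃ i, t = (u ++ i :: v, g) := by
  classical
  rw [slot, Module.Basis.constr_apply] at ht
  obtain ⟨i, -, hi⟩ := Finset.mem_biUnion.mp (Finsupp.support_sum ht)
  exact ⟨i, by simpa using Finsupp.support_single_subset (Finsupp.support_smul hi)⟩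

/-- Rewriting rules on the monomials `w g` (`w` a word in the basis of a Lie algebra `𝔩`, `g ∈ G`):
`a b → b a + [a, b]` at any place for `b < a`, and `a g → ρ` at the right end whenever `P a g ρ`. -/
inductive PRule [LinearOrder κ] (P : κ → G → (List κ × G →₀ k) → Prop) :
    List κ × G → (List κ × G →₀ k) → Prop
  | comm (u v : List κ) (a b : κ) (g : G) (h : b < a) : PRule P (u ++ a :: b :: v, g)
      (Finsupp.single (u ++ b :: a :: v, g) 1
        + slot B (fun w => Finsupp.single (w, g) 1) u v ⁅B a, B b⁆)
  | gen (u : List κ) (a : κ) (g : G) (ρ : List κ × G →₀ k) (h : P a g ρ) :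
      PRule P (u ++ [a], g) (pre k u ρ)

variable {B}

theorem shortlex_append {κ : Type*} [LT κ] (u : List κ) {s t : List κ}
    (h : List.Shortlex (· < ·) s t) : List.Shortlex (· < ·) (u ++ s) (u ++ t) :=
  h.append_left u

theorem shortlex_swap {κ : Type*} [LinearOrder κ] {a b : κ} (h : b < a) (u v : List κ) :
    List.Shortlex (· < ·) (u ++ b :: a :: v) (u ++ a :: b :: v) :=
  .append_left (.of_lex (by simp) (.rel h)) u

variable [LinearOrder κ] {P : κ → G → (List κ × G →₀ k) → Prop}

theorem PRule.prefix {t : List κ × G} {ρ : List κ × G →₀ k} (h : PRule B P t ρ) (w : List κ) :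
    PRule B P (w ++ t.1, t.2) (pre k w ρ) := by
  cases h with
  | comm u v a b g h =>
    have := PRule.comm (B := B) (P := P) (w ++ u) v a b g h
    rw [map_add, map_slot]
    have e := slot_congr B (f := fun t => pre k w (Finsupp.single (t, g) (1 : k)))
      (g := fun t => Finsupp.single (t, g) 1) (u := u) (v := v) (u' := w ++ u) (v' := v)
      (fun i => by simp) ⁅B a, B b⁆
    rw [e]
    simpa using this
  | gen u a g ρ h =>
    have := PRule.gen (B := B) (P := P) (w ++ u) a g ρ h
    rw [pre_pre]
    simpa using this

theorem PRule.lt (hlt : ∀ a g ρ, P a g ρ → ∀ t ∈ ρ.support, List.Shortlex (· < ·) t.1 [a])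
    {m : List κ × G} {r : List κ × G →₀ k} (h : PRule B P m r) :
    ∀ t ∈ r.support, List.Shortlex (· < ·) t.1 m.1 := by
  classical
  intro t ht
  cases h with
  | comm u v a b g h =>
    rcases Finset.mem_union.mp (Finsupp.support_add ht) with ht | ht
    · obtain rfl := Finset.mem_singleton.mp (Finsupp.support_single_subset ht)
      exact shortlex_swap h u v
    · obtain ⟨i, rfl⟩ := slot_mem_supported B _ ht
      exact .of_length_lt (by simp)
  | gen u a g ρ h =>
    obtain ⟨s, hs, rfl⟩ := Finset.mem_image.mp (Finsupp.mapDomain_support ht)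
    exact shortlex_append u (hlt a g ρ h s hs)

theorem slot₂_sub_slot₂ {f : List κ → V} {u v : List κ}
    (h : ∀ a b, b < a → f (u ++ a :: b :: v) = f (u ++ b :: a :: v) + slot B f u v ⁅B a, B b⁆)
    (x y : 𝔩) : slot₂ B f u v x y = slot₂ B f u v y x + slot B f u v ⁅x, y⁆ := by
  have : slot₂ B f u v = (slot₂ B f u v).flip +
      (LieModule.toEnd k 𝔩 𝔩 : 𝔩 →ₗ[k] Module.End k 𝔩).compr₂ (slot B f u v) := by
    refine B.ext fun i => B.ext fun j => ?_
    simp only [slot₂_basis, slot_basis, LinearMap.add_apply, LinearMap.flip_apply,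
      LinearMap.compr₂_apply, List.append_assoc, List.singleton_append]
    change _ = _ + slot B f u v ⁅B i, B j⁆
    rcases lt_trichotomy i j with hij | rfl | hij
    · rw [h j i hij, ← lie_skew (B i) (B j), map_neg]
      abel
    · simp
    · exact h i j hij
  exact LinearMap.congr_fun₂ this x y

/-- The overlap of two commutation rules is resolved by the Jacobi identity. -/
theorem resolve_comm_comm {f : List κ → V} {u v : List κ} {a b c : κ} (hab : b < a) (hbc : c < b)
    (h : ∀ u' v' a' b', b' < a' →
      List.Shortlex (· < ·) (u' ++ a' :: b' :: v') (u ++ a :: b :: c :: v) →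
      f (u' ++ a' :: b' :: v') = f (u' ++ b' :: a' :: v') + slot B f u' v' ⁅B a', B b'⁆) :
    f (u ++ b :: a :: c :: v) + slot B f u (c :: v) ⁅B a, B b⁆
      = f (u ++ a :: c :: b :: v) + slot B f (u ++ [a]) v ⁅B b, B c⁆ := by
  have hac := hbc.trans hab
  have l1 : List.Shortlex (· < ·) (u ++ b :: a :: c :: v) (u ++ a :: b :: c :: v) :=
    shortlex_swap hab u _
  have l2 : List.Shortlex (· < ·) (u ++ b :: c :: a :: v) (u ++ a :: b :: c :: v) :=
    .append_left (.of_lex (by simp) (.rel hab)) u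
  have l3 : List.Shortlex (· < ·) (u ++ a :: c :: b :: v) (u ++ a :: b :: c :: v) :=
    .append_left (.of_lex (by simp) (.cons (.rel hbc))) u
  have l4 : List.Shortlex (· < ·) (u ++ c :: a :: b :: v) (u ++ a :: b :: c :: v) :=
    .append_left (.of_lex (by simp) (.rel hac)) u
  have e1 := h (u ++ [b]) v a c hac (by simpa using l1)
  have e2 := h u (a :: v) b c hbc l2
  have e3 := h u (b :: v) a c hac l3
  have e4 := h (u ++ [c]) v a b hab (by simpa using l4)
  have S := slot₂_sub_slot₂ (B := B) (f := f) (u := u) (v := v) fun a' b' hab' =>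
    h u v a' b' hab' (.of_length_lt (by simp))
  simp only [List.append_assoc, List.singleton_append] at e1 e2 e3 e4
  rw [e1, e2, e3, e4]
  simp only [← slot₂_basis, ← slot₂_basis_right]
  have J : ⁅⁅B a, B b⁆, B c⁆ + ⁅B b, ⁅B a, B c⁆⁆ + ⁅⁅B b, B c⁆, B a⁆ = 0 := by
    rw [lie_lie (B a) (B b) (B c), ← lie_skew ⁅B b, B c⁆ (B a)]
    abel
  have J' : slot B f u v ⁅⁅B a, B b⁆, B c⁆ + slot B f u v ⁅B b, ⁅B a, B c⁆⁆
      + slot B f u v ⁅⁅B b, B c⁆, B a⁆ = 0 := by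
    rw [← map_add, ← map_add, J, map_zero]
  rw [S ⁅B a, B b⁆ (B c), S (B b) ⁅B a, B c⁆, S ⁅B b, B c⁆ (B a)]
  rw [← sub_eq_zero, ← J']
  abel

/-- Rules applied at disjoint places commute. -/
theorem resolve_disjoint
    (hlt : ∀ a g ρ, P a g ρ → ∀ t ∈ ρ.support, List.Shortlex (· < ·) t.1 [a])
    {u c v : List κ} {a b : κ} {g : G} (hab : b < a) {ρ : List κ × G →₀ k}
    (hρ : PRule B P (v, g) ρ) {N : (List κ × G →₀ k) →ₗ[k] V}
    (hN : ∀ t s, List.Shortlex (· < ·) t.1 (u ++ a :: b :: (c ++ v)) → PRule B P t s →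
      N (Finsupp.single t 1) = N s) :
    N (Finsupp.single (u ++ b :: a :: (c ++ v), g) 1
        + slot B (fun w => Finsupp.single (w, g) 1) u (c ++ v) ⁅B a, B b⁆)
      = N (pre k (u ++ a :: b :: c) ρ) := by
  let T : 𝔩 →ₗ[k] (List κ × G →₀ k) →ₗ[k] V :=
    B.constr k fun i => N ∘ₗ pre k (u ++ i :: c)
  have hT : ∀ x t, T x (Finsupp.single t 1)
      = slot B (fun w => N (Finsupp.single (w, t.2) 1)) u (c ++ t.1) x := by
    intro x t
    have : (LinearMap.applyₗ (Finsupp.single t (1 : k))) ∘ₗ T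
        = slot B (fun w => N (Finsupp.single (w, t.2) 1)) u (c ++ t.1) := by
      refine B.ext fun i => ?_
      simp [T]
    exact LinearMap.congr_fun this x
  have hTρ : ∀ x, T x (Finsupp.single (v, g) 1) = T x ρ := by
    intro x
    have : (LinearMap.applyₗ (Finsupp.single (v, g) (1 : k))) ∘ₗ T = (LinearMap.applyₗ ρ) ∘ₗ T := by
      refine B.ext fun i => ?_
      have h := hN _ _ (.of_length_lt (by simp)) (hρ.prefix (u ++ i :: c))
      simpa [T] using h
    exact LinearMap.congr_fun this x
  have h1 := hN _ _ (by simpa using shortlex_swap hab u (c ++ v)) (hρ.prefix (u ++ b :: a :: c))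
  simp only [List.append_assoc, List.cons_append] at h1
  rw [map_add, map_slot, h1, ← hT _ (v, g), hTρ, ← LinearMap.comp_apply, ← LinearMap.add_apply,
    ← LinearMap.comp_apply N]
  have hdec : ∀ A A' : (List κ × G →₀ k) →ₗ[k] V,
      (∀ t ∈ ρ.support, A (Finsupp.single t 1) = A' (Finsupp.single t 1)) → A ρ = A' ρ := by
    intro A A' h
    rw [← Finsupp.sum_single ρ, Finsupp.sum, map_sum, map_sum]
    refine Finset.sum_congr rfl fun t ht => ?_
    rw [← mul_one (ρ t), ← smul_eq_mul, ← Finsupp.smul_single, map_smul, map_smul, h t ht]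
  refine hdec _ _ fun t ht => ?_
  have ht' := hρ.lt hlt t ht
  have h2 := hN _ _ (by simpa using shortlex_append (u ++ a :: b :: c) ht')
    (PRule.comm (B := B) (P := P) u (c ++ t.1) a b t.2 hab)
  rw [map_add, map_slot] at h2
  rw [LinearMap.add_apply, LinearMap.comp_apply, LinearMap.comp_apply, hT]
  simp only [pre_single, List.append_assoc, List.cons_append]
  exact h2.symm

variable [WellFoundedLT κ]

/-- The normal form map for the module over the enveloping algebra of `𝔩` presented by generators
`G` and relations `a g = ρ`, provided the rules of the module overlap well with commutation. -/
theorem exists_normalForm_presented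
    (hfun : ∀ a g ρ ρ', P a g ρ → P a g ρ' → ρ = ρ')
    (hlt : ∀ a g ρ, P a g ρ → ∀ t ∈ ρ.support, List.Shortlex (· < ·) t.1 [a])
    (hover : ∀ u a' a g ρ, a < a' → P a g ρ →
      ∀ N : (List κ × G →₀ k) →ₗ[k] (List κ × G →₀ k),
      (∀ t s, List.Shortlex (· < ·) t.1 (u ++ [a', a]) → PRule B P t s →
        N (Finsupp.single t 1) = N s) →
      N (Finsupp.single (u ++ [a, a'], g) 1)
        + slot B (fun w => N (Finsupp.single (w, g) 1)) u [] ⁅B a', B a⁆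
        = N (pre k (u ++ [a']) ρ)) :
    ∃ N : (List κ × G →₀ k) →ₗ[k] (List κ × G →₀ k),
      (∀ m r, PRule B P m r → N (Finsupp.single m 1) = N r) ∧
      ∀ m, Irreducible (PRule B P) m → N (Finsupp.single m 1) = Finsupp.single m 1 := by
  have wf : WellFounded fun s t : List κ × G => List.Shortlex (· < ·) s.1 t.1 :=
    InvImage.wf Prod.fst (List.Shortlex.wf wellFounded_lt)
  -- Two commutation rules, the left one first.
  have key : ∀ u c v a b g a' b' v', b < a → b' < a' → a :: b :: v = c ++ a' :: b' :: v' →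
      ∀ N : (List κ × G →₀ k) →ₗ[k] (List κ × G →₀ k),
      (∀ t s, List.Shortlex (· < ·) t.1 (u ++ a :: b :: v) → PRule B P t s →
        N (Finsupp.single t 1) = N s) →
      N (Finsupp.single (u ++ b :: a :: v, g) 1
          + slot B (fun w => Finsupp.single (w, g) 1) u v ⁅B a, B b⁆)
        = N (Finsupp.single (u ++ c ++ b' :: a' :: v', g) 1
          + slot B (fun w => Finsupp.single (w, g) 1) (u ++ c) v' ⁅B a', B b'⁆) := by
    intro u c v a b g a' b' v' hab hab' heq N hN
    match c, heq with
    | [], heq =>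
      obtain ⟨rfl, rfl, rfl⟩ : a = a' ∧ b = b' ∧ v = v' := by simpa using heq
      simp
    | [x], heq =>
      obtain ⟨rfl, rfl, rfl⟩ : a = x ∧ b = a' ∧ v = b' :: v' := by simpa using heq
      rw [map_add, map_add, map_slot, map_slot]
      have := resolve_comm_comm (B := B) (f := fun w => N (Finsupp.single (w, g) 1)) (u := u)
        (v := v') hab hab' fun u' v' a' b' h' hlt' => by
          have := hN _ _ hlt' (PRule.comm u' v' a' b' g h')
          rwa [map_add, map_slot] at this
      simpa using this
    | x :: y :: c', heq =>
      obtain ⟨rfl, rfl, rfl⟩ : a = x ∧ b = y ∧ v = c' ++ a' :: b' :: v' := by simpa using heq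
      have := resolve_disjoint (B := B) hlt (u := u) (c := c') (v := a' :: b' :: v') hab
        (PRule.comm [] v' a' b' g hab') hN
      rw [this, map_add (pre k _), map_slot]
      simp only [pre_single, List.nil_append, List.append_assoc, List.cons_append]
      congr 2
      exact slot_congr B (fun i => by simp) _
  have key' : ∀ u v a b g u' a' ρ, b < a → P a' g ρ → u ++ a :: b :: v = u' ++ [a'] →
      ∀ N : (List κ × G →₀ k) →ₗ[k] (List κ × G →₀ k),
      (∀ t s, List.Shortlex (· < ·) t.1 (u ++ a :: b :: v) → PRule B P t s →
        N (Finsupp.single t 1) = N s) →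
      N (Finsupp.single (u ++ b :: a :: v, g) 1
          + slot B (fun w => Finsupp.single (w, g) 1) u v ⁅B a, B b⁆) = N (pre k u' ρ) := by
    intro u v a b g u' a' ρ hab hP heq N hN
    obtain ⟨c, rfl, hc⟩ : ∃ c, u' = u ++ c ∧ a :: b :: v = c ++ [a'] := by
      rcases List.append_eq_append_iff.mp heq with ⟨c, h1, h2⟩ | ⟨c, h1, h2⟩
      · exact ⟨c, h1, h2⟩
      · have := congrArg List.length h2
        simp at this
        omega
    match c, hc with
    | [], hc => simp at hc
    | [x], hc =>
      obtain ⟨rfl, rfl, rfl⟩ : a = x ∧ b = a' ∧ v = [] := by simpa using hc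
      rw [map_add, map_slot]
      exact hover u a b g ρ hab hP N hN
    | x :: y :: c', hc =>
      obtain ⟨rfl, rfl, rfl⟩ : a = x ∧ b = y ∧ v = c' ++ [a'] := by simpa using hc
      have := resolve_disjoint (B := B) hlt (u := u) (c := c') (v := [a']) hab
        (PRule.gen [] a' g ρ hP) hN
      rw [this, pre_pre]
      simp
  refine exists_normalForm wf (fun m r h => h.lt hlt) ?_
  intro m r r' h h' N hN
  cases h with
  | comm u v a b g hab =>
    generalize hm : (u ++ a :: b :: v, g) = m at h'
    cases h' with
    | comm u' v' a' b' g' hab' =>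
      obtain ⟨hm', rfl⟩ := Prod.mk.inj hm
      rcases List.append_eq_append_iff.mp hm' with ⟨c, rfl, hc⟩ | ⟨c, rfl, hc⟩
      · exact key u c v a b g a' b' v' hab hab' hc N hN
      · refine (key u' c v' a' b' g a b v hab' hab hc N ?_).symm
        rw [← hm']
        exact hN
    | gen u' a' g' ρ hP =>
      obtain ⟨hm', rfl⟩ := Prod.mk.inj hm
      exact key' u v a b g u' a' ρ hab hP hm' N hN
  | gen u a g ρ hP =>
    generalize hm : (u ++ [a], g) = m at h'
    cases h' with
    | comm u' v' a' b' g' hab' =>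
      obtain ⟨hm', rfl⟩ := Prod.mk.inj hm
      refine (key' u' v' a' b' g u a ρ hab' hP hm'.symm N ?_).symm
      rw [← hm']
      exact hN
    | gen u' a' g' ρ' hP' =>
      obtain ⟨hm', rfl⟩ := Prod.mk.inj hm
      obtain ⟨rfl, h2⟩ := List.append_inj' hm' rfl
      obtain rfl : a = a' := by simpa using h2
      rw [hfun a g ρ ρ' hP hP']

end

end PresentedModules

/-! ### Presented modules and the Poincaré–Birkhoff–Witt theorem -/

section Enveloping

noncomputable section

variable {k : Type*} [Field k] {𝔩 : Type*} [LieRing 𝔩] [LieAlgebra k 𝔩] {κ : Type*} {G : Type*}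
  {V : Type*} [AddCommGroup V] [Module k V]

section

attribute [local instance] LieRing.ofAssociativeRing

/-- `UniversalEnvelopingAlgebra.ι` in terms of the product, without the Lie ring structure of the
enveloping algebra. -/
theorem envelope_ι_lie (x y : 𝔩) :
    UniversalEnvelopingAlgebra.ι k ⁅x, y⁆
      = UniversalEnvelopingAlgebra.ι k x * UniversalEnvelopingAlgebra.ι k y
        - UniversalEnvelopingAlgebra.ι k y * UniversalEnvelopingAlgebra.ι k x := by
  rw [LieHom.map_lie, LieRing.of_associative_ring_bracket]

theorem exists_envelope_lift (ρ : 𝔩 →ₗ[k] Module.End k V)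
    (h : ∀ x y, ρ ⁅x, y⁆ = ρ x * ρ y - ρ y * ρ x) :
    ∃ F : UniversalEnvelopingAlgebra k 𝔩 →ₐ[k] Module.End k V,
      ∀ x, F (UniversalEnvelopingAlgebra.ι k x) = ρ x :=
  ⟨UniversalEnvelopingAlgebra.lift k
    { ρ with map_lie' := fun {x y} => (h x y).trans (LieRing.of_associative_ring_bracket _ _).symm },
    fun x => UniversalEnvelopingAlgebra.lift_ι_apply k _ x⟩

end

theorem lie_hom_of_basis (B : Module.Basis κ k 𝔩) (θ : 𝔩 →ₗ[k] Module.End k V)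
    (h : ∀ i j, θ ⁅B i, B j⁆ = θ (B i) * θ (B j) - θ (B j) * θ (B i)) (x y : 𝔩) :
    θ ⁅x, y⁆ = θ x * θ y - θ y * θ x := by
  have : (LieModule.toEnd k 𝔩 𝔩 : 𝔩 →ₗ[k] Module.End k 𝔩).compr₂ θ
      = (LinearMap.mul k (Module.End k V)).compl₁₂ θ θ
        - ((LinearMap.mul k (Module.End k V)).compl₁₂ θ θ).flip :=
    B.ext fun i => B.ext fun j => h i j
  exact LinearMap.congr_fun₂ this x y

variable (B : Module.Basis κ k 𝔩) [LinearOrder κ] (P : κ → G → (List κ × G →₀ k) → Prop)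

/-- The module over the enveloping algebra of `𝔩` with generators `G` and relations `a g = ρ` for
`P a g ρ`, as a quotient of the space with basis the monomials `w g`. -/
abbrev Presented : Type _ := (List κ × G →₀ k) ⧸ relSpan (PRule B P)

/-- The class of the monomial `w g`. -/
def pmk (w : List κ) (g : G) : Presented B P := Submodule.Quotient.mk (Finsupp.single (w, g) 1)

variable {B P}

theorem mkQ_rule {t : List κ × G} {ρ : List κ × G →₀ k} (h : PRule B P t ρ) :
    (relSpan (PRule B P)).mkQ (Finsupp.single t 1) = (relSpan (PRule B P)).mkQ ρ :=
  (Submodule.Quotient.eq _).mpr (sub_mem_relSpan h)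

theorem relSpan_le_comap_pre (w : List κ) :
    relSpan (PRule B P) ≤ (relSpan (PRule B P)).comap (pre k w) := by
  refine Submodule.span_le.mpr ?_
  rintro f ⟨m, r, hr, rfl⟩
  change pre k w _ ∈ relSpan (PRule B P)
  rw [map_sub, pre_single]
  exact sub_mem_relSpan (hr.prefix w)

variable (B P)

/-- The action of `𝔩` on a presented module. -/
def pact : 𝔩 →ₗ[k] Module.End k (Presented B P) :=
  B.constr k fun i => Submodule.mapQ _ _ (pre k [i]) (relSpan_le_comap_pre [i])

theorem pact_basis_mkQ (i : κ) (f : List κ × G →₀ k) :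
    pact B P (B i) ((relSpan (PRule B P)).mkQ f) = (relSpan (PRule B P)).mkQ (pre k [i] f) := by
  simp [pact]

theorem pact_basis_pmk (i : κ) (w : List κ) (g : G) :
    pact B P (B i) (pmk B P w g) = pmk B P (i :: w) g := by
  have := pact_basis_mkQ B P i (Finsupp.single (w, g) 1)
  rwa [pre_single] at this

theorem pact_pmk (x : 𝔩) (w : List κ) (g : G) :
    pact B P x (pmk B P w g) = slot B (fun w => pmk B P w g) [] w x := by
  have : (pact B P).flip (pmk B P w g) = slot B (fun w => pmk B P w g) [] w :=
    B.ext fun i => by simp [pact_basis_pmk]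
  exact LinearMap.congr_fun this x

variable {B P} in
theorem presented_hom_ext {F F' : Presented B P →ₗ[k] V}
    (h : ∀ w g, F (pmk B P w g) = F' (pmk B P w g)) : F = F' := by
  refine Submodule.linearMap_qext _ (Finsupp.lhom_ext' fun t => LinearMap.ext_ring ?_)
  exact h t.1 t.2

theorem pmk_comm {a b : κ} (h : b < a) (w : List κ) (g : G) :
    pmk B P (a :: b :: w) g = pmk B P (b :: a :: w) g + pact B P ⁅B a, B b⁆ (pmk B P w g) := by
  have := mkQ_rule (PRule.comm (B := B) (P := P) [] w a b g h)
  rw [map_add, map_slot] at this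
  rw [pact_pmk]
  exact this

theorem pact_lie (x y : 𝔩) :
    pact B P ⁅x, y⁆ = pact B P x * pact B P y - pact B P y * pact B P x := by
  refine lie_hom_of_basis B (pact B P) (fun i j => presented_hom_ext fun w g => ?_) x y
  change pact B P ⁅B i, B j⁆ (pmk B P w g) = pact B P (B i) (pact B P (B j) (pmk B P w g))
    - pact B P (B j) (pact B P (B i) (pmk B P w g))
  simp only [pact_basis_pmk]
  rcases lt_trichotomy i j with hij | rfl | hij
  · rw [pmk_comm B P hij, ← lie_skew (B i) (B j), map_neg, LinearMap.neg_apply]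
    abel
  · simp
  · rw [pmk_comm B P hij]
    abel

theorem prod_pact_pmk (w w' : List κ) (g : G) :
    (w.map fun i => pact B P (B i)).prod (pmk B P w' g) = pmk B P (w ++ w') g := by
  induction w with
  | nil => rfl
  | cons i w ih => rw [List.map_cons, List.prod_cons, Module.End.mul_apply, ih, pact_basis_pmk]; rfl

/-- Commutation turns a word into permutations of it and shorter words. -/
theorem normalForm_perm [WellFoundedLT κ] {N : (List κ × G →₀ k) →ₗ[k] (List κ × G →₀ k)}
    (hN : ∀ m r, PRule B (fun _ _ _ => False) m r → N (Finsupp.single m 1) = N r)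
    (hN' : ∀ m, Irreducible (PRule B fun _ _ _ => False) m →
      N (Finsupp.single m 1) = Finsupp.single m 1)
    (m t : List κ × G) (ht : N (Finsupp.single m 1) t ≠ 0) :
    t.1.Perm m.1 ∨ t.1.length < m.1.length := by
  have wf : WellFounded fun s t : List κ × G => List.Shortlex (· < ·) s.1 t.1 :=
    InvImage.wf Prod.fst (List.Shortlex.wf wellFounded_lt)
  induction m using wf.induction with
  | _ m ih =>
    classical
    by_cases hm : Irreducible (PRule B fun _ _ _ => False) m
    · rw [hN' m hm, Finsupp.single_apply] at ht
      left
      by_cases h : m = t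
      · rw [h]
      · simp [h] at ht
    · obtain ⟨r, hr⟩ := not_forall_not.mp hm
      cases hr with
      | gen u a g ρ h => exact h.elim
      | comm u v a b g hab =>
        rw [hN _ _ (PRule.comm u v a b g hab), map_add, Finsupp.add_apply] at ht
        by_cases h1 : N (Finsupp.single (u ++ b :: a :: v, g) 1) t = 0
        · right
          rw [h1, zero_add, map_slot, slot, Module.Basis.constr_apply, Finsupp.sum,
            Finsupp.finsetSum_apply] at ht
          obtain ⟨i, -, hi⟩ := Finset.exists_ne_zero_of_sum_ne_zero ht
          have h2 : N (Finsupp.single (u ++ i :: v, g) 1) t ≠ 0 := fun h => hi (by simp [h])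
          rcases ih (u ++ i :: v, g) (.of_length_lt (by simp)) h2 with h | h
          · rw [h.length_eq]
            simp
          · exact h.trans (by simp)
        · rcases ih (u ++ b :: a :: v, g) (shortlex_swap hab u v) h1 with h | h
          · exact Or.inl (h.trans ((List.Perm.swap a b v).append_left u))
          · right
            simpa using h

/-- A form of the Poincaré–Birkhoff–Witt theorem: coordinates on the enveloping algebra in which
sorted words in the basis are independent, and every word is a combination of permutations of it and
of shorter words. -/
theorem exists_pbw_coordinates [WellFoundedLT κ] :
    ∃ C : UniversalEnvelopingAlgebra k 𝔩 →ₗ[k] (List κ →₀ k),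
      (∀ w : List κ, w.Pairwise (· ≤ ·) →
        C (w.map fun i => UniversalEnvelopingAlgebra.ι k (B i)).prod = Finsupp.single w 1) ∧
      ∀ w t : List κ, C (w.map fun i => UniversalEnvelopingAlgebra.ι k (B i)).prod t ≠ 0 →
        t.Perm w ∨ t.length < w.length := by
  let P : κ → Unit → (List κ × Unit →₀ k) → Prop := fun _ _ _ => False
  obtain ⟨N, hN, hN'⟩ := exists_normalForm_presented (B := B) (P := P)
    (fun _ _ _ _ h => h.elim) (fun _ _ _ h => h.elim) (fun _ _ _ _ _ _ h => h.elim)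
  obtain ⟨F, hF⟩ := exists_envelope_lift (pact B P) (pact_lie B P)
  let Q : Presented B P →ₗ[k] (List κ × Unit →₀ k) := Submodule.liftQ _ N <| by
    refine Submodule.span_le.mpr ?_
    rintro f ⟨m, r, hr, rfl⟩
    simp [hN m r hr]
  let E : (List κ × Unit →₀ k) ≃ₗ[k] (List κ →₀ k) :=
    Finsupp.domLCongr (Equiv.prodUnique (List κ) Unit)
  let C : UniversalEnvelopingAlgebra k 𝔩 →ₗ[k] (List κ →₀ k) :=
    E.toLinearMap ∘ₗ Q ∘ₗ (LinearMap.applyₗ (pmk B P [] ())) ∘ₗ F.toLinearMap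
  have hC : ∀ w : List κ, C (w.map fun i => UniversalEnvelopingAlgebra.ι k (B i)).prod
      = E (N (Finsupp.single (w, ()) 1)) := by
    intro w
    have h1 : F (w.map fun i => UniversalEnvelopingAlgebra.ι k (B i)).prod
        = (w.map fun i => pact B P (B i)).prod := by
      rw [map_list_prod, List.map_map]
      congr 1
      exact List.map_congr_left fun i _ => hF (B i)
    change E (Q (F _ (pmk B P [] ()))) = _
    rw [h1, prod_pact_pmk, List.append_nil]
    rfl
  refine ⟨C, fun w hw => ?_, fun w t ht => ?_⟩
  · rw [hC, hN' _ fun r hr => ?_]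
    · simp [E]
    · generalize hm : (w, ()) = m at hr
      cases hr with
      | gen u a g ρ h => exact h
      | comm u v a b g hab =>
        obtain ⟨rfl, -⟩ := Prod.mk.inj hm
        have := (List.pairwise_append.mp hw).2.1
        exact absurd (List.rel_of_pairwise_cons this (by simp)) (not_le.mpr hab)
  · rw [hC] at ht
    exact normalForm_perm B hN hN' (w, ()) (t, ()) (by simpa [E] using ht)

end

end Enveloping

/-! ### Models of the presentation -/

section Models

noncomputable section

variable {k : Type*} [Field k] {𝔤 : Type*} [LieRing 𝔤] [LieAlgebra k 𝔤] {ι : Type*}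
  {V : Type*} [AddCommGroup V] [Module k V] {G : Type*} [AddCommGroup G] [Module k G]

/-- A representation of the algebra `A` on `V`: operators `L_n^x`, `R_n^x` (linear in `x ∈ 𝔤`) and
`∂` subject to the relations of `A`. -/
structure Rep (k : Type*) [Field k] (𝔤 : Type*) [LieRing 𝔤] [LieAlgebra k 𝔤]
    (V : Type*) [AddCommGroup V] [Module k V] where
  L : ℕ → 𝔤 →ₗ[k] Module.End k V
  R : ℕ → 𝔤 →ₗ[k] Module.End k V
  D : Module.End k V
  L_D : ∀ n x v, L n x (D v) = D (L n x v) + (n : k) • L (n - 1) x v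
  R_D : ∀ n x v, R n x (D v) = D (R n x v) + (n : k) • R (n - 1) x v
  R_L : ∀ n m x y v, R n x (L m y v) = L m y (R n x v)
  L_L : ∀ n m x y v, L n x (L m y v) = L m y (L n x v) + L (n + m) ⁅x, y⁆ v

/-- A representation of `A` with vectors `X x` (linear in `x ∈ 𝔤`) and `E` subject to the relations
of the generators of `U`. -/
structure Model (φ : LinearMap.BilinForm k 𝔤) (V : Type*) [AddCommGroup V] [Module k V] extends
    Rep k 𝔤 V where
  X : 𝔤 →ₗ[k] V
  E : V
  locL : ∀ n x y, 3 ≤ n → L n x (X y) = 0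
  locR : ∀ n x y, 3 ≤ n → R n x (X y) = 0
  L_E : ∀ n x, L n x E = 0
  R_E : ∀ n x, R n x E = 0
  D_E : D E = 0
  RL2 : ∀ x y, R 2 x (X y) = L 2 y (X x)
  RL1 : ∀ x y, R 1 x (X y) = - L 1 y (X x) + D (L 2 y (X x))
  RL0 : ∀ x y, R 0 x (X y) = L 0 y (X x) - D (L 1 y (X x)) + (1 / 2 : k) • D (D (L 2 y (X x)))
  comm0 : ∀ x y, R 0 x (X y) = L 0 x (X y) - X ⁅x, y⁆
  comm1 : ∀ x y, R 1 x (X y) = L 1 x (X y) - φ x y • E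
  comm2 : ∀ x y, R 2 x (X y) = L 2 x (X y)

/-- The operator of a letter. -/
def Rep.op (ρ : Rep k 𝔤 V) (b : Module.Basis ι k 𝔤) : Letter ι → Module.End k V
  | .L n a => ρ.L n (b a)
  | .d => ρ.D
  | .R n a => ρ.R n (b a)

/-- The vector of a generator. -/
def Model.gen {φ : LinearMap.BilinForm k 𝔤} (μ : Model φ V) (b : Module.Basis ι k 𝔤) : Gen ι → V
  | ⊥ => μ.E
  | (a : ι) => μ.X (b a)

section Lift

variable (b : Module.Basis ι k 𝔤)

theorem basis_sum_map (f : 𝔤 →ₗ[k] V) (v : 𝔤) :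
    ((b.repr v).sum fun i c => c • f (b i)) = f v := by
  conv_rhs => rw [← b.linearCombination_repr v, Finsupp.linearCombination_apply]
  rw [Finsupp.sum, Finsupp.sum, map_sum]
  simp

/-- The projection of the free algebra onto `A`. -/
def algMk : FreeAlgebra k (Letter ι) →ₐ[k] Alg b := RingQuot.mkAlgHom k (AlgRel b)

theorem algMk_ι (l : Letter ι) : algMk b (FreeAlgebra.ι k l) = letter b l := rfl

theorem algMk_eq {f g : FreeAlgebra k (Letter ι)} (h : AlgRel b f g) : algMk b f = algMk b g :=
  RingQuot.mkAlgHom_rel k h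

theorem Rep.exists_algHom (ρ : Rep k 𝔤 V) :
    ∃ F : Alg b →ₐ[k] Module.End k V, ∀ l, F (letter b l) = ρ.op b l := by
  let F₀ : FreeAlgebra k (Letter ι) →ₐ[k] Module.End k V := FreeAlgebra.lift k (ρ.op b)
  have hι : ∀ l, F₀ (FreeAlgebra.ι k l) = ρ.op b l := fun l => FreeAlgebra.lift_ι_apply _ _
  have hL : ∀ n v, F₀ (freeL b n v) = ρ.L n v := by
    intro n v
    rw [freeL, Finsupp.sum, map_sum, ← basis_sum_map b (ρ.L n) v, Finsupp.sum]
    exact Finset.sum_congr rfl fun i _ => by rw [map_smul, hι]; rfl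
  refine ⟨RingQuot.liftAlgHom k ⟨F₀, fun x y h => ?_⟩, fun l => ?_⟩
  · refine LinearMap.ext fun v => ?_
    cases h with
    | L_d n a =>
      simp only [map_mul, map_add, map_smul, hι]
      exact ρ.L_D n (b a) v
    | R_d n a =>
      simp only [map_mul, map_add, map_smul, hι]
      exact ρ.R_D n (b a) v
    | R_L n m a c =>
      simp only [map_mul, hι]
      exact ρ.R_L n m (b a) (b c) v
    | L_L n m a c =>
      simp only [map_mul, map_add, hι, hL]
      exact ρ.L_L n m (b a) (b c) v
  · exact (RingQuot.liftAlgHom_mkAlgHom_apply k _ _ _).trans (hι l)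

/-- The universal property of the envelope `U`. -/
theorem Model.exists_lift {φ : LinearMap.BilinForm k 𝔤} (μ : Model φ V) :
    ∃ F : Envelope b φ →ₗ[k] V, ∀ w y,
      F (toEnvelope b φ (Finsupp.single (w, y) 1)) = (w.map (μ.op b)).prod (μ.gen b y) := by
  obtain ⟨F, hF⟩ := μ.toRep.exists_algHom b
  let ev : (Gen ι →₀ Alg b) →ₗ[k] V :=
    Finsupp.lsum k fun y => (LinearMap.applyₗ (μ.gen b y)) ∘ₗ F.toLinearMap
  have hev : ∀ w y, ev (act b w y) = F w (μ.gen b y) := fun w y => by simp [ev, act]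
  have hsmul : ∀ (w : Alg b) f, ev (w • f) = F w (ev f) := by
    intro w f
    induction f using Finsupp.induction_linear with
    | zero => simp
    | add f g hf hg => simp only [smul_add, map_add, hf, hg]
    | single y u =>
      rw [Finsupp.smul_single, smul_eq_mul]
      change ev (act b (w * u) y) = F w (ev (act b u y))
      rw [hev, hev, map_mul]
      rfl
  have hvec : ∀ v, ev (vec b v) = μ.X v := by
    intro v
    rw [vec, Finsupp.sum, map_sum, ← basis_sum_map b μ.X v, Finsupp.sum]
    refine Finset.sum_congr rfl fun i _ => ?_
    rw [map_smul, hev, map_one]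
    rfl
  have hker : ∀ f ∈ Submodule.span (Alg b) {f | ModRel b φ f}, ev f = 0 := by
    intro f hf
    induction hf using Submodule.span_induction with
    | zero => exact map_zero _
    | add f g _ _ hf hg => rw [map_add, hf, hg, add_zero]
    | smul w f _ hf => rw [hsmul, hf, map_zero]
    | mem f hf =>
      cases hf with
      | locL n a c hn => rw [hev, hF]; exact μ.locL n _ _ hn
      | locR n a c hn => rw [hev, hF]; exact μ.locR n _ _ hn
      | L_e n a => rw [hev, hF]; exact μ.L_E n _
      | R_e n a => rw [hev, hF]; exact μ.R_E n _
      | d_e => rw [hev, hF]; exact μ.D_E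
      | RL2 a c => rw [map_sub, hev, hev, hF, hF, sub_eq_zero]; exact μ.RL2 _ _
      | RL1 a c =>
        rw [map_sub, map_add, hev, hev, hev, map_mul, hF, hF, hF, hF]
        have := μ.RL1 (b a) (b c)
        change μ.R 1 (b a) (μ.X (b c)) + μ.L 1 (b c) (μ.X (b a)) - μ.D (μ.L 2 (b c) (μ.X (b a))) = 0
        rw [this]
        abel
      | RL0 a c =>
        rw [map_sub, map_add, map_sub, map_smul, hev, hev, hev, hev, map_mul, map_mul, map_mul, hF,
          hF, hF, hF, hF]
        have := μ.RL0 (b a) (b c)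
        change μ.R 0 (b a) (μ.X (b c)) - μ.L 0 (b c) (μ.X (b a)) + μ.D (μ.L 1 (b c) (μ.X (b a)))
          - (1 / 2 : k) • μ.D (μ.D (μ.L 2 (b c) (μ.X (b a)))) = 0
        rw [this]
        abel
      | comm0 a c =>
        rw [map_add, map_sub, hev, hev, hvec, hF, hF]
        have := μ.comm0 (b a) (b c)
        change μ.R 0 (b a) (μ.X (b c)) - μ.L 0 (b a) (μ.X (b c)) + μ.X ⁅b a, b c⁆ = 0
        rw [this]
        abel
      | comm1 a c =>
        rw [map_add, map_sub, map_smul, hev, hev, hev, hF, hF, map_one]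
        have := μ.comm1 (b a) (b c)
        change μ.R 1 (b a) (μ.X (b c)) - μ.L 1 (b a) (μ.X (b c)) + φ (b a) (b c) • μ.E = 0
        rw [this]
        abel
      | comm2 a c => rw [map_sub, hev, hev, hF, hF, sub_eq_zero]; exact μ.comm2 _ _
  let F' : Envelope b φ →ₗ[k] V :=
    { toFun := Quotient.lift (fun f => ev f) (fun f g h => by
        have h' : f - g ∈ Submodule.span (Alg b) {f | ModRel b φ f} :=
          (Submodule.quotientRel_def _).mp h
        have := hker _ h'
        rwa [map_sub, sub_eq_zero] at this)
      map_add' := by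
        rintro ⟨f⟩ ⟨g⟩
        exact map_add ev f g
      map_smul' := by
        rintro c ⟨f⟩
        exact map_smul ev c f }
  refine ⟨F', fun w y => ?_⟩
  rw [toEnvelope, Finsupp.linearCombination_single, one_smul]
  change ev (act b _ y) = _
  rw [hev, map_list_prod, List.map_map]
  congr 3
  exact funext hF

end Lift

section Tautological

variable (b : Module.Basis ι k 𝔤) (φ : LinearMap.BilinForm k 𝔤)

/-- It suffices to check the relations of a model on a basis of `𝔤`. -/
def Model.ofBasis (L R : ℕ → 𝔤 →ₗ[k] Module.End k V) (D : Module.End k V) (X : 𝔤 →ₗ[k] V) (E : V)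
    (L_D : ∀ n i v, L n (b i) (D v) = D (L n (b i) v) + (n : k) • L (n - 1) (b i) v)
    (R_D : ∀ n i v, R n (b i) (D v) = D (R n (b i) v) + (n : k) • R (n - 1) (b i) v)
    (R_L : ∀ n m i j v, R n (b i) (L m (b j) v) = L m (b j) (R n (b i) v))
    (L_L : ∀ n m i j v,
      L n (b i) (L m (b j) v) = L m (b j) (L n (b i) v) + L (n + m) ⁅b i, b j⁆ v)
    (locL : ∀ n i j, 3 ≤ n → L n (b i) (X (b j)) = 0)
    (locR : ∀ n i j, 3 ≤ n → R n (b i) (X (b j)) = 0)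
    (L_E : ∀ n i, L n (b i) E = 0) (R_E : ∀ n i, R n (b i) E = 0) (D_E : D E = 0)
    (RL2 : ∀ i j, R 2 (b i) (X (b j)) = L 2 (b j) (X (b i)))
    (RL1 : ∀ i j, R 1 (b i) (X (b j)) = - L 1 (b j) (X (b i)) + D (L 2 (b j) (X (b i))))
    (RL0 : ∀ i j, R 0 (b i) (X (b j)) = L 0 (b j) (X (b i)) - D (L 1 (b j) (X (b i)))
      + (1 / 2 : k) • D (D (L 2 (b j) (X (b i)))))
    (comm0 : ∀ i j, R 0 (b i) (X (b j)) = L 0 (b i) (X (b j)) - X ⁅b i, b j⁆)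
    (comm1 : ∀ i j, R 1 (b i) (X (b j)) = L 1 (b i) (X (b j)) - φ (b i) (b j) • E)
    (comm2 : ∀ i j, R 2 (b i) (X (b j)) = L 2 (b i) (X (b j))) : Model φ V where
  L := L
  R := R
  D := D
  X := X
  E := E
  L_D n x v := by
    have : (L n).flip (D v) = D ∘ₗ (L n).flip v + (n : k) • (L (n - 1)).flip v :=
      b.ext fun i => L_D n i v
    exact LinearMap.congr_fun this x
  R_D n x v := by
    have : (R n).flip (D v) = D ∘ₗ (R n).flip v + (n : k) • (R (n - 1)).flip v :=
      b.ext fun i => R_D n i v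
    exact LinearMap.congr_fun this x
  R_L n m x y v := by
    have : (R n).compl₂ ((L m).flip v) = ((L m).compl₂ ((R n).flip v)).flip :=
      b.ext fun i => b.ext fun j => R_L n m i j v
    exact LinearMap.congr_fun₂ this x y
  L_L n m x y v := by
    have : (L n).compl₂ ((L m).flip v) = ((L m).compl₂ ((L n).flip v)).flip
        + (LieModule.toEnd k 𝔤 𝔤 : 𝔤 →ₗ[k] Module.End k 𝔤).compr₂ ((L (n + m)).flip v) :=
      b.ext fun i => b.ext fun j => L_L n m i j v
    exact LinearMap.congr_fun₂ this x y
  locL n x y hn := by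
    have : (L n).compl₂ X = 0 := b.ext fun i => b.ext fun j => locL n i j hn
    exact LinearMap.congr_fun₂ this x y
  locR n x y hn := by
    have : (R n).compl₂ X = 0 := b.ext fun i => b.ext fun j => locR n i j hn
    exact LinearMap.congr_fun₂ this x y
  L_E n x := by
    have : (L n).flip E = 0 := b.ext fun i => L_E n i
    exact LinearMap.congr_fun this x
  R_E n x := by
    have : (R n).flip E = 0 := b.ext fun i => R_E n i
    exact LinearMap.congr_fun this x
  D_E := D_E
  RL2 x y := by
    have : (R 2).compl₂ X = ((L 2).compl₂ X).flip := b.ext fun i => b.ext fun j => RL2 i j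
    exact LinearMap.congr_fun₂ this x y
  RL1 x y := by
    have : (R 1).compl₂ X = - ((L 1).compl₂ X).flip + ((L 2).compl₂ X).flip.compr₂ D :=
      b.ext fun i => b.ext fun j => RL1 i j
    exact LinearMap.congr_fun₂ this x y
  RL0 x y := by
    have : (R 0).compl₂ X = ((L 0).compl₂ X).flip - ((L 1).compl₂ X).flip.compr₂ D
        + (1 / 2 : k) • ((L 2).compl₂ X).flip.compr₂ (D * D) :=
      b.ext fun i => b.ext fun j => RL0 i j
    exact LinearMap.congr_fun₂ this x y
  comm0 x y := by
    have : (R 0).compl₂ X = (L 0).compl₂ X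
        - (LieModule.toEnd k 𝔤 𝔤 : 𝔤 →ₗ[k] Module.End k 𝔤).compr₂ X :=
      b.ext fun i => b.ext fun j => comm0 i j
    exact LinearMap.congr_fun₂ this x y
  comm1 x y := by
    have : (R 1).compl₂ X = (L 1).compl₂ X - φ.compr₂ (LinearMap.toSpanSingleton k V E) :=
      b.ext fun i => b.ext fun j => comm1 i j
    exact LinearMap.congr_fun₂ this x y
  comm2 x y := by
    have : (R 2).compl₂ X = (L 2).compl₂ X := b.ext fun i => b.ext fun j => comm2 i j
    exact LinearMap.congr_fun₂ this x y

/-- The generator `y` of `U`. -/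
def envGen (y : Gen ι) : Envelope b φ := Submodule.Quotient.mk (act b 1 y)

theorem mk_act (w : Alg b) (y : Gen ι) :
    (Submodule.Quotient.mk (act b w y) : Envelope b φ) = w • envGen b φ y := by
  rw [envGen, ← Submodule.Quotient.mk_smul]
  congr 1
  exact ((Finsupp.smul_single w y 1).trans (by rw [smul_eq_mul, mul_one]; rfl)).symm

theorem mk_vec (v : 𝔤) : (Submodule.Quotient.mk (vec b v) : Envelope b φ)
    = b.constr k (fun a => envGen b φ (x a)) v := by
  rw [Module.Basis.constr_apply]
  change (Submodule.mkQ _).restrictScalars k (vec b v) = _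
  rw [vec, Finsupp.sum, map_sum, Finsupp.sum]
  exact Finset.sum_congr rfl fun i _ => by rw [map_smul]; rfl

theorem mk_modRel {f : Gen ι →₀ Alg b} (h : ModRel b φ f) :
    (Submodule.Quotient.mk f : Envelope b φ) = 0 :=
  (Submodule.Quotient.mk_eq_zero _).mpr (Submodule.subset_span h)

/-- The action of a letter on `U`. -/
def envOp (l : Letter ι) : Module.End k (Envelope b φ) :=
  Algebra.lsmul k k (Envelope b φ) (letter b l)

theorem envOp_apply (l : Letter ι) (u : Envelope b φ) : envOp b φ l u = letter b l • u := rfl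

theorem algMk_freeL_smul (n : ℕ) (v : 𝔤) (u : Envelope b φ) :
    algMk b (freeL b n v) • u = b.constr k (fun a => envOp b φ (.L n a)) v u := by
  change Algebra.lsmul k k (Envelope b φ) (algMk b (freeL b n v)) u = _
  rw [Module.Basis.constr_apply, freeL, Finsupp.sum, map_sum, map_sum, Finsupp.sum]
  congr 1
  refine Finset.sum_congr rfl fun i _ => ?_
  rw [map_smul, map_smul]
  rfl

/-- The envelope itself, as a model of its presentation. -/
def envModel : Model φ (Envelope b φ) :=
  Model.ofBasis b φ (fun n => b.constr k fun a => envOp b φ (.L n a))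
    (fun n => b.constr k fun a => envOp b φ (.R n a)) (envOp b φ .d)
    (b.constr k fun a => envGen b φ (x a)) (envGen b φ e)
    (fun n i v => by
      have := congrArg (· • v) (algMk_eq b (.L_d n i))
      simp only [map_mul, map_add, map_smul, algMk_ι, add_smul, mul_smul, smul_assoc] at this
      simpa only [envOp_apply, Module.Basis.constr_basis] using this)
    (fun n i v => by
      have := congrArg (· • v) (algMk_eq b (.R_d n i))
      simp only [map_mul, map_add, map_smul, algMk_ι, add_smul, mul_smul, smul_assoc] at this
      simpa only [envOp_apply, Module.Basis.constr_basis] using this)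
    (fun n m i j v => by
      have := congrArg (· • v) (algMk_eq b (.R_L n m i j))
      simp only [map_mul, algMk_ι, mul_smul] at this
      simpa only [envOp_apply, Module.Basis.constr_basis] using this)
    (fun n m i j v => by
      have := congrArg (· • v) (algMk_eq b (.L_L n m i j))
      simp only [map_mul, map_add, algMk_ι, add_smul, mul_smul, algMk_freeL_smul] at this
      simpa only [envOp_apply, Module.Basis.constr_basis] using this)
    (fun n i j hn => by
      have := mk_modRel b φ (.locL n i j hn)
      simpa only [envOp_apply, Module.Basis.constr_basis, mk_act] using this)
    (fun n i j hn => by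
      have := mk_modRel b φ (.locR n i j hn)
      simpa only [envOp_apply, Module.Basis.constr_basis, mk_act] using this)
    (fun n i => by
      have := mk_modRel b φ (.L_e n i)
      simpa only [envOp_apply, Module.Basis.constr_basis, mk_act] using this)
    (fun n i => by
      have := mk_modRel b φ (.R_e n i)
      simpa only [envOp_apply, Module.Basis.constr_basis, mk_act] using this)
    (by simpa only [envOp_apply, mk_act] using mk_modRel b φ .d_e)
    (fun i j => by
      have := mk_modRel b φ (.RL2 i j)
      rw [Submodule.Quotient.mk_sub, mk_act, mk_act, sub_eq_zero] at this
      simpa only [envOp_apply, Module.Basis.constr_basis] using this)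
    (fun i j => by
      have := mk_modRel b φ (.RL1 i j)
      rw [Submodule.Quotient.mk_sub, Submodule.Quotient.mk_add, mk_act, mk_act, mk_act, mul_smul,
        sub_eq_zero, ← eq_sub_iff_add_eq, sub_eq_neg_add] at this
      simpa only [envOp_apply, Module.Basis.constr_basis] using this)
    (fun i j => by
      have := mk_modRel b φ (.RL0 i j)
      rw [Submodule.Quotient.mk_sub, Submodule.Quotient.mk_add, Submodule.Quotient.mk_sub,
        Submodule.Quotient.mk_smul, mk_act, mk_act, mk_act, mk_act, mul_smul, mul_smul, mul_smul,
        sub_eq_zero, ← eq_sub_iff_add_eq, sub_eq_iff_eq_add] at this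
      simp only [Module.Basis.constr_basis, envOp_apply]
      rw [this]
      abel)
    (fun i j => by
      have := mk_modRel b φ (.comm0 i j)
      rw [Submodule.Quotient.mk_add, Submodule.Quotient.mk_sub, mk_act, mk_act, mk_vec] at this
      simp only [Module.Basis.constr_basis, envOp_apply]
      rw [eq_sub_iff_add_eq, ← sub_eq_zero, ← this]
      abel)
    (fun i j => by
      have := mk_modRel b φ (.comm1 i j)
      rw [Submodule.Quotient.mk_add, Submodule.Quotient.mk_sub, Submodule.Quotient.mk_smul, mk_act,
        mk_act, mk_act, one_smul] at this
      simp only [Module.Basis.constr_basis, envOp_apply]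
      rw [eq_sub_iff_add_eq, ← sub_eq_zero, ← this]
      abel)
    (fun i j => by
      have := mk_modRel b φ (.comm2 i j)
      rw [Submodule.Quotient.mk_sub, mk_act, mk_act, sub_eq_zero] at this
      simpa only [envOp_apply, Module.Basis.constr_basis] using this)

theorem toEnvelope_single (w : List (Letter ι)) (y : Gen ι) :
    toEnvelope b φ (Finsupp.single (w, y) 1)
      = (w.map ((envModel b φ).op b)).prod ((envModel b φ).gen b y) := by
  have hop : ∀ l, (envModel b φ).op b l = envOp b φ l := by
    rintro (⟨n, a⟩ | _ | ⟨n, a⟩)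
    · exact b.constr_basis k _ a
    · rfl
    · exact b.constr_basis k _ a
  have hgen : (envModel b φ).gen b y = envGen b φ y := by
    rcases y with _ | a
    · rfl
    · exact b.constr_basis k _ a
  rw [toEnvelope, Finsupp.linearCombination_single, one_smul, mk_act, hgen]
  change Algebra.lsmul k k (Envelope b φ) _ _ = _
  rw [map_list_prod, List.map_map]
  congr 3
  exact funext fun l => (hop l).symm

theorem toEnvelope_surjective : Function.Surjective (toEnvelope b φ) := by
  have hword : ∀ (w : FreeAlgebra k (Letter ι)) y,
      (Submodule.Quotient.mk (act b (algMk b w) y) : Envelope b φ) ∈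
        LinearMap.range (toEnvelope b φ) := by
    intro w y
    rw [mk_act]
    have hspan : w ∈ (⊤ : Submodule k (FreeAlgebra k (Letter ι))) := trivial
    rw [← FreeAlgebra.basisFreeMonoid k (Letter ι) |>.span_eq] at hspan
    induction hspan using Submodule.span_induction with
    | zero =>
      rw [map_zero, zero_smul]
      exact Submodule.zero_mem _
    | add f g _ _ hf hg =>
      rw [map_add, add_smul]
      exact Submodule.add_mem _ hf hg
    | smul c f _ hf =>
      rw [map_smul, smul_assoc]
      exact Submodule.smul_mem _ c hf
    | mem f hf =>
      obtain ⟨w, rfl⟩ := hf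
      refine ⟨Finsupp.single (w.toList, y) 1, ?_⟩
      rw [toEnvelope, Finsupp.linearCombination_single, one_smul, mk_act]
      congr 1
      have : FreeAlgebra.basisFreeMonoid k (Letter ι) w
          = (w.toList.map (FreeAlgebra.ι k)).prod := by
        simp [FreeAlgebra.basisFreeMonoid, FreeAlgebra.equivMonoidAlgebraFreeMonoid,
          FreeMonoid.lift_apply]
      rw [this, map_list_prod, List.map_map]
      rfl
  intro u
  obtain ⟨f, rfl⟩ := Submodule.Quotient.mk_surjective _ u
  change _ ∈ LinearMap.range (toEnvelope b φ)
  induction f using Finsupp.induction_linear with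
  | zero => exact Submodule.zero_mem _
  | add f g hf hg => exact Submodule.add_mem _ hf hg
  | single y w =>
    obtain ⟨w, rfl⟩ := RingQuot.mkAlgHom_surjective k (AlgRel b) w
    exact hword w y

end Tautological

end

end Models

/-! ### Relations valid in every model -/

section Relations

variable {k : Type*} [Field k] [CharZero k] {𝔤 : Type*} [LieRing 𝔤] [LieAlgebra k 𝔤]
  {V : Type*} [AddCommGroup V] [Module k V] {φ : LinearMap.BilinForm k 𝔤} (μ : Model φ V)

namespace Model

omit [CharZero k] in
theorem L2_symm (x y : 𝔤) : μ.L 2 x (μ.X y) = μ.L 2 y (μ.X x) := by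
  rw [← μ.comm2, μ.RL2]

omit [CharZero k] in
/-- The two expressions for `R_1^x y` agree. -/
theorem D_L2 (x y : 𝔤) :
    μ.D (μ.L 2 x (μ.X y)) = μ.L 1 x (μ.X y) + μ.L 1 y (μ.X x) - φ x y • μ.E := by
  have h1 := μ.RL1 x y
  rw [μ.comm1] at h1
  rw [μ.L2_symm]
  linear_combination (norm := module) -h1

omit [CharZero k] in
theorem L1_D (x : 𝔤) (v : V) : μ.L 1 x (μ.D v) = μ.D (μ.L 1 x v) + μ.L 0 x v := by
  simpa using μ.L_D 1 x v

omit [CharZero k] in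
theorem L0_D (x : 𝔤) (v : V) : μ.L 0 x (μ.D v) = μ.D (μ.L 0 x v) := by
  simpa using μ.L_D 0 x v

omit [CharZero k] in
theorem L2_D (x : 𝔤) (v : V) : μ.L 2 x (μ.D v) = μ.D (μ.L 2 x v) + (2 : k) • μ.L 1 x v := by
  simpa using μ.L_D 2 x v

omit [CharZero k] in
theorem L3_D (x : 𝔤) (v : V) : μ.L 3 x (μ.D v) = μ.D (μ.L 3 x v) + (3 : k) • μ.L 2 x v := by
  simpa using μ.L_D 3 x v

/-- The two expressions for `R_0^x y` agree. -/
theorem D_L1_sub (x y : 𝔤) :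
    μ.D (μ.L 1 x (μ.X y)) - μ.D (μ.L 1 y (μ.X x))
      = (2 : k) • (μ.L 0 x (μ.X y) - μ.L 0 y (μ.X x) - μ.X ⁅x, y⁆) := by
  have h1 := μ.RL0 x y
  rw [μ.comm0, μ.D_L2, map_sub, map_add, map_smul, μ.D_E] at h1
  linear_combination (norm := module) (-2 : k) • h1

theorem L1_D_X (x y : 𝔤) :
    μ.L 1 x (μ.D (μ.X y)) = μ.L 1 y (μ.D (μ.X x)) + (3 : k) • μ.L 0 x (μ.X y)
      - (3 : k) • μ.L 0 y (μ.X x) - (2 : k) • μ.X ⁅x, y⁆ := by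
  rw [μ.L1_D, μ.L1_D]
  linear_combination (norm := module) μ.D_L1_sub x y

omit [CharZero k] in
theorem D_D_pow (v : V) (s : ℕ) : μ.D ((μ.D ^ s) v) = (μ.D ^ (s + 1)) v := by
  rw [pow_succ', Module.End.mul_apply]

omit [CharZero k] in
theorem D_pow_D (v : V) (s : ℕ) : (μ.D ^ s) (μ.D v) = (μ.D ^ (s + 1)) v := by
  rw [pow_succ, Module.End.mul_apply]

omit [CharZero k] in
theorem L1_D_pow (x : 𝔤) (v : V) (s : ℕ) :
    μ.L 1 x ((μ.D ^ (s + 1)) v)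
      = (μ.D ^ (s + 1)) (μ.L 1 x v) + ((s : k) + 1) • μ.L 0 x ((μ.D ^ s) v) := by
  induction s with
  | zero => simp [μ.L1_D]
  | succ s ih =>
    rw [← μ.D_D_pow, μ.L1_D, ih, map_add, map_smul, ← μ.L0_D, μ.D_D_pow, μ.D_D_pow]
    push_cast
    module

omit [CharZero k] in
theorem L0_D_pow (x : 𝔤) (v : V) (s : ℕ) : μ.L 0 x ((μ.D ^ s) v) = (μ.D ^ s) (μ.L 0 x v) := by
  induction s with
  | zero => simp
  | succ s ih => rw [← μ.D_D_pow, μ.L0_D, ih, μ.D_D_pow]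

theorem L1_D_pow_X (x y : 𝔤) (s : ℕ) :
    μ.L 1 x ((μ.D ^ (s + 1)) (μ.X y)) = μ.L 1 y ((μ.D ^ (s + 1)) (μ.X x))
      - ((s : k) + 3) • μ.L 0 y ((μ.D ^ s) (μ.X x)) + ((s : k) + 3) • μ.L 0 x ((μ.D ^ s) (μ.X y))
      - (2 : k) • (μ.D ^ s) (μ.X ⁅x, y⁆) := by
  have h := congrArg (μ.D ^ s) (μ.D_L1_sub x y)
  rw [map_sub, map_smul, map_sub, map_sub, μ.D_pow_D, μ.D_pow_D, ← μ.L0_D_pow, ← μ.L0_D_pow] at h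
  rw [μ.L1_D_pow, μ.L1_D_pow]
  linear_combination (norm := module) h

omit [CharZero k] in
theorem L3_L1_X (x y z : 𝔤) : μ.L 3 x (μ.L 1 y (μ.X z)) = 0 := by
  rw [μ.L_L, μ.locL 3 _ _ le_rfl, μ.locL _ _ _ (by norm_num), map_zero, add_zero]

/-- Applying `L_3` to the formula for `∂ L_2^y z` kills the right-hand side. -/
theorem L2_L2 (x y z : 𝔤) : μ.L 2 x (μ.L 2 y (μ.X z)) = 0 := by
  have h := congrArg (μ.L 3 x) (μ.D_L2 y z)
  rw [μ.L3_D, μ.L_L 3 2, μ.locL 3 _ _ le_rfl, μ.locL _ _ _ (by norm_num), map_sub,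
    (μ.L 3 x).map_add, map_smul, μ.L3_L1_X, μ.L3_L1_X, μ.L_E] at h
  have : (3 : k) ≠ 0 := by norm_num
  simpa [this] using h

omit [CharZero k] in
theorem L2_L1_X (x y z : 𝔤) : μ.L 2 x (μ.L 1 y (μ.X z)) = μ.L 1 y (μ.L 2 x (μ.X z)) := by
  rw [μ.L_L, μ.locL (2 + 1) _ _ le_rfl, add_zero]

/-- Applying `L_2^x` to the formula for `∂ L_2^y z`. -/
theorem L1_L2_sum (x y z : 𝔤) :
    (2 : k) • μ.L 1 x (μ.L 2 y (μ.X z))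
      = μ.L 1 y (μ.L 2 x (μ.X z)) + μ.L 1 z (μ.L 2 x (μ.X y)) := by
  have h := congrArg (μ.L 2 x) (μ.D_L2 y z)
  rw [μ.L2_D, μ.L2_L2, map_zero, zero_add, map_sub, map_add, map_smul, μ.L_E, μ.L2_L1_X,
    μ.L2_L1_X] at h
  rw [h]
  module

/-- `L_1^x L_2^y z` is symmetric in `x, y, z`. -/
theorem L1_L2_comm (x y z : 𝔤) :
    μ.L 1 x (μ.L 2 y (μ.X z)) = μ.L 1 y (μ.L 2 x (μ.X z)) := by
  have h1 := μ.L1_L2_sum x y z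
  have h2 := μ.L1_L2_sum y x z
  rw [μ.L2_symm y x] at h2
  have h3 : (3 : k) • (μ.L 1 x (μ.L 2 y (μ.X z)) - μ.L 1 y (μ.L 2 x (μ.X z))) = 0 := by
    linear_combination (norm := module) h1 - h2
  have : (3 : k) ≠ 0 := by norm_num
  exact sub_eq_zero.mp ((smul_eq_zero.mp h3).resolve_left this)

/-- Applying `L_2^x` to the formula for `∂ (L_1^y z - L_1^z y)`. -/
theorem L1_L1_sub (x y z : 𝔤) :
    μ.L 1 x (μ.L 1 y (μ.X z)) - μ.L 1 x (μ.L 1 z (μ.X y))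
      = μ.L 0 y (μ.L 2 x (μ.X z)) - μ.L 0 z (μ.L 2 x (μ.X y)) + μ.L 2 ⁅x, y⁆ (μ.X z)
        - μ.L 2 ⁅x, z⁆ (μ.X y) - μ.L 2 x (μ.X ⁅y, z⁆) := by
  have h := congrArg (μ.L 2 x) (μ.D_L1_sub y z)
  rw [map_sub, μ.L2_D, μ.L2_D, map_smul, map_sub, map_sub, μ.L_L 2 0, μ.L_L 2 0, μ.L2_L1_X,
    μ.L2_L1_X, μ.L1_L2_comm y, μ.L1_L2_comm z, μ.L2_symm y z] at h
  simp only [add_zero] at h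
  have h2 : (2 : k) ≠ 0 := by norm_num
  refine smul_right_injective V h2 ?_
  change (2 : k) • _ = (2 : k) • _
  linear_combination (norm := module) h

/-- The relation behind the last rule: the cyclic sum of the equations obtained from the formula
for `∂ (L_1^y z - L_1^z y)` by `L_1^x`. -/
theorem L0_L1_cyclic (hsymm : ∀ u v : 𝔤, φ u v = φ v u)
    (hinv : ∀ u v w : 𝔤, φ ⁅u, v⁆ w = φ u ⁅v, w⁆) (x y z : 𝔤) :
    μ.L 0 x (μ.L 1 y (μ.X z)) = μ.L 0 x (μ.L 1 z (μ.X y)) + μ.L 0 y (μ.L 1 x (μ.X z))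
      + μ.L 0 z (μ.L 1 y (μ.X x)) - μ.L 0 y (μ.L 1 z (μ.X x)) - μ.L 0 z (μ.L 1 x (μ.X y))
      + μ.L 1 ⁅z, x⁆ (μ.X y) + μ.L 1 ⁅x, y⁆ (μ.X z) + μ.L 1 ⁅y, z⁆ (μ.X x)
      - μ.L 1 z (μ.X ⁅x, y⁆) - μ.L 1 x (μ.X ⁅y, z⁆) - μ.L 1 y (μ.X ⁅z, x⁆)
      + φ x ⁅y, z⁆ • μ.E := by
  have key : ∀ a b c : 𝔤, μ.D (μ.L 0 b (μ.L 2 a (μ.X c)) - μ.L 0 c (μ.L 2 a (μ.X b)))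
      + μ.D (μ.L 2 ⁅a, b⁆ (μ.X c) + μ.L 2 ⁅c, a⁆ (μ.X b) - μ.L 2 a (μ.X ⁅b, c⁆))
      + μ.L 0 a (μ.L 1 b (μ.X c)) - μ.L 0 a (μ.L 1 c (μ.X b))
      = (2 : k) • (μ.L 0 b (μ.L 1 a (μ.X c)) - μ.L 0 c (μ.L 1 a (μ.X b))
        + μ.L 1 ⁅a, b⁆ (μ.X c) + μ.L 1 ⁅c, a⁆ (μ.X b) - μ.L 1 a (μ.X ⁅b, c⁆)) := by
    intro a b c
    have h := congrArg (μ.L 1 a) (μ.D_L1_sub b c)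
    have h' := μ.L1_L1_sub a b c
    rw [← lie_skew a c, map_neg, LinearMap.neg_apply] at h'
    rw [map_sub, μ.L1_D, μ.L1_D, map_smul, map_sub, map_sub, μ.L_L 1 0, μ.L_L 1 0,
      ← lie_skew a c, map_neg, LinearMap.neg_apply] at h
    simp only [add_zero] at h
    have h'' := congrArg μ.D h'
    simp only [map_sub, map_add, map_neg] at h'' ⊢
    linear_combination (norm := module) h - h''
  have h1 := key x y z
  have h2 := key y z x
  have h3 := key z x y
  simp only [map_sub, map_add, μ.D_L2] at h1 h2 h3
  simp only [← μ.L0_D, μ.L2_symm z y, μ.L2_symm z x, μ.L2_symm y x] at h1 h2 h3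
  have e1 : φ ⁅x, y⁆ z = φ x ⁅y, z⁆ := hinv x y z
  have e2 : φ ⁅z, x⁆ y = φ x ⁅y, z⁆ := by rw [hsymm, ← hinv y z x, hsymm]
  have e3 : φ ⁅y, z⁆ x = φ x ⁅y, z⁆ := hsymm _ _
  have e4 : φ y ⁅z, x⁆ = φ x ⁅y, z⁆ := by rw [hsymm, e2]
  have e5 : φ z ⁅x, y⁆ = φ x ⁅y, z⁆ := by rw [hsymm, e1]
  rw [e1, e2] at h1
  rw [e1, e3, e4] at h2
  rw [e2, e3, e5] at h3
  have h4 : (3 : k) ≠ 0 := by norm_num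
  refine smul_right_injective V h4 ?_
  change (3 : k) • _ = (3 : k) • _
  linear_combination (norm := module) h1 + h2 + h3

end Model

end Relations

/-! ### Representations on power series -/

section Sequences

noncomputable section

variable {k : Type*} [Field k] {𝔤 : Type*} [LieRing 𝔤] [LieAlgebra k 𝔤]
  {V : Type*} [AddCommGroup V] [Module k V] {G : Type*} [AddCommGroup G] [Module k G]

/-- An operator applied to every coefficient of a power series. -/
def coeffwise : Module.End k G →ₐ[k] Module.End k (ℕ → G) where
  toFun f := LinearMap.compLeft f ℕ
  map_one' := rfl
  map_mul' _ _ := rfl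
  map_zero' := rfl
  map_add' _ _ := rfl
  commutes' _ := rfl

@[simp] theorem coeffwise_apply (f : Module.End k G) (p : ℕ → G) (s : ℕ) :
    coeffwise f p s = f (p s) := rfl

variable (k G) in
/-- The derivative of power series. -/
def seqDeriv : Module.End k (ℕ → G) where
  toFun p s := ((s : k) + 1) • p (s + 1)
  map_add' p q := by ext s; simp
  map_smul' c p := by ext s; simp [smul_comm c]

variable (k G) in
/-- Multiplication of power series by the variable. -/
def seqShift : Module.End k (ℕ → G) where
  toFun p s := match s with
    | 0 => 0
    | s + 1 => p s
  map_add' p q := by ext (_ | s) <;> simp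
  map_smul' c p := by ext (_ | s) <;> simp

@[simp] theorem seq_shift_zero (p : ℕ → G) : seqShift k G p 0 = 0 := rfl

@[simp] theorem seq_shift_succ (p : ℕ → G) (s : ℕ) : seqShift k G p (s + 1) = p s := rfl

theorem seq_deriv_apply (p : ℕ → G) (s : ℕ) : seqDeriv k G p s = ((s : k) + 1) • p (s + 1) := rfl

theorem seq_deriv_pow_apply (n : ℕ) (p : ℕ → G) (s : ℕ) :
    (seqDeriv k G ^ n) p s = ((s + 1).ascFactorial n : k) • p (s + n) := by
  induction n generalizing p with
  | zero => simp
  | succ n ih =>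
    rw [pow_succ, Module.End.mul_apply, ih, seq_deriv_apply, smul_smul, Nat.ascFactorial_succ]
    push_cast
    congr 1
    ring

theorem seq_deriv_mul_coeffwise (f : Module.End k G) :
    seqDeriv k G * coeffwise f = coeffwise f * seqDeriv k G := by
  refine LinearMap.ext fun p => funext fun s => ?_
  simp [seq_deriv_apply]

theorem seq_shift_mul_coeffwise (f : Module.End k G) :
    seqShift k G * coeffwise f = coeffwise f * seqShift k G := by
  refine LinearMap.ext fun p => funext fun s => ?_
  cases s <;> simp

theorem seq_deriv_mul_shift : seqDeriv k G * seqShift k G = seqShift k G * seqDeriv k G + 1 := by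
  refine LinearMap.ext fun p => funext fun s => ?_
  cases s with
  | zero => simp [seq_deriv_apply]
  | succ s => simp [seq_deriv_apply, add_smul]

theorem seq_deriv_pow_mul_shift (n : ℕ) :
    seqDeriv k G ^ n * seqShift k G = seqShift k G * seqDeriv k G ^ n + (n : k) • seqDeriv k G ^ (n - 1) := by
  induction n with
  | zero => simp
  | succ n ih =>
    rw [pow_succ', mul_assoc, ih, mul_add, ← mul_assoc, seq_deriv_mul_shift, add_mul, one_mul,
      mul_assoc, mul_smul_comm, add_assoc]
    congr 1
    cases n with
    | zero => simp
    | succ n =>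
      rw [Nat.add_sub_cancel, Nat.add_sub_cancel, ← pow_succ']
      push_cast
      module

/-- The operator `l(x) Dⁿ + n ε(x) Dⁿ⁻¹` on power series. -/
def seqOp (l ε : 𝔤 →ₗ[k] Module.End k G) (n : ℕ) : 𝔤 →ₗ[k] Module.End k (ℕ → G) :=
  LinearMap.mulRight k (seqDeriv k G ^ n) ∘ₗ coeffwise.toLinearMap ∘ₗ l
    + (n : k) • (LinearMap.mulRight k (seqDeriv k G ^ (n - 1)) ∘ₗ coeffwise.toLinearMap ∘ₗ ε)

theorem seqOp_eq (l ε : 𝔤 →ₗ[k] Module.End k G) (n : ℕ) (x : 𝔤) :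
    seqOp l ε n x = coeffwise (l x) * seqDeriv k G ^ n
      + (n : k) • (coeffwise (ε x) * seqDeriv k G ^ (n - 1)) := rfl

theorem seqOp_apply (l ε : 𝔤 →ₗ[k] Module.End k G) (n : ℕ) (x : 𝔤) (p : ℕ → G) (s : ℕ) :
    seqOp l ε n x p s = ((s + 1).ascFactorial n : k) • l x (p (s + n))
      + (n : k) • ((s + 1).ascFactorial (n - 1) : k) • ε x (p (s + (n - 1))) := by
  simp [seqOp_eq, seq_deriv_pow_apply]

theorem seqOp_zero_apply (l ε : 𝔤 →ₗ[k] Module.End k G) (x : 𝔤) (p : ℕ → G) (s : ℕ) :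
    seqOp l ε 0 x p s = l x (p s) := by
  simp [seqOp_apply]

theorem seqOp_one_apply (l ε : 𝔤 →ₗ[k] Module.End k G) (x : 𝔤) (p : ℕ → G) (s : ℕ) :
    seqOp l ε 1 x p s = ((s : k) + 1) • l x (p (s + 1)) + ε x (p s) := by
  simp [seqOp_apply, Nat.ascFactorial_succ]

theorem seqOp_mul_shift (l ε : 𝔤 →ₗ[k] Module.End k G) (n : ℕ) (x : 𝔤) :
    seqOp l ε n x * seqShift k G = seqShift k G * seqOp l ε n x + (n : k) • seqOp l ε (n - 1) x := by
  simp only [seqOp_eq, add_mul, smul_mul_assoc, mul_assoc, seq_deriv_pow_mul_shift, mul_add,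
    mul_smul_comm, ← mul_assoc (seqShift k G), seq_shift_mul_coeffwise]
  cases n with
  | zero => simp
  | succ n =>
    rw [Nat.add_sub_cancel]
    module

/-- The product of two operators `a Pⁿ + n b Pⁿ⁻¹`, where `P` commutes with the coefficients of the
second. -/
theorem pow_op_mul {A : Type*} [Ring A] [Algebra k A] {P a b a' b' : A} (ha : P * a' = a' * P)
    (hb : P * b' = b' * P) (n m : ℕ) :
    (a * P ^ n + (n : k) • (b * P ^ (n - 1))) * (a' * P ^ m + (m : k) • (b' * P ^ (m - 1)))
      = a * a' * P ^ (n + m) + (m : k) • (a * b' * P ^ (n + m - 1))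
        + (n : k) • (b * a' * P ^ (n + m - 1)) + ((n : k) * m) • (b * b' * P ^ (n + m - 2)) := by
  have ha' : ∀ (c : A) i j, c * P ^ i * (a' * P ^ j) = c * a' * P ^ (i + j) := fun c i j => by
    rw [pow_add, mul_assoc, ← mul_assoc (P ^ i), (Commute.pow_left ha i).eq]
    simp only [mul_assoc]
  have hb' : ∀ (c : A) i j, c * P ^ i * (b' * P ^ j) = c * b' * P ^ (i + j) := fun c i j => by
    rw [pow_add, mul_assoc, ← mul_assoc (P ^ i), (Commute.pow_left hb i).eq]
    simp only [mul_assoc]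
  simp only [add_mul, mul_add, smul_mul_assoc, mul_smul_comm, ha', hb']
  rcases n with _ | n <;> rcases m with _ | m
  · simp
  · simp [← add_assoc]
  · simp
  · have e1 : n + 1 + (m + 1 - 1) = n + 1 + (m + 1) - 1 := by omega
    have e2 : n + 1 - 1 + (m + 1) = n + 1 + (m + 1) - 1 := by omega
    have e3 : n + 1 - 1 + (m + 1 - 1) = n + 1 + (m + 1) - 2 := by omega
    rw [e1, e2, e3]
    module

theorem seqOp_comm {l ε r η : 𝔤 →ₗ[k] Module.End k G}
    (lr : ∀ x y, r x * l y = l y * r x) (er : ∀ x y, r x * ε y = ε y * r x)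
    (lη : ∀ x y, η x * l y = l y * η x) (eη : ∀ x y, η x * ε y = ε y * η x)
    (n m : ℕ) (x y : 𝔤) : seqOp r η n x * seqOp l ε m y = seqOp l ε m y * seqOp r η n x := by
  simp only [seqOp_eq]
  rw [pow_op_mul (seq_deriv_mul_coeffwise _) (seq_deriv_mul_coeffwise _),
    pow_op_mul (seq_deriv_mul_coeffwise _) (seq_deriv_mul_coeffwise _)]
  simp only [← map_mul, lr, er, lη, eη, add_comm m n, mul_comm (m : k)]
  abel

theorem seqOp_lie {l ε : 𝔤 →ₗ[k] Module.End k G}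
    (ll : ∀ x y, l ⁅x, y⁆ = l x * l y - l y * l x)
    (le : ∀ x y, ε ⁅x, y⁆ = l x * ε y - ε y * l x)
    (ee : ∀ x y, ε x * ε y = ε y * ε x)
    (n m : ℕ) (x y : 𝔤) :
    seqOp l ε n x * seqOp l ε m y = seqOp l ε m y * seqOp l ε n x + seqOp l ε (n + m) ⁅x, y⁆ := by
  have le' : l y * ε x = ε x * l y - ε ⁅x, y⁆ := by
    rw [← lie_skew, map_neg, le]
    abel
  have le'' : l x * ε y = ε y * l x + ε ⁅x, y⁆ := by
    rw [le]
    abel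
  have ll' : l x * l y = l y * l x + l ⁅x, y⁆ := by
    rw [ll]
    abel
  simp only [seqOp_eq]
  rw [pow_op_mul (seq_deriv_mul_coeffwise _) (seq_deriv_mul_coeffwise _),
    pow_op_mul (seq_deriv_mul_coeffwise _) (seq_deriv_mul_coeffwise _)]
  simp only [← map_mul, le', le'', ll', ee y x, map_sub, map_add, add_comm m n, add_mul, sub_mul]
  push_cast
  module

/-- Commuting left and right actions of `𝔤 ⋉ ε𝔤` on `G` make `G[[∂]]` a representation of `A`:
`L_n^x = x Dⁿ + n εx Dⁿ⁻¹`, where `D` is the derivative in `∂`, and the same formula, with right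
multiplications, for `R_n^x`. -/
def seqRep (l ε r η : 𝔤 →ₗ[k] Module.End k G)
    (ll : ∀ x y, l ⁅x, y⁆ = l x * l y - l y * l x)
    (le : ∀ x y, ε ⁅x, y⁆ = l x * ε y - ε y * l x)
    (ee : ∀ x y, ε x * ε y = ε y * ε x)
    (lr : ∀ x y, r x * l y = l y * r x) (er : ∀ x y, r x * ε y = ε y * r x)
    (lη : ∀ x y, η x * l y = l y * η x) (eη : ∀ x y, η x * ε y = ε y * η x) :
    Rep k 𝔤 (ℕ → G) where
  L := seqOp l ε
  R := seqOp r η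
  D := seqShift k G
  L_D n x v := LinearMap.congr_fun (seqOp_mul_shift l ε n x) v
  R_D n x v := LinearMap.congr_fun (seqOp_mul_shift r η n x) v
  R_L n m x y v := LinearMap.congr_fun (seqOp_comm lr er lη eη n m x y) v
  L_L n m x y v := LinearMap.congr_fun (seqOp_lie ll le ee n m x y) v

/-- The representation on a quotient by an invariant subspace. -/
def Rep.quot (ρ : Rep k 𝔤 V) (K : Submodule k V) (hL : ∀ n x, K ≤ K.comap (ρ.L n x))
    (hR : ∀ n x, K ≤ K.comap (ρ.R n x)) (hD : K ≤ K.comap ρ.D) : Rep k 𝔤 (V ⧸ K) where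
  L n :=
    { toFun := fun x => K.mapQ K (ρ.L n x) (hL n x)
      map_add' := fun x y => Submodule.linearMap_qext _ (LinearMap.ext fun v => by simp)
      map_smul' := fun c x => Submodule.linearMap_qext _ (LinearMap.ext fun v => by simp) }
  R n :=
    { toFun := fun x => K.mapQ K (ρ.R n x) (hR n x)
      map_add' := fun x y => Submodule.linearMap_qext _ (LinearMap.ext fun v => by simp)
      map_smul' := fun c x => Submodule.linearMap_qext _ (LinearMap.ext fun v => by simp) }
  D := K.mapQ K ρ.D hD
  L_D n x v := by
    obtain ⟨v, rfl⟩ := K.mkQ_surjective v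
    exact congrArg K.mkQ (ρ.L_D n x v)
  R_D n x v := by
    obtain ⟨v, rfl⟩ := K.mkQ_surjective v
    exact congrArg K.mkQ (ρ.R_D n x v)
  R_L n m x y v := by
    obtain ⟨v, rfl⟩ := K.mkQ_surjective v
    exact congrArg K.mkQ (ρ.R_L n m x y v)
  L_L n m x y v := by
    obtain ⟨v, rfl⟩ := K.mkQ_surjective v
    exact congrArg K.mkQ (ρ.L_L n m x y v)

end

end Sequences

/-! ### The model over the Takiff algebra -/

section AlgebraModel

noncomputable section

variable {k : Type*} [Field k] {𝔤 : Type*} [LieRing 𝔤] [LieAlgebra k 𝔤]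
  {G : Type*} [AddCommGroup G] [Module k G]

/-- The power series `p₀ + p₁ ∂ + p₂ ∂²`. -/
def seq₃ (p₀ p₁ p₂ : G) : ℕ → G
  | 0 => p₀
  | 1 => p₁
  | 2 => p₂
  | _ => 0

theorem seq₃_add (p₀ p₁ p₂ q₀ q₁ q₂ : G) :
    seq₃ p₀ p₁ p₂ + seq₃ q₀ q₁ q₂ = seq₃ (p₀ + q₀) (p₁ + q₁) (p₂ + q₂) := by
  ext (_ | _ | _ | s) <;> simp [seq₃]

theorem seq₃_sub (p₀ p₁ p₂ q₀ q₁ q₂ : G) :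
    seq₃ p₀ p₁ p₂ - seq₃ q₀ q₁ q₂ = seq₃ (p₀ - q₀) (p₁ - q₁) (p₂ - q₂) := by
  ext (_ | _ | _ | s) <;> simp [seq₃]

theorem seq₃_neg (p₀ p₁ p₂ : G) : - seq₃ p₀ p₁ p₂ = seq₃ (-p₀) (-p₁) (-p₂) := by
  ext (_ | _ | _ | s) <;> simp [seq₃]

theorem seq₃_smul (c : k) (p₀ p₁ p₂ : G) : c • seq₃ p₀ p₁ p₂ = seq₃ (c • p₀) (c • p₁) (c • p₂) := by
  ext (_ | _ | _ | s) <;> simp [seq₃]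

theorem seqShift_seq₃ (p₀ p₁ : G) : seqShift k G (seq₃ p₀ p₁ 0) = seq₃ 0 p₀ p₁ := by
  ext (_ | _ | _ | _ | s) <;> simp [seq₃]

theorem seqOp_zero_seq₃ (l ε : 𝔤 →ₗ[k] Module.End k G) (x : 𝔤) (p₀ p₁ p₂ : G) :
    seqOp l ε 0 x (seq₃ p₀ p₁ p₂) = seq₃ (l x p₀) (l x p₁) (l x p₂) := by
  ext (_ | _ | _ | s) <;> simp [seq₃, seqOp_zero_apply]

theorem seqOp_one_seq₃ (l ε : 𝔤 →ₗ[k] Module.End k G) (x : 𝔤) (p₀ p₁ : G) :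
    seqOp l ε 1 x (seq₃ p₀ p₁ 0) = seq₃ (l x p₁ + ε x p₀) (ε x p₁) 0 := by
  ext (_ | _ | _ | s) <;> simp [seq₃, seqOp_one_apply]

theorem seqOp_two_seq₃ (l ε : 𝔤 →ₗ[k] Module.End k G) (x : 𝔤) (p₀ p₁ : G) :
    seqOp l ε 2 x (seq₃ p₀ p₁ 0) = seq₃ ((2 : k) • ε x p₁) 0 0 := by
  ext (_ | _ | _ | s) <;> simp [seq₃, seqOp_apply, Nat.ascFactorial_succ]

theorem seqOp_seq₃_of_three_le (l ε : 𝔤 →ₗ[k] Module.End k G) {n : ℕ} (hn : 3 ≤ n) (x : 𝔤)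
    (p₀ p₁ : G) : seqOp l ε n x (seq₃ p₀ p₁ 0) = 0 := by
  obtain ⟨n, rfl⟩ := Nat.exists_eq_add_of_le' hn
  funext s
  have h1 : seq₃ p₀ p₁ 0 (s + (n + 3)) = 0 := rfl
  have h2 : seq₃ p₀ p₁ 0 (s + (n + 2)) = 0 := by
    cases h : s + n with
    | zero => rw [← add_assoc, h]; rfl
    | succ m => rw [← add_assoc, h]; rfl
  rw [seqOp_apply, h1, show n + 3 - 1 = n + 2 from rfl, h2]
  simp

variable {A : Type*} [Ring A] [Algebra k A] [CharZero k]

/-- An algebra with elements `T x`, `S x` (`x ∈ 𝔤`) satisfying the commutation relations of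
`𝔤 ⋉ ε𝔤` gives a model in which `e` is zero: the generator `x` goes to `(∂ S x - T x) / 2`. -/
def algModel (φ : LinearMap.BilinForm k 𝔤) (T S : 𝔤 →ₗ[k] A)
    (hT : ∀ x y, T ⁅x, y⁆ = T x * T y - T y * T x) (hS : ∀ x y, S ⁅x, y⁆ = T x * S y - S y * T x)
    (hSS : ∀ x y, S x * S y = S y * S x) : Model φ (ℕ → A) where
  toRep := seqRep (LinearMap.mul k A ∘ₗ T) (LinearMap.mul k A ∘ₗ S)
    ((LinearMap.mul k A).flip ∘ₗ T) ((LinearMap.mul k A).flip ∘ₗ S)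
    (fun x y => LinearMap.ext fun v => by simp [hT, mul_assoc])
    (fun x y => LinearMap.ext fun v => by simp [hS, mul_assoc])
    (fun x y => LinearMap.ext fun v => by simp [← mul_assoc, hSS x y])
    (fun x y => LinearMap.ext fun v => by simp [mul_assoc])
    (fun x y => LinearMap.ext fun v => by simp [mul_assoc])
    (fun x y => LinearMap.ext fun v => by simp [mul_assoc])
    (fun x y => LinearMap.ext fun v => by simp [mul_assoc])
  X :=
    { toFun := fun x => seq₃ (-((1 / 2 : k) • T x)) ((1 / 2 : k) • S x) 0
      map_add' := fun x y => by simp [seq₃_add, add_comm]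
      map_smul' := fun c x => by simp [seq₃_smul, smul_comm c] }
  E := 0
  locL n x y hn := seqOp_seq₃_of_three_le _ _ hn x _ _
  locR n x y hn := seqOp_seq₃_of_three_le _ _ hn x _ _
  L_E n x := map_zero _
  R_E n x := map_zero _
  D_E := map_zero _
  RL2 x y := by
    refine (seqOp_two_seq₃ _ _ _ _ _).trans (Eq.trans ?_ (seqOp_two_seq₃ _ _ _ _ _).symm)
    simp
  RL1 x y := by
    change seqOp _ _ 1 x (seq₃ _ _ 0) = - seqOp _ _ 1 y (seq₃ _ _ 0)
      + seqShift k A (seqOp _ _ 2 y (seq₃ _ _ 0))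
    rw [seqOp_one_seq₃, seqOp_one_seq₃, seqOp_two_seq₃, seqShift_seq₃, seq₃_neg, seq₃_add]
    congr 1
    · simp only [LinearMap.comp_apply, LinearMap.flip_apply, LinearMap.mul_apply', neg_mul, mul_neg,
        smul_mul_assoc, mul_smul_comm]
      module
    · simp only [LinearMap.comp_apply, LinearMap.flip_apply, LinearMap.mul_apply', smul_mul_assoc,
        mul_smul_comm]
      module
    · simp
  RL0 x y := by
    change seqOp _ _ 0 x (seq₃ _ _ 0) = seqOp _ _ 0 y (seq₃ _ _ 0)
      - seqShift k A (seqOp _ _ 1 y (seq₃ _ _ 0))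
      + (1 / 2 : k) • seqShift k A (seqShift k A (seqOp _ _ 2 y (seq₃ _ _ 0)))
    have e : ∀ z : A, (1 / 2 : k) • seq₃ 0 0 z = seq₃ 0 0 ((1 / 2 : k) • z) := fun z => by
      ext (_ | _ | _ | s) <;> simp [seq₃]
    rw [seqOp_zero_seq₃, seqOp_zero_seq₃, seqOp_one_seq₃, seqOp_two_seq₃, seqShift_seq₃,
      seqShift_seq₃, seqShift_seq₃, e, seq₃_sub, seq₃_add]
    simp only [LinearMap.comp_apply, LinearMap.flip_apply, LinearMap.mul_apply', neg_mul, mul_neg,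
        smul_mul_assoc, mul_smul_comm, mul_zero, zero_mul]
    congr 1
    · module
    · module
    · module
  comm0 x y := by
    change seqOp _ _ 0 x (seq₃ _ _ 0) = seqOp _ _ 0 x (seq₃ _ _ 0) - seq₃ _ _ 0
    rw [seqOp_zero_seq₃, seqOp_zero_seq₃, seq₃_sub, hT, hS]
    simp only [LinearMap.comp_apply, LinearMap.flip_apply, LinearMap.mul_apply', neg_mul, mul_neg,
        smul_mul_assoc, mul_smul_comm, mul_zero, zero_mul]
    congr 1
    · module
    · module
    · module
  comm1 x y := by
    change seqOp _ _ 1 x (seq₃ _ _ 0) = seqOp _ _ 1 x (seq₃ _ _ 0) - φ x y • 0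
    have h2 := hS y x
    rw [← lie_skew, map_neg, hS] at h2
    rw [seqOp_one_seq₃, seqOp_one_seq₃, smul_zero, sub_zero]
    simp only [LinearMap.comp_apply, LinearMap.flip_apply, LinearMap.mul_apply', neg_mul, mul_neg,
        smul_mul_assoc, mul_smul_comm, hSS y x]
    congr 1
    linear_combination (norm := module) (1 / 2 : k) • h2
  comm2 x y := by
    refine (seqOp_two_seq₃ _ _ _ _ _).trans (Eq.trans ?_ (seqOp_two_seq₃ _ _ _ _ _).symm)
    simp [hSS y x]

end

end AlgebraModel

section Takiff

/-- The Takiff Lie algebra `𝔤 ⊗ k[ε]/ε² = 𝔤 ⊕ ε𝔤`. -/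
def Takiff (𝔤 : Type*) : Type _ := 𝔤 × 𝔤

/-- The element `x + εy`. -/
def Takiff.mk {𝔤 : Type*} (x y : 𝔤) : Takiff 𝔤 := (x, y)

variable {k : Type*} [Field k] {𝔤 : Type*} [LieRing 𝔤] [LieAlgebra k 𝔤]

instance : AddCommGroup (Takiff 𝔤) := inferInstanceAs (AddCommGroup (𝔤 × 𝔤))

instance : Module k (Takiff 𝔤) := inferInstanceAs (Module k (𝔤 × 𝔤))

/-- The bracket `[x + εy, x' + εy'] = [x, x'] + ε([x, y'] + [y, x'])`. -/
instance : LieRing (Takiff 𝔤) where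
  bracket p q := (⁅p.1, q.1⁆, ⁅p.1, q.2⁆ + ⁅p.2, q.1⁆)
  add_lie p q r := Prod.ext (add_lie _ _ _) <| by
    change ⁅p.1 + q.1, r.2⁆ + ⁅p.2 + q.2, r.1⁆ = ⁅p.1, r.2⁆ + ⁅p.2, r.1⁆ + (⁅q.1, r.2⁆ + ⁅q.2, r.1⁆)
    simp only [add_lie]
    abel
  lie_add p q r := Prod.ext (lie_add _ _ _) <| by
    change ⁅p.1, q.2 + r.2⁆ + ⁅p.2, q.1 + r.1⁆ = ⁅p.1, q.2⁆ + ⁅p.2, q.1⁆ + (⁅p.1, r.2⁆ + ⁅p.2, r.1⁆)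
    simp only [lie_add]
    abel
  lie_self p := Prod.ext (lie_self _) <| by
    change ⁅p.1, p.2⁆ + ⁅p.2, p.1⁆ = 0
    rw [← lie_skew]
    abel
  leibniz_lie p q r := Prod.ext (leibniz_lie _ _ _) <| by
    change ⁅p.1, ⁅q.1, r.2⁆ + ⁅q.2, r.1⁆⁆ + ⁅p.2, ⁅q.1, r.1⁆⁆
      = ⁅⁅p.1, q.1⁆, r.2⁆ + ⁅⁅p.1, q.2⁆ + ⁅p.2, q.1⁆, r.1⁆
        + (⁅q.1, ⁅p.1, r.2⁆ + ⁅p.2, r.1⁆⁆ + ⁅q.2, ⁅p.1, r.1⁆⁆)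
    simp only [lie_add, add_lie, leibniz_lie p.1, leibniz_lie p.2]
    abel

instance : LieAlgebra k (Takiff 𝔤) where
  lie_smul c p q := Prod.ext (lie_smul _ _ _) <| by
    change ⁅p.1, c • q.2⁆ + ⁅p.2, c • q.1⁆ = c • (⁅p.1, q.2⁆ + ⁅p.2, q.1⁆)
    simp only [lie_smul, smul_add]

theorem Takiff.mk_lie_mk (x y x' y' : 𝔤) :
    ⁅Takiff.mk x y, Takiff.mk x' y'⁆ = Takiff.mk ⁅x, x'⁆ (⁅x, y'⁆ + ⁅y, x'⁆) := rfl

section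

attribute [local instance] LieRing.ofAssociativeRing

variable (k 𝔤)

/-- `𝔤` inside the enveloping algebra of the Takiff algebra. -/
noncomputable def takT : 𝔤 →ₗ[k] UniversalEnvelopingAlgebra k (Takiff 𝔤) :=
  (UniversalEnvelopingAlgebra.ι k : Takiff 𝔤 →ₗ⁅k⁆ _).toLinearMap ∘ₗ LinearMap.inl k 𝔤 𝔤

/-- `ε𝔤` inside the enveloping algebra of the Takiff algebra. -/
noncomputable def takS : 𝔤 →ₗ[k] UniversalEnvelopingAlgebra k (Takiff 𝔤) :=
  (UniversalEnvelopingAlgebra.ι k : Takiff 𝔤 →ₗ⁅k⁆ _).toLinearMap ∘ₗ LinearMap.inr k 𝔤 𝔤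

end

theorem takT_apply (x : 𝔤) :
    takT k 𝔤 x = UniversalEnvelopingAlgebra.ι k (Takiff.mk x 0) := rfl

theorem takS_apply (x : 𝔤) :
    takS k 𝔤 x = UniversalEnvelopingAlgebra.ι k (Takiff.mk 0 x) := rfl

theorem takT_lie (x y : 𝔤) :
    takT k 𝔤 ⁅x, y⁆ = takT k 𝔤 x * takT k 𝔤 y - takT k 𝔤 y * takT k 𝔤 x := by
  rw [takT_apply, takT_apply, takT_apply, ← envelope_ι_lie, Takiff.mk_lie_mk, lie_zero, zero_lie,
    add_zero]

theorem takS_lie (x y : 𝔤) :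
    takS k 𝔤 ⁅x, y⁆ = takT k 𝔤 x * takS k 𝔤 y - takS k 𝔤 y * takT k 𝔤 x := by
  rw [takS_apply, takS_apply, takT_apply, ← envelope_ι_lie, Takiff.mk_lie_mk, lie_zero, zero_lie,
    add_zero]

theorem takS_mul_takS (x y : 𝔤) : takS k 𝔤 x * takS k 𝔤 y = takS k 𝔤 y * takS k 𝔤 x := by
  rw [← sub_eq_zero, takS_apply, takS_apply, ← envelope_ι_lie, Takiff.mk_lie_mk, lie_zero,
    zero_lie, lie_zero, add_zero]
  exact map_zero (takT k 𝔤)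

variable {ι : Type*} [LinearOrder ι] [WellFoundedLT ι]

instance : WellFoundedLT (ι ⊕ₗ ι) := ⟨Sum.lex_wf wellFounded_lt wellFounded_lt⟩

/-- The letters `a` and `εa` of the Takiff algebra, the former being smaller. -/
abbrev takLetters (u v : List ι) : List (ι ⊕ₗ ι) := u.map Sum.inlₗ ++ v.map Sum.inrₗ

/-- Coordinates on the enveloping algebra of the Takiff algebra: the products of sorted words in
`𝔤` and sorted words in `ε𝔤` are independent, and any word is a combination of its permutations
and shorter words. -/
theorem exists_takiff_coordinates (b : Module.Basis ι k 𝔤) :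
    ∃ C : UniversalEnvelopingAlgebra k (Takiff 𝔤) →ₗ[k] (List (ι ⊕ₗ ι) →₀ k),
      (∀ u v : List ι, u.Pairwise (· ≤ ·) → v.Pairwise (· ≤ ·) →
        C ((u.map fun i => takT k 𝔤 (b i)).prod * (v.map fun i => takS k 𝔤 (b i)).prod)
          = Finsupp.single (takLetters u v) 1) ∧
      ∀ (u v : List ι) (t : List (ι ⊕ₗ ι)),
        C ((u.map fun i => takT k 𝔤 (b i)).prod * (v.map fun i => takS k 𝔤 (b i)).prod) t ≠ 0 →
        t.Perm (takLetters u v) ∨ t.length < u.length + v.length := by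
  let B₀ : Module.Basis (ι ⊕ ι) k (Takiff 𝔤) := b.prod b
  let B : Module.Basis (ι ⊕ₗ ι) k (Takiff 𝔤) := B₀.reindex toLex
  obtain ⟨C, hC, hC'⟩ := exists_pbw_coordinates B
  have hl : ∀ i, B (Sum.inlₗ i) = Takiff.mk (b i) 0 := fun i =>
    (B₀.reindex_apply toLex _).trans (Prod.ext (b.prod_apply_inl_fst b i) (b.prod_apply_inl_snd b i))
  have hr : ∀ i, B (Sum.inrₗ i) = Takiff.mk 0 (b i) := fun i =>
    (B₀.reindex_apply toLex _).trans (Prod.ext (b.prod_apply_inr_fst b i) (b.prod_apply_inr_snd b i))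
  have hprod : ∀ u v : List ι, (u.map fun i => takT k 𝔤 (b i)).prod
      * (v.map fun i => takS k 𝔤 (b i)).prod
      = ((takLetters u v).map fun i => UniversalEnvelopingAlgebra.ι k (B i)).prod := by
    intro u v
    rw [List.map_append, List.prod_append, List.map_map, List.map_map]
    congr 3
    · exact funext fun i => by rw [takT_apply, Function.comp_apply, hl]
    · exact funext fun i => by rw [takS_apply, Function.comp_apply, hr]
  refine ⟨C, fun u v hu hv => ?_, fun u v t ht => ?_⟩
  · rw [hprod, hC]
    refine List.pairwise_append.mpr ⟨?_, ?_, ?_⟩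
    · exact hu.map _ fun i j h => Sum.Lex.inl_le_inl_iff.mpr h
    · exact hv.map _ fun i j h => Sum.Lex.inr_le_inr_iff.mpr h
    · intro s hs t ht
      obtain ⟨i, -, rfl⟩ := List.mem_map.mp hs
      obtain ⟨j, -, rfl⟩ := List.mem_map.mp ht
      exact Sum.Lex.inl_le_inr i j
  · rw [hprod] at ht
    simpa using hC' _ t ht

end Takiff

/-! ### Irreducible monomials -/

section NormalForms

/-- The irreducible monomials other than `e`: with `u`, `bs` sorted words,
`pw u bs s c` is `L_0^u L_1^{bs} ∂^s c`, `two u bs a c` is `L_0^u L_1^{bs} L_2^a c`, and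
`one u b c` is `L_0^u L_1^b c` with `c < b`. -/
inductive NormalForm (ι : Type*) where
  | pw (u bs : List ι) (s : ℕ) (c : ι) : NormalForm ι
  | two (u bs : List ι) (a c : ι) : NormalForm ι
  | one (u : List ι) (b c : ι) : NormalForm ι

namespace NormalForm

variable {ι : Type*}

/-- The conditions on the indices of an irreducible monomial. -/
def Valid [LinearOrder ι] : NormalForm ι → Prop
  | pw u bs _ c => u.Pairwise (· ≤ ·) ∧ (bs ++ [c]).Pairwise (· ≤ ·)
  | two u bs a c => u.Pairwise (· ≤ ·) ∧ (bs ++ [a, c]).Pairwise (· ≤ ·)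
  | one u b c => (u ++ [b]).Pairwise (· ≤ ·) ∧ c < b

/-- The monomial of a normal form. -/
def mon : NormalForm ι → Mon ι
  | pw u bs s c => (u.map (Letter.L 0) ++ (bs.map (Letter.L 1) ++ List.replicate s .d), x c)
  | two u bs a c => (u.map (Letter.L 0) ++ (bs.map (Letter.L 1) ++ [Letter.L 2 a]), x c)
  | one u b c => (u.map (Letter.L 0) ++ [Letter.L 1 b], x c)

theorem R_not_mem (n : NormalForm ι) (m : ℕ) (a : ι) : Letter.R m a ∉ n.mon.1 := by
  cases n <;> simp [mon, List.mem_replicate]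

end NormalForm

section

variable {k : Type*} [Field k] {𝔤 : Type*} [LieRing 𝔤] [LieAlgebra k 𝔤] {ι : Type*} [LinearOrder ι]
  (b : Module.Basis ι k 𝔤) (φ : LinearMap.BilinForm k 𝔤)

variable {b φ} in
theorem Irreducible.tail {l : Letter ι} {w : List (Letter ι)} {y : Gen ι}
    (h : Irreducible (Rule b φ) (l :: w, y)) : Irreducible (Rule b φ) (w, y) := by
  rintro r hr
  generalize hm : (w, y) = m at hr
  cases hr with
  | alg u v w' y' r' h' =>
    obtain ⟨rfl, rfl⟩ := Prod.mk.inj hm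
    exact h _ (Rule.alg (l :: u) v w' y r' h')
  | mod u w' y' r' h' =>
    obtain ⟨rfl, rfl⟩ := Prod.mk.inj hm
    exact h _ (Rule.mod (l :: u) w' y r' h')

variable {b φ} in
theorem Irreducible.not_algRule {w v : List (Letter ι)} {y : Gen ι} {r}
    (h : Irreducible (Rule b φ) (w ++ v, y)) : ¬ AlgRule b w r :=
  fun h' => h _ (Rule.alg [] v w y r h')

variable {b φ} in
theorem Irreducible.not_modRule {w : List (Letter ι)} {y : Gen ι} {r}
    (h : Irreducible (Rule b φ) (w, y)) : ¬ ModRule b φ (w, y) r :=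
  fun h' => h _ (Rule.mod [] w y r h')

variable {b φ} in
theorem Irreducible.not_algRule₂ {l l' : Letter ι} {v : List (Letter ι)} {y : Gen ι} {r}
    (h : Irreducible (Rule b φ) (l :: l' :: v, y)) : ¬ AlgRule b [l, l'] r :=
  Irreducible.not_algRule (w := [l, l']) h

variable {b φ} in
theorem Irreducible.L_L_le {n m : ℕ} {a c : ι} {v : List (Letter ι)} {y : Gen ι}
    (h : Irreducible (Rule b φ) (.L n a :: .L m c :: v, y)) : n < m ∨ n = m ∧ a ≤ c := by
  by_contra hcon
  push Not at hcon
  refine h.not_algRule₂ (.L_L n m a c ?_)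
  rcases hcon.1.lt_or_eq with h1 | h1
  · exact Or.inl h1
  · exact Or.inr ⟨h1, hcon.2 h1.symm⟩

open NormalForm in
/-- Irreducible monomials are in normal form. -/
theorem exists_normalForm_of_irreducible (m : Mon ι) (h : Irreducible (Rule b φ) m) :
    m = ([], e) ∨ ∃ n : NormalForm ι, n.Valid ∧ n.mon = m := by
  obtain ⟨w, y⟩ := m
  induction w with
  | nil =>
    rcases y with _ | c
    · exact Or.inl rfl
    · exact Or.inr ⟨pw [] [] 0 c, by simp [Valid], rfl⟩
  | cons l w ih =>
    right
    rcases ih h.tail with hw | ⟨n, hn, hw⟩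
    · obtain ⟨rfl, rfl⟩ := Prod.mk.inj hw
      rcases l with ⟨n, a⟩ | _ | ⟨n, a⟩
      · exact absurd (ModRule.L_e n a) h.not_modRule
      · exact absurd ModRule.d_e h.not_modRule
      · exact absurd (ModRule.R_e n a) h.not_modRule
    · -- `R` moves to the right past every other letter and then acts on the generator.
      have hR : ∀ p a, l = .R p a → False := by
        rintro p a rfl
        rcases w with _ | ⟨⟨m, c⟩ | _ | ⟨m, c⟩, w⟩
        · rcases y with _ | c
          · exact h.not_modRule (.R_e p a)
          · rcases p with _ | _ | _ | p
            · exact h.not_modRule (.R0 a c)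
            · exact h.not_modRule (.R1 a c)
            · exact h.not_modRule (.R2 a c)
            · exact h.not_modRule (.locR (p + 3) a c (by omega))
        · exact h.not_algRule₂ (.R_L p m a c)
        · exact h.not_algRule₂ (.R_d p a)
        · refine n.R_not_mem m c ?_
          rw [hw]
          exact List.mem_cons_self
      rcases n with ⟨u, bs, s, c⟩ | ⟨u, bs, a', c⟩ | ⟨u, b', c⟩
      · obtain ⟨rfl, rfl⟩ := Prod.mk.inj hw
        obtain ⟨hu, hbs⟩ := hn
        rcases l with ⟨_ | _ | n, a⟩ | _ | ⟨n, a⟩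
        · refine ⟨pw (a :: u) bs s c, ⟨?_, hbs⟩, rfl⟩
          rcases u with _ | ⟨a₁, u⟩
          · simp
          · have := h.L_L_le
            simp only [lt_irrefl, true_and, false_or] at this
            exact List.isChain_iff_pairwise.mp
              (List.isChain_cons_cons.mpr ⟨this, List.isChain_iff_pairwise.mpr hu⟩)
        · rcases u with _ | ⟨a₁, u⟩
          swap
          · exact absurd h.L_L_le (by simp)
          rcases bs with _ | ⟨b₁, bs⟩
          · rcases s with _ | _ | s
            · rcases le_or_gt a c with hac | hac
              · exact ⟨pw [] [a] 0 c, by simpa [Valid] using hac, rfl⟩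
              · exact ⟨one [] a c, by simpa [Valid] using hac, rfl⟩
            · rcases le_or_gt a c with hac | hac
              · exact ⟨pw [] [a] 1 c, by simpa [Valid] using hac, rfl⟩
              · exact absurd (ModRule.L1_d a c hac) h.not_modRule
            · rcases le_or_gt a c with hac | hac
              · exact ⟨pw [] [a] (s + 2) c, by simpa [Valid] using hac, rfl⟩
              · exact absurd (ModRule.L1_ds (s + 2) a c (by omega) hac) h.not_modRule
          · refine ⟨pw [] (a :: b₁ :: bs) s c, ⟨hu, ?_⟩, rfl⟩
            have := h.L_L_le
            simp only [lt_irrefl, true_and, false_or] at this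
            exact List.isChain_iff_pairwise.mp
              (List.isChain_cons_cons.mpr ⟨this, List.isChain_iff_pairwise.mpr hbs⟩)
        · rcases u with _ | ⟨a₁, u⟩
          swap
          · exact absurd h.L_L_le (by simp)
          rcases bs with _ | ⟨b₁, bs⟩
          swap
          · exact absurd h.L_L_le (by simp)
          rcases s with _ | s
          swap
          · exact absurd (AlgRule.L_d (n + 2) a (by omega)) h.not_algRule₂
          rcases n with _ | n
          · rcases le_or_gt a c with hac | hac
            · exact ⟨two [] [] a c, by simpa [Valid] using hac, rfl⟩
            · exact absurd (ModRule.L2 a c hac) h.not_modRule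
          · exact absurd (ModRule.locL (n + 3) a c (by omega)) h.not_modRule
        · rcases u with _ | ⟨a₁, u⟩
          swap
          · exact absurd (AlgRule.d_L0 a₁) h.not_algRule₂
          rcases bs with _ | ⟨b₁, bs⟩
          swap
          · exact absurd (AlgRule.d_L1 b₁) h.not_algRule₂
          exact ⟨pw [] [] (s + 1) c, ⟨hu, hbs⟩, rfl⟩
        · exact (hR _ _ rfl).elim
      · obtain ⟨rfl, rfl⟩ := Prod.mk.inj hw
        obtain ⟨hu, hbs⟩ := hn
        rcases l with ⟨_ | _ | n, a⟩ | _ | ⟨n, a⟩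
        · refine ⟨two (a :: u) bs a' c, ⟨?_, hbs⟩, rfl⟩
          rcases u with _ | ⟨a₁, u⟩
          · simp
          · have := h.L_L_le
            simp only [lt_irrefl, true_and, false_or] at this
            exact List.isChain_iff_pairwise.mp
              (List.isChain_cons_cons.mpr ⟨this, List.isChain_iff_pairwise.mpr hu⟩)
        · rcases u with _ | ⟨a₁, u⟩
          swap
          · exact absurd h.L_L_le (by simp)
          rcases bs with _ | ⟨b₁, bs⟩
          · have hac : a' ≤ c := by simpa using hbs
            rcases le_or_gt a a' with h1 | h1
            · exact ⟨two [] [a] a' c, by simpa [Valid] using ⟨⟨h1, h1.trans hac⟩, hac⟩, rfl⟩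
            · rcases le_or_gt a c with h2 | h2
              · exact absurd (ModRule.L1_L2' a a' c h1 h2) h.not_modRule
              · exact absurd (ModRule.L1_L2 a a' c hac h2) h.not_modRule
          · refine ⟨two [] (a :: b₁ :: bs) a' c, ⟨hu, ?_⟩, rfl⟩
            have := h.L_L_le
            simp only [lt_irrefl, true_and, false_or] at this
            exact List.isChain_iff_pairwise.mp
              (List.isChain_cons_cons.mpr ⟨this, List.isChain_iff_pairwise.mpr hbs⟩)
        · rcases u with _ | ⟨a₁, u⟩
          swap
          · exact absurd h.L_L_le (by simp)
          rcases bs with _ | ⟨b₁, bs⟩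
          swap
          · exact absurd h.L_L_le (by simp)
          rcases n with _ | n
          · exact absurd (ModRule.L2_L2 a a' c) h.not_modRule
          · exact absurd h.L_L_le (by simp)
        · rcases u with _ | ⟨a₁, u⟩
          swap
          · exact absurd (AlgRule.d_L0 a₁) h.not_algRule₂
          rcases bs with _ | ⟨b₁, bs⟩
          swap
          · exact absurd (AlgRule.d_L1 b₁) h.not_algRule₂
          exact absurd (ModRule.d_L2 a' c) h.not_modRule
        · exact (hR _ _ rfl).elim
      · obtain ⟨rfl, rfl⟩ := Prod.mk.inj hw
        obtain ⟨hu, hcb⟩ := hn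
        rcases l with ⟨_ | _ | n, a⟩ | _ | ⟨n, a⟩
        · refine ⟨one (a :: u) b' c, ⟨?_, hcb⟩, rfl⟩
          rcases u with _ | ⟨a₁, u⟩
          · rcases le_or_gt a b' with h1 | h1
            · simpa using h1
            · exact absurd (ModRule.L0_L1 a b' c hcb h1) h.not_modRule
          · have := h.L_L_le
            simp only [lt_irrefl, true_and, false_or] at this
            exact List.isChain_iff_pairwise.mp
              (List.isChain_cons_cons.mpr ⟨this, List.isChain_iff_pairwise.mpr hu⟩)
        · rcases u with _ | ⟨a₁, u⟩
          swap
          · exact absurd h.L_L_le (by simp)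
          have hab := h.L_L_le
          simp only [lt_irrefl, true_and, false_or] at hab
          rcases le_or_gt a c with h1 | h1
          · exact absurd (ModRule.L1_L1 a b' c h1 hcb) h.not_modRule
          · exact absurd (ModRule.L1_L1' a b' c h1 hab) h.not_modRule
        · rcases u with _ | ⟨a₁, u⟩ <;> exact absurd h.L_L_le (by simp)
        · rcases u with _ | ⟨a₁, u⟩
          · exact absurd (AlgRule.d_L1 b') h.not_algRule₂
          · exact absurd (AlgRule.d_L0 a₁) h.not_algRule₂
        · exact (hR _ _ rfl).elim

end

end NormalForms

/-! ### Independence of the normal forms modulo `e` -/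

section Independence

noncomputable section

variable {k : Type*} [Field k]

/-- Vectors are independent if they can be ranked so that each is detected by a functional that
vanishes on the other vectors of at most the same rank. -/
theorem linearIndependent_of_rank {I V Γ : Type*} [AddCommGroup V] [Module k V] [LinearOrder Γ]
    (v : I → V) (rank : I → Γ) (F : I → V →ₗ[k] k) (h1 : ∀ i, F i (v i) ≠ 0)
    (h0 : ∀ i j, j ≠ i → rank j ≤ rank i → F i (v j) = 0) : LinearIndependent k v := by
  classical
  refine linearIndependent_iff.mpr fun f hf => ?_
  by_contra hne
  obtain ⟨i, hi, hmax⟩ := f.support.exists_max_image rank (Finsupp.support_nonempty_iff.mpr hne)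
  have := congrArg (F i) hf
  rw [Finsupp.linearCombination_apply, Finsupp.sum, map_sum, map_zero,
    Finset.sum_eq_single_of_mem i hi] at this
  · rw [map_smul, smul_eq_mul] at this
    exact (mul_ne_zero (Finsupp.mem_support_iff.mp hi) (h1 i)) this
  · intro j hj hji
    rw [map_smul, h0 i j hji (hmax j hj), smul_zero]

section Words

theorem filterMap_getLeft_takLetters {ι : Type*} (u v : List ι) :
    (takLetters u v).filterMap (fun s => (ofLex s).getLeft?) = u := by
  have h1 : ∀ u : List ι, (u.map Sum.inlₗ).filterMap (fun s : ι ⊕ₗ ι => (ofLex s).getLeft?) = u := by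
    intro u
    rw [List.filterMap_map]
    exact List.filterMap_some
  have h2 : ∀ v : List ι, (v.map Sum.inrₗ).filterMap (fun s : ι ⊕ₗ ι => (ofLex s).getLeft?) = [] := by
    intro v
    rw [List.filterMap_map]
    exact List.filterMap_eq_nil_iff.mpr fun _ _ => rfl
  rw [takLetters, List.filterMap_append, h1, h2, List.append_nil]

theorem filterMap_getRight_takLetters {ι : Type*} (u v : List ι) :
    (takLetters u v).filterMap (fun s => (ofLex s).getRight?) = v := by
  have h1 : ∀ u : List ι, (u.map Sum.inrₗ).filterMap (fun s : ι ⊕ₗ ι => (ofLex s).getRight?) = u := by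
    intro u
    rw [List.filterMap_map]
    exact List.filterMap_some
  have h2 : ∀ v : List ι, (v.map Sum.inlₗ).filterMap (fun s : ι ⊕ₗ ι => (ofLex s).getRight?) = [] := by
    intro v
    rw [List.filterMap_map]
    exact List.filterMap_eq_nil_iff.mpr fun _ _ => rfl
  rw [takLetters, List.filterMap_append, h1, h2, List.nil_append]

theorem takLetters_inj {ι : Type*} {u v u' v' : List ι} :
    takLetters u v = takLetters u' v' ↔ u = u' ∧ v = v' := by
  refine ⟨fun h => ⟨?_, ?_⟩, fun ⟨h1, h2⟩ => by rw [h1, h2]⟩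
  · rw [← filterMap_getLeft_takLetters u v, h, filterMap_getLeft_takLetters]
  · rw [← filterMap_getRight_takLetters u v, h, filterMap_getRight_takLetters]

end Words

variable [CharZero k] {𝔤 : Type*} [LieRing 𝔤] [LieAlgebra k 𝔤] {ι : Type*}
  (b : Module.Basis ι k 𝔤) (φ : LinearMap.BilinForm k 𝔤)

section

variable {V : Type*} [AddCommGroup V] [Module k V] {φ}

/-- The image of a monomial in a model. -/
def Model.eval (μ : Model φ V) (m : Mon ι) : V := (m.1.map (μ.op b)).prod (μ.gen b m.2)

omit [CharZero k] in
theorem Model.eval_cons (μ : Model φ V) (l : Letter ι) (w : List (Letter ι)) (y : Gen ι) :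
    μ.eval b (l :: w, y) = μ.op b l (μ.eval b (w, y)) := by
  simp [eval]

end

variable (k 𝔤) in
/-- The model of `U / e` in power series over the enveloping algebra of the Takiff algebra. -/
abbrev takModel : Model φ (ℕ → UniversalEnvelopingAlgebra k (Takiff 𝔤)) :=
  algModel φ (takT k 𝔤) (takS k 𝔤) takT_lie takS_lie takS_mul_takS

/-- Products of elements of `𝔤`. -/
def prodT (u : List ι) : UniversalEnvelopingAlgebra k (Takiff 𝔤) :=
  (u.map fun i => takT k 𝔤 (b i)).prod

/-- Products of elements of `ε𝔤`. -/
def prodS (v : List ι) : UniversalEnvelopingAlgebra k (Takiff 𝔤) :=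
  (v.map fun i => takS k 𝔤 (b i)).prod

omit [CharZero k] in
theorem prodT_cons (i : ι) (u : List ι) : prodT b (i :: u) = takT k 𝔤 (b i) * prodT b u := by
  simp [prodT]

omit [CharZero k] in
theorem prodS_cons (i : ι) (u : List ι) : prodS b (i :: u) = takS k 𝔤 (b i) * prodS b u := by
  simp [prodS]

omit [CharZero k] in
theorem prodT_concat (u : List ι) (i : ι) : prodT b (u ++ [i]) = prodT b u * takT k 𝔤 (b i) := by
  simp [prodT]

theorem eval_L0 (u : List ι) (w : List (Letter ι)) (y : Gen ι) (s : ℕ) :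
    (takModel k 𝔤 φ).eval b (u.map (Letter.L 0) ++ w, y) s
      = prodT b u * (takModel k 𝔤 φ).eval b (w, y) s := by
  induction u with
  | nil => simp [prodT]
  | cons i u ih =>
    rw [List.map_cons, List.cons_append, Model.eval_cons, prodT_cons, mul_assoc, ← ih]
    exact seqOp_zero_apply _ _ _ _ _

theorem eval_L1 (bs : List ι) (w : List (Letter ι)) (y : Gen ι) (n : ℕ)
    (hn : ∀ s, n < s → (takModel k 𝔤 φ).eval b (w, y) s = 0) :
    (takModel k 𝔤 φ).eval b (bs.map (Letter.L 1) ++ w, y) n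
        = prodS b bs * (takModel k 𝔤 φ).eval b (w, y) n ∧
      ∀ s, n < s → (takModel k 𝔤 φ).eval b (bs.map (Letter.L 1) ++ w, y) s = 0 := by
  induction bs with
  | nil => exact ⟨by simp [prodS], hn⟩
  | cons i bs ih =>
    have key : ∀ s, (takModel k 𝔤 φ).eval b ((i :: bs).map (Letter.L 1) ++ w, y) s
        = ((s : k) + 1) • (LinearMap.mul k _ ∘ₗ takT k 𝔤) (b i)
            ((takModel k 𝔤 φ).eval b (bs.map (Letter.L 1) ++ w, y) (s + 1))
          + (LinearMap.mul k _ ∘ₗ takS k 𝔤) (b i)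
            ((takModel k 𝔤 φ).eval b (bs.map (Letter.L 1) ++ w, y) s) := fun s => by
      rw [List.map_cons, List.cons_append, Model.eval_cons]
      exact seqOp_one_apply _ _ _ _ _
    constructor
    · rw [key, ih.2 (n + 1) (by omega), ih.1, map_zero, smul_zero, zero_add, prodS_cons, mul_assoc]
      rfl
    · intro s hs
      rw [key, ih.2 (s + 1) (by omega), ih.2 s hs, map_zero, map_zero, smul_zero, zero_add]

theorem eval_d_pow (s : ℕ) (c : ι) :
    (takModel k 𝔤 φ).eval b (List.replicate s .d, x c) (s + 1) = (1 / 2 : k) • takS k 𝔤 (b c) ∧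
      ∀ t, s + 1 < t → (takModel k 𝔤 φ).eval b (List.replicate s .d, x c) t = 0 := by
  induction s with
  | zero =>
    refine ⟨rfl, fun t ht => ?_⟩
    obtain ⟨t, rfl⟩ := Nat.exists_eq_add_of_le' ht
    cases t <;> rfl
  | succ s ih =>
    rw [List.replicate_succ, Model.eval_cons]
    refine ⟨ih.1, fun t ht => ?_⟩
    obtain ⟨t, rfl⟩ := Nat.exists_eq_add_of_le' (Nat.zero_lt_of_lt ht)
    exact ih.2 t (by omega)

theorem eval_pw (u bs : List ι) (s : ℕ) (c : ι) :
    (takModel k 𝔤 φ).eval b (NormalForm.pw u bs s c).mon (s + 1)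
        = (1 / 2 : k) • (prodT b u * prodS b (bs ++ [c])) ∧
      ∀ t, s + 1 < t → (takModel k 𝔤 φ).eval b (NormalForm.pw u bs s c).mon t = 0 := by
  have h := eval_L1 b φ bs _ (x c) (s + 1) (eval_d_pow b φ s c).2
  refine ⟨?_, fun t ht => ?_⟩
  · rw [NormalForm.mon, eval_L0, h.1, (eval_d_pow b φ s c).1]
    simp [prodS]
  · rw [NormalForm.mon, eval_L0, h.2 t ht, mul_zero]

theorem eval_L2 (a c : ι) : (takModel k 𝔤 φ).eval b ([Letter.L 2 a], x c)
    = seq₃ (takS k 𝔤 (b a) * takS k 𝔤 (b c)) 0 0 := by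
  rw [Model.eval_cons]
  refine (seqOp_two_seq₃ _ _ _ _ _).trans ?_
  simp

theorem eval_two (u bs : List ι) (a c : ι) :
    (takModel k 𝔤 φ).eval b (NormalForm.two u bs a c).mon 0
        = prodT b u * prodS b (bs ++ [a, c]) ∧
      ∀ t, 0 < t → (takModel k 𝔤 φ).eval b (NormalForm.two u bs a c).mon t = 0 := by
  have h := eval_L1 b φ bs [Letter.L 2 a] (x c) 0 fun s hs => by
    rw [eval_L2]
    obtain ⟨t, rfl⟩ := Nat.exists_eq_add_of_le' hs
    rcases t with _ | _ | t <;> rfl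
  refine ⟨?_, fun t ht => ?_⟩
  · rw [NormalForm.mon, eval_L0, h.1, eval_L2]
    simp [prodS, seq₃]
  · rw [NormalForm.mon, eval_L0, h.2 t ht, mul_zero]

theorem eval_L1_sub (a c : ι) :
    (takModel k 𝔤 φ).eval b ([Letter.L 1 a], x c) - (takModel k 𝔤 φ).eval b ([Letter.L 1 c], x a)
      = seq₃ (takT k 𝔤 (b a) * takS k 𝔤 (b c) - takT k 𝔤 (b c) * takS k 𝔤 (b a)
        - takS k 𝔤 ⁅b a, b c⁆) 0 0 := by
  have h : ∀ a c, (takModel k 𝔤 φ).eval b ([Letter.L 1 a], x c)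
      = seq₃ ((LinearMap.mul k _ ∘ₗ takT k 𝔤) (b a) ((1 / 2 : k) • takS k 𝔤 (b c))
          + (LinearMap.mul k _ ∘ₗ takS k 𝔤) (b a) (-((1 / 2 : k) • takT k 𝔤 (b c))))
        ((LinearMap.mul k _ ∘ₗ takS k 𝔤) (b a) ((1 / 2 : k) • takS k 𝔤 (b c))) 0 := fun a c => by
    rw [Model.eval_cons]
    exact seqOp_one_seq₃ _ _ _ _ _
  rw [h, h, seq₃_sub]
  simp only [LinearMap.comp_apply, LinearMap.mul_apply', mul_neg, mul_smul_comm,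
    takS_mul_takS (b c) (b a), sub_self]
  congr 1
  have h1 := takS_lie (k := k) (b a) (b c)
  have h2 := takS_lie (k := k) (b c) (b a)
  rw [← lie_skew, map_neg] at h2
  linear_combination (norm := module) (1 / 2 : k) • h1 - (1 / 2 : k) • h2

theorem eval_one_sub (u : List ι) (a c : ι) :
    (takModel k 𝔤 φ).eval b (NormalForm.one u a c).mon
        - (takModel k 𝔤 φ).eval b (NormalForm.pw u [c] 0 a).mon
      = seq₃ (prodT b (u ++ [a]) * prodS b [c] - prodT b (u ++ [c]) * prodS b [a]
        - prodT b u * takS k 𝔤 ⁅b a, b c⁆) 0 0 := by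
  funext s
  have := congrFun (eval_L1_sub b φ a c) s
  rw [Pi.sub_apply] at this ⊢
  have e1 : (takModel k 𝔤 φ).eval b (NormalForm.pw u [c] 0 a).mon s
      = prodT b u * (takModel k 𝔤 φ).eval b ([Letter.L 1 c], x a) s := eval_L0 b φ u _ _ s
  rw [e1, NormalForm.mon, eval_L0, ← mul_sub, this]
  rcases s with _ | _ | _ | s <;> simp [seq₃, prodT_concat, prodS, mul_sub, mul_assoc]

variable [LinearOrder ι] [WellFoundedLT ι]

/-- The images of the normal forms, those of `L_0^u L_1^a c` with `c < a` being replaced by the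
image of `L_0^u (L_1^a c - L_1^c a)`. -/
def reducedEval : NormalForm ι → (ℕ → UniversalEnvelopingAlgebra k (Takiff 𝔤))
  | .one u a c => (takModel k 𝔤 φ).eval b (NormalForm.one u a c).mon
      - (takModel k 𝔤 φ).eval b (NormalForm.pw u [c] 0 a).mon
  | .pw u bs s c => (takModel k 𝔤 φ).eval b (NormalForm.pw u bs s c).mon
  | .two u bs a c => (takModel k 𝔤 φ).eval b (NormalForm.two u bs a c).mon

/-- The order of elimination. The images of `pw` are those of positive degree in `∂` and are ranked
by it; those of degree zero with a single letter `εc` are ranked by the length of `u`, then by `c`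
in the opposite order, because the image of `one u a c` contains the term with `a` and `c`
interchanged. -/
def nfRank : NormalForm ι → ℕ ×ₗ (ℕ ×ₗ ιᵒᵈ)
  | .pw _ _ s c => toLex (2, toLex (s, OrderDual.toDual c))
  | .one u _ c => toLex (1, toLex (u.length, OrderDual.toDual c))
  | .two _ _ _ c => toLex (0, toLex (0, OrderDual.toDual c))

/-- The degree in `∂` and the sorted word of the leading term of `reducedEval`. -/
def nfLeading : NormalForm ι → ℕ × List (ι ⊕ₗ ι)
  | .pw u bs s c => (s + 1, takLetters u (bs ++ [c]))
  | .one u a c => (0, takLetters (u ++ [a]) [c])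
  | .two u bs a c => (0, takLetters u (bs ++ [a, c]))

/-- A triangularity argument: the functional of `n` is the coordinate at the leading term of its
image, and it vanishes on the images of the other normal forms of the same or smaller rank. -/
theorem linearIndependent_reducedEval :
    LinearIndependent k fun n : {n : NormalForm ι // n.Valid} => reducedEval b φ n.1 := by
  obtain ⟨C, hC, hC'⟩ := exists_takiff_coordinates b
  have hC : ∀ u v : List ι, u.Pairwise (· ≤ ·) → v.Pairwise (· ≤ ·) →
      C (prodT b u * prodS b v) = Finsupp.single (takLetters u v) 1 := hC
  have hC' : ∀ (u v : List ι) t, C (prodT b u * prodS b v) t ≠ 0 →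
      t.Perm (takLetters u v) ∨ t.length < u.length + v.length := hC'
  let F : {n : NormalForm ι // n.Valid} →
      (ℕ → UniversalEnvelopingAlgebra k (Takiff 𝔤)) →ₗ[k] k := fun n =>
    Finsupp.lapply (nfLeading n.1).2 ∘ₗ C ∘ₗ LinearMap.proj (nfLeading n.1).1
  -- The value of the functional of `one u a c` at `one u' a' c'` for comparable ranks.
  have hone : ∀ u a c u' a' c', c' < a' → (u' ++ [a']).Pairwise (· ≤ ·) →
      (u'.length < u.length ∨ u'.length = u.length ∧ c ≤ c') →
      C (reducedEval b φ (.one u' a' c') 0) (takLetters (u ++ [a]) [c])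
        = Finsupp.single (takLetters (u' ++ [a']) [c']) (1 : k) (takLetters (u ++ [a]) [c]) := by
    intro u a c u' a' c' hca hs hlen
    rw [reducedEval, eval_one_sub]
    change C (_ - _ - _) _ = _
    rw [map_sub, map_sub, hC _ _ hs (by simp)]
    have h2 : C (prodT b (u' ++ [c']) * prodS b [a']) (takLetters (u ++ [a]) [c]) = 0 := by
      by_contra hne
      rcases hC' _ _ _ hne with h | h
      · have e1 := h.length_eq
        have e2 := h.filterMap (fun s => (ofLex s).getRight?)
        rw [filterMap_getRight_takLetters, filterMap_getRight_takLetters] at e2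
        have e3 : c = a' := by simpa using e2
        simp at e1
        rcases hlen with h3 | ⟨-, h3⟩
        · omega
        · exact absurd (e3 ▸ h3) (not_le.mpr hca)
      · simp at h
        omega
    have h3 : C (prodT b u' * takS k 𝔤 ⁅b a', b c'⁆) (takLetters (u ++ [a]) [c]) = 0 := by
      have : Finsupp.lapply (takLetters (u ++ [a]) [c]) ∘ₗ C ∘ₗ
          LinearMap.mulLeft k (prodT b u') ∘ₗ takS k 𝔤 = 0 := by
        refine b.ext fun i => ?_
        by_contra hne
        have hne' : C (prodT b u' * prodS b [i]) (takLetters (u ++ [a]) [c]) ≠ 0 := by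
          simpa [prodS] using hne
        rcases hC' _ _ _ hne' with h | h
        · have := h.length_eq
          simp at this
          omega
        · simp at h
          omega
      exact LinearMap.congr_fun this ⁅b a', b c'⁆
    rw [Finsupp.sub_apply, Finsupp.sub_apply, h2, h3, sub_zero, sub_zero]
  have hsingle : ∀ {s t : List (ι ⊕ₗ ι)}, s ≠ t → Finsupp.single s (1 : k) t = 0 := fun h =>
    Finsupp.single_eq_of_ne h.symm
  refine linearIndependent_of_rank _ (fun n => nfRank n.1) F ?_ ?_
  · rintro ⟨⟨u, bs, s, c⟩ | ⟨u, bs, a, c⟩ | ⟨u, a, c⟩, hn⟩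
    · change C (reducedEval b φ (.pw u bs s c) (s + 1)) (takLetters u (bs ++ [c])) ≠ 0
      rw [reducedEval, (eval_pw b φ _ _ _ _).1, map_smul, hC _ _ hn.1 hn.2]
      simp
    · change C (reducedEval b φ (.two u bs a c) 0) (takLetters u (bs ++ [a, c])) ≠ 0
      rw [reducedEval, (eval_two b φ _ _ _ _).1, hC _ _ hn.1 hn.2]
      simp
    · change C (reducedEval b φ (.one u a c) 0) (takLetters (u ++ [a]) [c]) ≠ 0
      rw [hone _ _ _ _ _ _ hn.2 hn.1 (Or.inr ⟨rfl, le_rfl⟩)]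
      simp
  · rintro ⟨i, hi⟩ ⟨j, hj⟩ hne hr
    have hne : j ≠ i := fun h => hne (Subtype.ext h)
    change nfRank j ≤ nfRank i at hr
    change C (reducedEval b φ j (nfLeading i).1) (nfLeading i).2 = 0
    rcases i with ⟨u, bs, s, c⟩ | ⟨u, bs, a, c⟩ | ⟨u, a, c⟩ <;>
      rcases j with ⟨u', bs', s', c'⟩ | ⟨u', bs', a', c'⟩ | ⟨u', a', c'⟩ <;>
      simp only [nfRank, Prod.Lex.toLex_le_toLex, OrderDual.toDual_le_toDual] at hr <;>
      simp only [nfLeading]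
    · rw [reducedEval]
      rcases lt_or_eq_of_le (show s' ≤ s by omega) with h | rfl
      · rw [(eval_pw b φ _ _ _ _).2 _ (by omega), map_zero, Finsupp.zero_apply]
      · rw [(eval_pw b φ _ _ _ _).1, map_smul, hC _ _ hj.1 hj.2, Finsupp.smul_apply, hsingle,
          smul_zero]
        intro h
        obtain ⟨rfl, h2⟩ := takLetters_inj.mp h
        obtain ⟨rfl, h3⟩ := List.append_inj' h2 rfl
        exact hne (by simp_all)
    · rw [reducedEval, (eval_two b φ _ _ _ _).2 _ (by omega), map_zero, Finsupp.zero_apply]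
    · rw [reducedEval, eval_one_sub]
      rcases s with _ | _ | s <;> simp [seq₃]
    · omega
    · rw [reducedEval, (eval_two b φ _ _ _ _).1, hC _ _ hj.1 hj.2, hsingle]
      intro h
      obtain ⟨rfl, h2⟩ := takLetters_inj.mp h
      obtain ⟨rfl, h3⟩ := List.append_inj' h2 rfl
      exact hne (by simp_all)
    · omega
    · omega
    · rw [reducedEval, (eval_two b φ _ _ _ _).1, hC _ _ hj.1 hj.2, hsingle]
      intro h
      have := congrArg List.length (takLetters_inj.mp h).2
      simp at this
    · rw [hone _ _ _ _ _ _ hj.2 hj.1 (by simpa using hr), hsingle]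
      intro h
      obtain ⟨h1, h2⟩ := takLetters_inj.mp h
      obtain ⟨rfl, h1⟩ := List.append_inj' h1 rfl
      exact hne (by simp_all)

/-- The images of the normal forms other than `e` are independent modulo `e`. -/
theorem linearIndependent_eval_takModel :
    LinearIndependent k fun n : {n : NormalForm ι // n.Valid} =>
      (takModel k 𝔤 φ).eval b n.1.mon := by
  -- The images are obtained from `reducedEval` by `1 + N` with `N² = 0`.
  let σ : {n : NormalForm ι // n.Valid} → ({n : NormalForm ι // n.Valid} →₀ k) := fun n =>
    match n with
    | ⟨.one u a c, h⟩ => Finsupp.single ⟨.pw u [c] 0 a, (List.pairwise_append.mp h.1).1,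
        by simpa using h.2.le⟩ 1
    | _ => 0
  let N := Finsupp.linearCombination k σ
  have hN : N ∘ₗ N = 0 := by
    refine Finsupp.lhom_ext' fun n => LinearMap.ext_ring ?_
    rcases n with ⟨u | u | u, hn⟩ <;> simp [N, σ]
  have hv : Finsupp.linearCombination k (fun n : {n : NormalForm ι // n.Valid} =>
        (takModel k 𝔤 φ).eval b n.1.mon)
      = Finsupp.linearCombination k (fun n : {n : NormalForm ι // n.Valid} => reducedEval b φ n.1)
        ∘ₗ (LinearMap.id + N) := by
    refine Finsupp.lhom_ext' fun n => LinearMap.ext_ring ?_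
    rcases n with ⟨u | u | u, hn⟩ <;> simp [N, σ, reducedEval]
  refine linearIndependent_iff.mpr fun f hf => ?_
  rw [hv, LinearMap.comp_apply] at hf
  have h1 := linearIndependent_iff.mp (linearIndependent_reducedEval b φ) _ hf
  rw [LinearMap.add_apply, LinearMap.id_apply] at h1
  have h2 := congrArg N h1
  rw [map_add, map_zero, ← LinearMap.comp_apply, hN, LinearMap.zero_apply, add_zero] at h2
  rwa [h2, add_zero] at h1

end

end Independence

/-! ### An extension of a syzygy module by a cocycle -/

section Extension

noncomputable section

variable {k : Type*} [Field k] {𝔤 : Type*} [LieRing 𝔤] [LieAlgebra k 𝔤] {ι : Type*}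
  {V : Type*} [AddCommGroup V] [Module k V]

theorem eq_zero_of_basis {B : Module.Basis ι k 𝔤} {f : 𝔤 → V} (hf : IsLinearMap k f)
    (h : ∀ i, f (B i) = 0) (x : 𝔤) : f x = 0 := by
  have : hf.mk' f = 0 := B.ext h
  exact LinearMap.congr_fun this x

theorem skew_of_basis (B : Module.Basis ι k 𝔤) {Ω : 𝔤 →ₗ[k] 𝔤 →ₗ[k] V}
    (h : ∀ i j, Ω (B i) (B j) = - Ω (B j) (B i)) (x y : 𝔤) : Ω x y = - Ω y x := by
  have : Ω = - Ω.flip := B.ext fun i => B.ext fun j => h i j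
  exact LinearMap.congr_fun₂ this x y

/-- The relation between a bilinear map `Ω`, the trilinear map `T x y z = x Ω(y, z)` and a vector
`c` in the extension of a syzygy module of the trivial module by the cocycle `φ(x, [y, z]) / 2`. -/
def cocycleDefect (φ : LinearMap.BilinForm k 𝔤) (T : 𝔤 →ₗ[k] 𝔤 →ₗ[k] 𝔤 →ₗ[k] V)
    (Ω : 𝔤 →ₗ[k] 𝔤 →ₗ[k] V) (c : V) (x y z : 𝔤) : V :=
  T x y z + T y z x + T z x y - Ω ⁅y, z⁆ x - Ω ⁅z, x⁆ y - Ω ⁅x, y⁆ z - ((1 / 2 : k) * φ x ⁅y, z⁆) • c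

variable {φ : LinearMap.BilinForm k 𝔤} (hsymm : ∀ x y, φ x y = φ y x)
  (hinv : ∀ x y z, φ ⁅x, y⁆ z = φ x ⁅y, z⁆)

include hsymm hinv in
theorem form_lie_cyclic (x y z : 𝔤) : φ y ⁅z, x⁆ = φ x ⁅y, z⁆ := by
  rw [← hinv, hsymm]

include hinv in
/-- The cocycle identity for `φ(x, [y, z])`, up to the invariance of `φ`. -/
theorem form_lie_lie (x y z t : 𝔤) :
    φ ⁅x, y⁆ ⁅z, t⁆ - φ ⁅x, z⁆ ⁅y, t⁆ + φ ⁅x, t⁆ ⁅y, z⁆ = 0 := by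
  rw [hinv, hinv, hinv, ← map_sub, ← map_add]
  have : ⁅y, ⁅z, t⁆⁆ - ⁅z, ⁅y, t⁆⁆ + ⁅t, ⁅y, z⁆⁆ = 0 := by
    rw [leibniz_lie y z t, ← lie_skew t ⁅y, z⁆]
    abel
  rw [this, map_zero]

variable (φ) in
theorem cocycleDefect_linear_left (T : 𝔤 →ₗ[k] 𝔤 →ₗ[k] 𝔤 →ₗ[k] V) (Ω : 𝔤 →ₗ[k] 𝔤 →ₗ[k] V) (c : V)
    (y z : 𝔤) : IsLinearMap k fun x => cocycleDefect φ T Ω c x y z where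
  map_add x x' := by
    simp only [cocycleDefect, map_add, LinearMap.add_apply, lie_add, add_lie]
    module
  map_smul r x := by
    simp only [cocycleDefect, map_smul, LinearMap.smul_apply, lie_smul, smul_lie, smul_eq_mul]
    module

include hsymm hinv in
theorem cocycleDefect_cyclic (T : 𝔤 →ₗ[k] 𝔤 →ₗ[k] 𝔤 →ₗ[k] V) (Ω : 𝔤 →ₗ[k] 𝔤 →ₗ[k] V) (c : V)
    (x y z : 𝔤) : cocycleDefect φ T Ω c y z x = cocycleDefect φ T Ω c x y z := by
  rw [cocycleDefect, cocycleDefect, form_lie_cyclic hsymm hinv]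
  abel

theorem cocycleDefect_swap {T : 𝔤 →ₗ[k] 𝔤 →ₗ[k] 𝔤 →ₗ[k] V} {Ω : 𝔤 →ₗ[k] 𝔤 →ₗ[k] V} (c : V)
    (hT : ∀ x y z, T x y z = - T x z y) (x y z : 𝔤) :
    cocycleDefect φ T Ω c x z y = - cocycleDefect φ T Ω c x y z := by
  rw [cocycleDefect, cocycleDefect, hT x z y, hT z y x, hT y x z, ← lie_skew z y, ← lie_skew y x,
    ← lie_skew x z]
  simp only [map_neg, LinearMap.neg_apply]
  module

include hsymm hinv in
/-- By antisymmetry, the defect vanishes once it vanishes on decreasing triples of basis vectors. -/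
theorem cocycleDefect_eq_zero [CharZero k] [LinearOrder ι] {B : Module.Basis ι k 𝔤}
    {T : 𝔤 →ₗ[k] 𝔤 →ₗ[k] 𝔤 →ₗ[k] V} {Ω : 𝔤 →ₗ[k] 𝔤 →ₗ[k] V} {c : V}
    (hT : ∀ x y z, T x y z = - T x z y)
    (h : ∀ i j l, l < j → j < i → cocycleDefect φ T Ω c (B i) (B j) (B l) = 0) (x y z : 𝔤) :
    cocycleDefect φ T Ω c x y z = 0 := by
  have cyc := cocycleDefect_cyclic hsymm hinv T Ω c
  have swap := cocycleDefect_swap (φ := φ) (Ω := Ω) c hT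
  have hself : ∀ x y, cocycleDefect φ T Ω c x y y = 0 := fun x y => by
    have h2 : (2 : k) • cocycleDefect φ T Ω c x y y = 0 := by
      rw [two_smul]
      nth_rewrite 1 [swap]
      exact neg_add_cancel _
    exact (smul_eq_zero_iff_right two_ne_zero).mp h2
  have hbasis : ∀ i j l, cocycleDefect φ T Ω c (B i) (B j) (B l) = 0 := by
    -- The maximal index can be moved to the front.
    have hmax : ∀ i j l, j ≤ i → l ≤ i → cocycleDefect φ T Ω c (B i) (B j) (B l) = 0 := by
      intro i j l hj hl
      rcases hj.eq_or_lt with rfl | hj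
      · rw [← cyc, ← cyc, hself]
      rcases hl.eq_or_lt with rfl | hl
      · rw [← cyc, hself]
      rcases lt_trichotomy l j with h' | rfl | h'
      · exact h i j l h' hj
      · exact hself _ _
      · rw [swap, h i l j h' hl, neg_zero]
    intro i j l
    rcases le_total i j with hij | hij
    · rcases le_total j l with hjl | hjl
      · exact (cyc _ _ _).trans (hmax l i j (hij.trans hjl) hjl)
      · exact (cyc _ _ _).symm.trans (hmax j l i hjl hij)
    · rcases le_total i l with hil | hil
      · exact (cyc _ _ _).trans (hmax l i j hil (hij.trans hil))
      · exact hmax i j l hij hil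
  refine eq_zero_of_basis (B := B) (cocycleDefect_linear_left φ T Ω c y z) (fun i => ?_) x
  rw [← cyc]
  refine eq_zero_of_basis (B := B) (cocycleDefect_linear_left φ T Ω c z (B i)) (fun j => ?_) y
  rw [← cyc]
  refine eq_zero_of_basis (B := B) (cocycleDefect_linear_left φ T Ω c (B i) (B j)) (fun l => ?_) z
  exact hbasis l i j

include hsymm hinv in
/-- The alternating sum of the defects of `x' · (x, y, z)` vanishes: this is the fact that
`φ(x, [y, z])` is a cocycle, together with `d² = 0` for the Chevalley–Eilenberg differential.
-/
theorem overlap_identity {T : 𝔤 →ₗ[k] 𝔤 →ₗ[k] 𝔤 →ₗ[k] V} {Ω : 𝔤 →ₗ[k] 𝔤 →ₗ[k] V} {c : V}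
    (hT : ∀ x y z, T x y z = - T x z y) (hΩ : ∀ x y, Ω x y = - Ω y x)
    (h : ∀ x y z, cocycleDefect φ T Ω c x y z = 0) (x y z t : 𝔤) :
    T ⁅x, y⁆ z t - T ⁅x, z⁆ y t + T ⁅x, t⁆ y z + T ⁅y, z⁆ x t - T ⁅y, t⁆ x z + T ⁅z, t⁆ x y
      = T x ⁅z, t⁆ y - T x ⁅y, t⁆ z + T x ⁅y, z⁆ t - T y ⁅z, t⁆ x + T y ⁅x, t⁆ z - T y ⁅x, z⁆ t
        + T z ⁅y, t⁆ x - T z ⁅x, t⁆ y + T z ⁅x, y⁆ t - T t ⁅y, z⁆ x + T t ⁅x, z⁆ y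
        - T t ⁅x, y⁆ z := by
  have h1 := h ⁅x, y⁆ z t
  have h2 := h ⁅x, z⁆ y t
  have h3 := h ⁅x, t⁆ y z
  have h4 := h ⁅y, z⁆ x t
  have h5 := h ⁅y, t⁆ x z
  have h6 := h ⁅z, t⁆ x y
  have hφ := form_lie_lie hinv x y z t
  have J : ∀ a b c d : 𝔤, Ω ⁅⁅a, b⁆, c⁆ d + Ω ⁅⁅b, c⁆, a⁆ d + Ω ⁅⁅c, a⁆, b⁆ d = 0 := by
    intro a b c d
    rw [← LinearMap.add_apply, ← LinearMap.add_apply, ← map_add, ← map_add]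
    have : ⁅⁅a, b⁆, c⁆ + ⁅⁅b, c⁆, a⁆ + ⁅⁅c, a⁆, b⁆ = 0 := by
      rw [lie_lie a b c, ← lie_skew ⁅b, c⁆ a, ← lie_skew ⁅c, a⁆ b, ← lie_skew c a, lie_neg]
      abel
    rw [this, map_zero, LinearMap.zero_apply]
  have J1 := J x y z t
  have J2 := J x y t z
  have J3 := J x z t y
  have J4 := J y z t x
  have hφ' : ((1 / 2 : k) * φ ⁅x, y⁆ ⁅z, t⁆) • c - ((1 / 2 : k) * φ ⁅x, z⁆ ⁅y, t⁆) • c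
      + ((1 / 2 : k) * φ ⁅x, t⁆ ⁅y, z⁆) • c = 0 := by
    rw [← sub_smul, ← add_smul, ← mul_sub, ← mul_add, hφ, mul_zero, zero_smul]
  simp only [cocycleDefect] at h1 h2 h3 h4 h5 h6
  rw [hsymm ⁅y, z⁆] at h4
  rw [hsymm ⁅y, t⁆] at h5
  rw [hsymm ⁅z, t⁆] at h6
  have s : ∀ a b c : 𝔤, ⁅c, ⁅a, b⁆⁆ = -⁅⁅a, b⁆, c⁆ := fun a b c => (lie_skew _ _).symm
  simp only [← lie_skew z x, ← lie_skew t x, ← lie_skew t y, s, neg_lie, map_neg,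
    LinearMap.neg_apply] at h1 h2 h3 h4 h5 h6 J1 J2 J3 J4
  simp only [hT z t, hT y t, hT y z, hT x t, hT x z, hT x y,
    hΩ ⁅y, z⁆ ⁅x, t⁆, hΩ ⁅y, t⁆ ⁅x, z⁆, hΩ ⁅z, t⁆ ⁅x, y⁆] at h1 h2 h3 h4 h5 h6 ⊢
  linear_combination (norm := module) h1 - h2 + h3 + h4 - h5 + h6 + J1 - J2 + J3 - J4
    + (2 : k) • hφ'


section Rewriting

variable [LinearOrder ι] (B : Module.Basis ι k 𝔤)

/-- The monomials `u e` and `u w(b, c)`, where `c < b`: `none` stands for `e`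
and `some (b, c)` for `w(b, c)`. -/
abbrev ExtMon (ι : Type*) [LT ι] := List ι × Option {p : ι × ι // p.2 < p.1}

/-- The alternating bilinear map `w` with values in the span of the generators `w(b, c)`, `c < b`. -/
def extGen : 𝔤 →ₗ[k] 𝔤 →ₗ[k] (ExtMon ι →₀ k) :=
  B.constr k fun b => B.constr k fun c =>
    if h : c < b then Finsupp.single ([], some ⟨(b, c), h⟩) 1
    else if h : b < c then -Finsupp.single ([], some ⟨(c, b), h⟩) 1 else 0

theorem extGen_basis {b c : ι} (h : c < b) :
    extGen B (B b) (B c) = Finsupp.single ([], some ⟨(b, c), h⟩) 1 := by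
  simp [extGen, h]

theorem extGen_skew (x y : 𝔤) : extGen B x y = - extGen B y x := by
  refine skew_of_basis B (fun i j => ?_) x y
  rcases lt_trichotomy i j with h | rfl | h
  · simp [extGen, h, h.not_gt]
  · simp [extGen]
  · simp [extGen, h, h.not_gt]

theorem extGen_support (x y : 𝔤) : ∀ t ∈ (extGen B x y).support, t.1 = [] := by
  have : extGen B x y ∈ Finsupp.supported k k {t : ExtMon ι | t.1 = []} := by
    have hs : ∀ (g : Option {p : ι × ι // p.2 < p.1}), Finsupp.single ([], g) (1 : k) ∈
        Finsupp.supported k k {t : ExtMon ι | t.1 = []} := fun g =>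
      Finsupp.single_mem_supported k _ rfl
    rw [extGen, Module.Basis.constr_apply, Finsupp.sum, LinearMap.sum_apply]
    refine Submodule.sum_mem _ fun i _ => ?_
    rw [LinearMap.smul_apply, Module.Basis.constr_apply]
    refine Submodule.smul_mem _ _ (Submodule.sum_mem _ fun j _ => Submodule.smul_mem _ _ ?_)
    split_ifs
    · exact hs _
    · exact Submodule.neg_mem _ (hs _)
    · exact Submodule.zero_mem _
  exact fun t ht => (Finsupp.mem_supported k _).mp this ht

variable (φ) in
/-- The relations of the extension by `e` of a syzygy module of the trivial module, solved for the
greatest monomial. -/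
inductive ExtRule : ι → Option {p : ι × ι // p.2 < p.1} → (ExtMon ι →₀ k) → Prop
  | e (a : ι) : ExtRule a none 0
  | w (a b c : ι) (hcb : c < b) (hba : b < a) : ExtRule a (some ⟨(b, c), hcb⟩)
      (pre k [b] (extGen B (B a) (B c)) - pre k [c] (extGen B (B a) (B b))
        + extGen B ⁅B b, B c⁆ (B a) + extGen B ⁅B c, B a⁆ (B b) + extGen B ⁅B a, B b⁆ (B c)
        + ((1 / 2 : k) * φ (B a) ⁅B b, B c⁆) • Finsupp.single ([], none) 1)

theorem ExtRule.lt {a : ι} {g : Option {p : ι × ι // p.2 < p.1}} {ρ : ExtMon ι →₀ k} (h : ExtRule φ B a g ρ) :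
    ∀ t ∈ ρ.support, List.Shortlex (· < ·) t.1 [a] := by
  have hs : ρ ∈ Finsupp.supported k k {t : ExtMon ι | List.Shortlex (· < ·) t.1 [a]} := by
    have hnil : ∀ x y, extGen B x y ∈
        Finsupp.supported k k {t : ExtMon ι | List.Shortlex (· < ·) t.1 [a]} := by
      refine fun x y => (Finsupp.mem_supported k _).mpr fun t ht => ?_
      rw [Set.mem_ofPred_eq, extGen_support B x y t ht]
      exact .of_length_lt (by simp)
    cases h with
    | e => exact Submodule.zero_mem _
    | w b c hcb hba =>
      have h1 := extGen_basis B (hcb.trans hba)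
      have h2 := extGen_basis B hba
      rw [h1, h2, pre_single, pre_single]
      refine Submodule.add_mem _ (Submodule.add_mem _ (Submodule.add_mem _ (Submodule.add_mem _
        (Submodule.sub_mem _ ?_ ?_) (hnil _ _)) (hnil _ _)) (hnil _ _)) (Submodule.smul_mem _ _ ?_)
      · exact Finsupp.single_mem_supported k _ (.of_lex (by simp) (.rel hba))
      · exact Finsupp.single_mem_supported k _ (.of_lex (by simp) (.rel (hcb.trans hba)))
      · exact Finsupp.single_mem_supported k _ (.of_length_lt (by simp))
  exact fun t ht => (Finsupp.mem_supported k _).mp hs ht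

theorem ExtRule.unique {a : ι} {g : Option {p : ι × ι // p.2 < p.1}} {ρ ρ' : ExtMon ι →₀ k}
    (h : ExtRule φ B a g ρ) (h' : ExtRule φ B a g ρ') : ρ = ρ' := by
  cases h <;> cases h' <;> rfl

/-- The trilinear map `(x, y, z) ↦ N(u x w(y, z))`. -/
def extTri (N : (ExtMon ι →₀ k) →ₗ[k] V) (u : List ι) : 𝔤 →ₗ[k] 𝔤 →ₗ[k] 𝔤 →ₗ[k] V :=
  B.constr k fun i => (extGen B).compr₂ (N ∘ₗ pre k (u ++ [i]))

@[simp] theorem extTri_basis (N : (ExtMon ι →₀ k) →ₗ[k] V) (u : List ι) (i : ι) (y z : 𝔤) :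
    extTri B N u (B i) y z = N (pre k (u ++ [i]) (extGen B y z)) := by
  simp [extTri]

theorem extTri_skew (N : (ExtMon ι →₀ k) →ₗ[k] V) (u : List ι) (x y z : 𝔤) :
    extTri B N u x y z = - extTri B N u x z y := by
  have hf : IsLinearMap k fun x => extTri B N u x y z + extTri B N u x z y :=
    ⟨fun x x' => by simp only [map_add, LinearMap.add_apply]; abel,
      fun r x => by simp only [map_smul, LinearMap.smul_apply, smul_add]⟩
  refine eq_neg_of_add_eq_zero_left (eq_zero_of_basis (B := B) hf (fun i => ?_) x)
  rw [extTri_basis, extTri_basis, extGen_skew, map_neg, map_neg, neg_add_cancel]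

theorem slot_some (N : (ExtMon ι →₀ k) →ₗ[k] V) (u : List ι) {b c : ι} (h : c < b) (x : 𝔤) :
    slot B (fun w => N (Finsupp.single (w, some ⟨(b, c), h⟩) 1)) u [] x
      = extTri B N u x (B b) (B c) := by
  have : slot B (fun w => N (Finsupp.single (w, some ⟨(b, c), h⟩) 1)) u []
      = ((extTri B N u).flip (B b)).flip (B c) := by
    refine B.ext fun i => ?_
    simp [extGen_basis B h]
  exact LinearMap.congr_fun this x

variable [CharZero k]

include hsymm hinv in
/-- The relations of the extension overlap well with commutation. -/
theorem ExtRule.overlap (u : List ι) (a' a : ι) (g : Option {p : ι × ι // p.2 < p.1}) (ρ : ExtMon ι →₀ k)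
    (haa' : a < a') (hP : ExtRule φ B a g ρ) (N : (ExtMon ι →₀ k) →ₗ[k] (ExtMon ι →₀ k))
    (hN : ∀ t s, List.Shortlex (· < ·) t.1 (u ++ [a', a]) → PRule B (ExtRule φ B) t s →
      N (Finsupp.single t 1) = N s) :
    N (Finsupp.single (u ++ [a, a'], g) 1)
      + slot B (fun w => N (Finsupp.single (w, g) 1)) u [] ⁅B a', B a⁆ = N (pre k (u ++ [a']) ρ) := by
  have hshort : ∀ i, List.Shortlex (· < ·) (u ++ [i]) (u ++ [a', a]) := fun i =>
    .of_length_lt (by simp)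
  have hless : ∀ p q, p < a' → List.Shortlex (· < ·) (u ++ [p] ++ [q]) (u ++ [a', a]) :=
    fun p q h => by
      rw [List.append_assoc]
      exact .append_left (.of_lex (by simp) (.rel h)) u
  have he : ∀ v q, List.Shortlex (· < ·) (v ++ [q]) (u ++ [a', a]) →
      N (Finsupp.single (v ++ [q], none) 1) = 0 := fun v q h => by
    rw [hN _ _ h (PRule.gen v q none 0 (.e q)), map_zero, map_zero]
  cases hP with
  | e =>
    have h1 : slot B (fun w => N (Finsupp.single (w, none) 1)) u [] = 0 :=
      B.ext fun i => by simpa using he u i (hshort i)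
    have h2 := he (u ++ [a]) a' (hless a a' haa')
    rw [List.append_assoc] at h2
    rw [h1, map_zero, map_zero, LinearMap.zero_apply, add_zero]
    exact h2
  | w b c hcb hba =>
    have hw : ∀ v p q r, r < q → q < p → List.Shortlex (· < ·) (v ++ [p]) (u ++ [a', a]) →
        cocycleDefect φ (extTri B N v) ((extGen B).compr₂ (N ∘ₗ pre k v))
          (N (Finsupp.single (v, none) 1)) (B p) (B q) (B r) = 0 := fun v p q r hrq hqp h => by
      have h1 := hN _ _ h (PRule.gen v p _ _ (.w p q r hrq hqp))
      simp only [map_add, map_sub, map_smul, pre_pre, pre_single, List.append_nil] at h1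
      have h2 := extTri_basis B N v p (B q) (B r)
      rw [extGen_basis B hrq, pre_single, List.append_nil, h1] at h2
      rw [cocycleDefect, h2, extTri_skew B N v (B q) (B r)]
      simp only [extTri_basis, LinearMap.compr₂_apply, LinearMap.comp_apply]
      abel
    have h0 := cocycleDefect_eq_zero hsymm hinv (extTri_skew B N u)
      (fun i j l hlj hji => hw u i j l hlj hji (hshort i))
    have hskew : ∀ x y, (extGen B).compr₂ (N ∘ₗ pre k u) x y
        = - (extGen B).compr₂ (N ∘ₗ pre k u) y x := fun x y => by
      rw [LinearMap.compr₂_apply, LinearMap.compr₂_apply, extGen_skew, map_neg]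
    have hca := hcb.trans hba
    have key := overlap_identity hsymm hinv (extTri_skew B N u) hskew h0 (B a') (B a) (B b) (B c)
    have ha := hw (u ++ [a]) a' b c hcb (hba.trans haa') (hless a a' haa')
    have hb := hw (u ++ [b]) a' a c hca haa' (hless b a' (hba.trans haa'))
    have hc := hw (u ++ [c]) a' a b hba haa' (hless c a' (hca.trans haa'))
    have hcomm : ∀ p q r s, q < p → s < r → List.Shortlex (· < ·) (u ++ [p, q]) (u ++ [a', a]) →
        extTri B N (u ++ [p]) (B q) (B r) (B s)
          = extTri B N (u ++ [q]) (B p) (B r) (B s) + extTri B N u ⁅B p, B q⁆ (B r) (B s) := by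
      intro p q r s hqp hsr h
      have := hN _ _ h (PRule.comm u [] p q (some ⟨(r, s), hsr⟩) hqp)
      rw [map_add, map_slot, slot_some B N u hsr] at this
      simpa [extGen_basis B hsr] using this
    have c1 := hcomm a' b a c (hba.trans haa') hca (.append_left (.of_lex (by simp) (.cons (.rel hba))) u)
    have c2 := hcomm a' c a b (hca.trans haa') hba (.append_left (.of_lex (by simp) (.cons (.rel hca))) u)
    have c3 := hcomm a b a' c hba (hca.trans haa') (.append_left (.of_lex (by simp) (.rel haa')) u)
    have c4 := hcomm a c a' b hca (hba.trans haa') (.append_left (.of_lex (by simp) (.rel haa')) u)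
    have c5 := hcomm b c a' a hcb haa'
      (.append_left (.of_lex (by simp) (.rel (hba.trans haa'))) u)
    have hT : ∀ p x y, N (pre k (u ++ [p]) (extGen B x y)) = extTri B N u (B p) x y := fun p x y =>
      (extTri_basis B N u p x y).symm
    have hT' : ∀ p q x y, N (pre k (u ++ [p, q]) (extGen B x y))
        = extTri B N (u ++ [p]) (B q) x y := fun p q x y => by
      rw [extTri_basis, List.append_assoc]
      rfl
    have h1 := hT' a a' (B b) (B c)
    rw [extGen_basis B hcb, pre_single, List.append_nil] at h1
    rw [slot_some B N u hcb, h1]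
    simp only [map_add, map_sub, map_smul, pre_pre, pre_single, List.append_nil, he u _ (hshort _),
      smul_zero, add_zero, List.append_assoc, List.cons_append, List.nil_append, hT, hT']
    simp only [cocycleDefect, LinearMap.compr₂_apply, LinearMap.comp_apply, hT, he u _ (hshort _),
      smul_zero, sub_zero] at ha hb hc
    simp only [← lie_skew (B b) (B a'), ← lie_skew (B c) (B a'), ← lie_skew (B c) (B a), map_neg,
      LinearMap.neg_apply, extTri_skew B N (u ++ [_]) _ (B b) (B a'), extTri_skew B N (u ++ [_]) _ (B c) (B a')]
      at ha hb hc c1 c2 c3 c4 c5 key ⊢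
    linear_combination (norm := module) ha - hb + hc + key - c1 + c2 + c3 - c4 + c5

include hsymm hinv in
/-- The vector `e` survives in the extension. -/
theorem pmk_none_ne_zero [WellFoundedLT ι] : pmk B (ExtRule φ B) [] none ≠ 0 := by
  obtain ⟨N, hN, hN'⟩ := exists_normalForm_presented (B := B) (P := ExtRule φ B)
    (fun a g ρ ρ' => ExtRule.unique B) (fun a g ρ h => h.lt B)
    (fun u a' a g ρ h hP N hN => ExtRule.overlap hsymm hinv B u a' a g ρ h hP N hN)
  intro h
  have hle : relSpan (PRule B (ExtRule φ B)) ≤ LinearMap.ker N := by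
    refine Submodule.span_le.mpr ?_
    rintro f ⟨m, r, hr, rfl⟩
    simp [hN m r hr]
  have h1 : N (Finsupp.single ([], none) 1) = 0 :=
    hle ((Submodule.Quotient.mk_eq_zero _).mp h)
  rw [hN' _ fun r hr => ?_] at h1
  · exact one_ne_zero (Finsupp.single_eq_zero.mp h1)
  · generalize hm : (([], none) : ExtMon ι) = m at hr
    cases hr <;> simp at hm

end Rewriting

end

end Extension

/-! ### Free modules over the enveloping algebra and operators on the extension -/

section FreeModules

noncomputable section

open TensorProduct

variable {k : Type*} [Field k] {𝔤 : Type*} [LieRing 𝔤] [LieAlgebra k 𝔤]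
  {V : Type*} [AddCommGroup V] [Module k V]

section

attribute [local instance] LieRing.ofAssociativeRing

theorem envelope_mem_subalgebra (S : Subalgebra k (UniversalEnvelopingAlgebra k 𝔤))
    (h : ∀ x, UniversalEnvelopingAlgebra.ι k x ∈ S) (u : UniversalEnvelopingAlgebra k 𝔤) : u ∈ S := by
  let ι' : 𝔤 →ₗ⁅k⁆ S :=
    { toFun := fun x => ⟨UniversalEnvelopingAlgebra.ι k x, h x⟩
      map_add' := fun x y => Subtype.ext (map_add _ _ _)
      map_smul' := fun c x => Subtype.ext (map_smul _ _ _)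
      map_lie' := fun {x y} => Subtype.ext (envelope_ι_lie x y) }
  have : S.val.comp (UniversalEnvelopingAlgebra.lift k ι') = AlgHom.id k _ := by
    refine UniversalEnvelopingAlgebra.hom_ext k (LieHom.ext fun x => ?_)
    change S.val (UniversalEnvelopingAlgebra.lift k ι' (UniversalEnvelopingAlgebra.ι k x))
      = UniversalEnvelopingAlgebra.ι k x
    rw [UniversalEnvelopingAlgebra.lift_ι_apply]
    rfl
  rw [← AlgHom.id_apply (R := k) u, ← this]
  exact Subtype.property _

variable (k 𝔤) in
/-- The inclusion of `𝔤` into its enveloping algebra, as a linear map. -/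
def envι : 𝔤 →ₗ[k] UniversalEnvelopingAlgebra k 𝔤 :=
  (UniversalEnvelopingAlgebra.ι k : 𝔤 →ₗ⁅k⁆ UniversalEnvelopingAlgebra k 𝔤)

end

variable (k 𝔤) in
/-- The free `U(𝔤)`-module `U(𝔤) ⊗ 𝔤`. -/
abbrev FreeMod : Type _ := UniversalEnvelopingAlgebra k 𝔤 ⊗[k] 𝔤

variable (k 𝔤) in
/-- The action of `𝔤` on `U(𝔤) ⊗ 𝔤` by multiplication in the first factor. -/
def freeAct : 𝔤 →ₗ[k] Module.End k (FreeMod k 𝔤) :=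
  LinearMap.rTensorHom 𝔤 ∘ₗ LinearMap.mul k (UniversalEnvelopingAlgebra k 𝔤) ∘ₗ
    envι k 𝔤

theorem freeAct_tmul (x : 𝔤) (u : UniversalEnvelopingAlgebra k 𝔤) (c : 𝔤) :
    freeAct k 𝔤 x (u ⊗ₜ c) = (UniversalEnvelopingAlgebra.ι k x * u) ⊗ₜ c := rfl

theorem freeAct_lie (x y : 𝔤) :
    freeAct k 𝔤 ⁅x, y⁆ = freeAct k 𝔤 x * freeAct k 𝔤 y - freeAct k 𝔤 y * freeAct k 𝔤 x := by
  refine TensorProduct.ext' fun u c => ?_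
  change freeAct k 𝔤 ⁅x, y⁆ (u ⊗ₜ c) = freeAct k 𝔤 x (freeAct k 𝔤 y (u ⊗ₜ c))
    - freeAct k 𝔤 y (freeAct k 𝔤 x (u ⊗ₜ c))
  simp only [freeAct_tmul]
  rw [envelope_ι_lie, sub_mul, TensorProduct.sub_tmul, mul_assoc, mul_assoc]

variable {θ : 𝔤 →ₗ[k] Module.End k V} (hθ : ∀ x y, θ ⁅x, y⁆ = θ x * θ y - θ y * θ x)

include hθ in
/-- The universal property of the free module `U(𝔤) ⊗ 𝔤`. -/
theorem exists_freeMod_lift (g : 𝔤 →ₗ[k] V) : ∃ A : FreeMod k 𝔤 →ₗ[k] V,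
    (∀ x n, A (freeAct k 𝔤 x n) = θ x (A n)) ∧ ∀ c, A (1 ⊗ₜ c) = g c := by
  obtain ⟨F, hF⟩ := exists_envelope_lift θ hθ
  let A : FreeMod k 𝔤 →ₗ[k] V := TensorProduct.lift (F.toLinearMap.compl₂ g)
  have hA : ∀ u c, A (u ⊗ₜ c) = F u (g c) := fun u c => rfl
  refine ⟨A, fun x n => ?_, fun c => by rw [hA, map_one]; rfl⟩
  have : A ∘ₗ freeAct k 𝔤 x = θ x ∘ₗ A := by
    refine TensorProduct.ext' fun u c => ?_
    rw [LinearMap.comp_apply, LinearMap.comp_apply, freeAct_tmul, hA, hA, map_mul, hF]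
    rfl
  exact LinearMap.congr_fun this n

include hθ in
theorem freeMod_hom_ext {A A' : FreeMod k 𝔤 →ₗ[k] V}
    (hA : ∀ x n, A (freeAct k 𝔤 x n) = θ x (A n)) (hA' : ∀ x n, A' (freeAct k 𝔤 x n) = θ x (A' n))
    (h : ∀ c, A (1 ⊗ₜ c) = A' (1 ⊗ₜ c)) : A = A' := by
  obtain ⟨F, hF⟩ := exists_envelope_lift θ hθ
  have key : ∀ A : FreeMod k 𝔤 →ₗ[k] V, (∀ x n, A (freeAct k 𝔤 x n) = θ x (A n)) →
      ∀ u u' c, A ((u * u') ⊗ₜ c) = F u (A (u' ⊗ₜ c)) := by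
    intro A hA u
    let S : Subalgebra k (UniversalEnvelopingAlgebra k 𝔤) :=
      { carrier := {u | ∀ u' c, A ((u * u') ⊗ₜ c) = F u (A (u' ⊗ₜ c))}
        mul_mem' := fun {u v} hu hv u' c => by
          rw [mul_assoc, hu, hv, map_mul]
          rfl
        add_mem' := fun {u v} hu hv u' c => by
          rw [add_mul, TensorProduct.add_tmul, map_add, map_add, hu, hv]
          rfl
        algebraMap_mem' := fun r u' c => by
          rw [AlgHom.commutes, ← Algebra.smul_def, ← TensorProduct.smul_tmul', map_smul]
          rfl }
    refine envelope_mem_subalgebra S (fun x u' c => ?_) u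
    rw [← freeAct_tmul, hA, hF]
  refine TensorProduct.ext' fun u c => ?_
  have h1 := key A hA u 1 c
  have h2 := key A' hA' u 1 c
  rw [mul_one] at h1 h2
  rw [h1, h2, h]

end

end FreeModules

section ExtensionModel

noncomputable section

open TensorProduct

variable {k : Type*} [Field k] {𝔤 : Type*} [LieRing 𝔤] [LieAlgebra k 𝔤]
  {Q : Type*} [AddCommGroup Q] [Module k Q] {N : Type*} [AddCommGroup N] [Module k N]

/-- The action of `𝔤` on the linear maps `𝔤 → Q`. -/
def homAct (θ : 𝔤 →ₗ[k] Module.End k Q) : 𝔤 →ₗ[k] Module.End k (𝔤 →ₗ[k] Q) :=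
  LinearMap.mk₂ k (fun x f => θ x ∘ₗ f - f ∘ₗ (LieModule.toEnd k 𝔤 𝔤 x : 𝔤 →ₗ[k] 𝔤))
    (fun x y f => by ext; simp; abel) (fun c x f => by ext; simp [smul_sub])
    (fun x f g => by ext; simp; abel) (fun c x f => by ext; simp [smul_sub])

theorem homAct_apply (θ : 𝔤 →ₗ[k] Module.End k Q) (x : 𝔤) (f : 𝔤 →ₗ[k] Q) (y : 𝔤) :
    homAct θ x f y = θ x (f y) - f ⁅x, y⁆ := rfl

theorem homAct_lie {θ : 𝔤 →ₗ[k] Module.End k Q} (hθ : ∀ x y, θ ⁅x, y⁆ = θ x * θ y - θ y * θ x)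
    (x y : 𝔤) : homAct θ ⁅x, y⁆ = homAct θ x * homAct θ y - homAct θ y * homAct θ x := by
  refine LinearMap.ext fun f => LinearMap.ext fun z => ?_
  simp only [LinearMap.sub_apply, Module.End.mul_apply, homAct_apply, hθ, map_sub, lie_lie]
  abel

/-- The action of `𝔤` on the linear maps `𝔤 → Q` through the values. -/
def valAct (θ : 𝔤 →ₗ[k] Module.End k Q) : 𝔤 →ₗ[k] Module.End k (𝔤 →ₗ[k] Q) :=
  LinearMap.mk₂ k (fun x f => θ x ∘ₗ f)
    (fun x y f => by ext; simp) (fun c x f => by ext; simp)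
    (fun x f g => by ext; simp) (fun c x f => by ext; simp)

theorem valAct_apply (θ : 𝔤 →ₗ[k] Module.End k Q) (x : 𝔤) (f : 𝔤 →ₗ[k] Q) (y : 𝔤) :
    valAct θ x f y = θ x (f y) := rfl

theorem valAct_lie {θ : 𝔤 →ₗ[k] Module.End k Q} (hθ : ∀ x y, θ ⁅x, y⁆ = θ x * θ y - θ y * θ x)
    (x y : 𝔤) : valAct θ ⁅x, y⁆ = valAct θ x * valAct θ y - valAct θ y * valAct θ x := by
  refine LinearMap.ext fun f => LinearMap.ext fun z => ?_
  simp only [LinearMap.sub_apply, Module.End.mul_apply, valAct_apply, hθ]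

/-- The bilinear map `(y, x) ↦ x g(y) - g([x, y])`. -/
def rightGen (θ : 𝔤 →ₗ[k] Module.End k Q) (g : 𝔤 →ₗ[k] Q) : 𝔤 →ₗ[k] 𝔤 →ₗ[k] Q :=
  LinearMap.mk₂ k (fun y x => θ x (g y) - g ⁅x, y⁆)
    (fun x y z => by simp; abel) (fun c x y => by simp [smul_sub])
    (fun x y z => by simp; abel) (fun c x y => by simp [smul_sub])

/-- The diagonal action on a product. -/
def diagOp (α : 𝔤 →ₗ[k] Module.End k Q) (β : 𝔤 →ₗ[k] Module.End k N) :
    𝔤 →ₗ[k] Module.End k (Q × N) :=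
  LinearMap.mk₂ k (fun x p => (α x p.1, β x p.2))
    (fun x y p => by simp) (fun c x p => by simp) (fun x p q => by simp) (fun c x p => by simp)

/-- The nilpotent operators on a product given by maps between the factors. -/
def nilOp (γ : N →ₗ[k] 𝔤 →ₗ[k] Q) : 𝔤 →ₗ[k] Module.End k (Q × N) :=
  LinearMap.mk₂ k (fun x p => (γ p.2 x, 0))
    (fun x y p => by simp) (fun c x p => by simp) (fun x p q => by simp) (fun c x p => by simp)

theorem diagOp_apply (α : 𝔤 →ₗ[k] Module.End k Q) (β : 𝔤 →ₗ[k] Module.End k N) (x : 𝔤) (p : Q × N) :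
    diagOp α β x p = (α x p.1, β x p.2) := rfl

theorem nilOp_apply (γ : N →ₗ[k] 𝔤 →ₗ[k] Q) (x : 𝔤) (p : Q × N) :
    nilOp γ x p = (γ p.2 x, 0) := rfl

/-- The relations `∂ q = δ(q)` on power series with coefficients in `Q × N`. -/
def shiftRel (δ : Q →ₗ[k] N) : (ℕ → Q) →ₗ[k] (ℕ → Q × N) where
  toFun p s := (seqShift k Q p s, - δ (p s))
  map_add' p q := by ext s <;> simp [add_comm]
  map_smul' c p := by ext s <;> simp

theorem shiftRel_apply (δ : Q →ₗ[k] N) (p : ℕ → Q) (s : ℕ) :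
    shiftRel δ p s = (seqShift k Q p s, - δ (p s)) := rfl

/-- The operators on power series are compatible with the relations `∂ q = δ(q)`. -/
theorem seqOp_shiftRel (δ : Q →ₗ[k] N) {α : 𝔤 →ₗ[k] Module.End k Q} {β : 𝔤 →ₗ[k] Module.End k N}
    {γ : N →ₗ[k] 𝔤 →ₗ[k] Q} (hγ : ∀ x q, γ (δ q) x = α x q) (hδ : ∀ x q, δ (α x q) = β x (δ q))
    (n : ℕ) (x : 𝔤) (p : ℕ → Q) :
    seqOp (diagOp α β) (nilOp γ) n x (shiftRel δ p) = shiftRel δ (seqOp α 0 n x p) := by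
  funext s
  have h := congrFun (LinearMap.congr_fun (seqOp_mul_shift α 0 n x) p) s
  simp only [Module.End.mul_apply, LinearMap.add_apply, LinearMap.smul_apply, Pi.add_apply,
    Pi.smul_apply] at h
  rw [shiftRel_apply, seqOp_apply]
  refine Prod.ext ?_ ?_
  · simp only [diagOp_apply, nilOp_apply, shiftRel_apply, Prod.fst_add, Prod.smul_fst, map_neg,
      LinearMap.neg_apply, hγ]
    rw [seqOp_apply, seqOp_apply] at h
    simp only [LinearMap.zero_apply, smul_zero, add_zero] at h
    rw [h]
    simp
  · simp only [diagOp_apply, nilOp_apply, shiftRel_apply, Prod.snd_add, Prod.smul_snd, map_neg,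
      smul_zero, add_zero]
    rw [seqOp_apply]
    simp [hδ]

theorem range_shiftRel_le_comap {δ : Q →ₗ[k] N} {α : 𝔤 →ₗ[k] Module.End k Q}
    {β : 𝔤 →ₗ[k] Module.End k N} {γ : N →ₗ[k] 𝔤 →ₗ[k] Q} (hγ : ∀ x q, γ (δ q) x = α x q)
    (hδ : ∀ x q, δ (α x q) = β x (δ q)) (n : ℕ) (x : 𝔤) :
    LinearMap.range (shiftRel δ)
      ≤ (LinearMap.range (shiftRel δ)).comap (seqOp (diagOp α β) (nilOp γ) n x) := by
  rintro _ ⟨p, rfl⟩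
  exact ⟨_, (seqOp_shiftRel δ hγ hδ n x p).symm⟩

/-- A representation `Q` of `𝔤` generated by vectors `w x y` and `e`, which is an extension of a
syzygy module of the trivial module by the cocycle `φ(x, [y, z]) / 2` with values in `k e`; the map
`δ` is the differential of the Chevalley–Eilenberg resolution. -/
structure CocycleExtension (φ : LinearMap.BilinForm k 𝔤) (Q : Type*) [AddCommGroup Q]
    [Module k Q] where
  θ : 𝔤 →ₗ[k] Module.End k Q
  w : 𝔤 →ₗ[k] 𝔤 →ₗ[k] Q
  e : Q
  θ_lie : ∀ x y, θ ⁅x, y⁆ = θ x * θ y - θ y * θ x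
  θ_e : ∀ x, θ x e = 0
  w_skew : ∀ x y, w x y = - w y x
  rel : ∀ x y z, θ x (w y z) + θ y (w z x) + θ z (w x y) - w ⁅y, z⁆ x - w ⁅z, x⁆ y - w ⁅x, y⁆ z
    = ((1 / 2 : k) * φ x ⁅y, z⁆) • e
  δ : Q →ₗ[k] FreeMod k 𝔤
  δ_θ : ∀ x q, δ (θ x q) = freeAct k 𝔤 x (δ q)
  δ_w : ∀ x y, δ (w x y)
    = freeAct k 𝔤 x (1 ⊗ₜ y) - freeAct k 𝔤 y (1 ⊗ₜ x) - 1 ⊗ₜ ⁅x, y⁆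
  δ_e : δ e = 0
  gen : ∀ S : Submodule k Q, (∀ x q, q ∈ S → θ x q ∈ S) → (∀ x y, w x y ∈ S) → e ∈ S → S = ⊤

namespace CocycleExtension

variable {φ : LinearMap.BilinForm k 𝔤} (T : CocycleExtension φ Q)

theorem hom_ext {θ' : 𝔤 →ₗ[k] Module.End k N} {A A' : Q →ₗ[k] N}
    (hA : ∀ x q, A (T.θ x q) = θ' x (A q)) (hA' : ∀ x q, A' (T.θ x q) = θ' x (A' q))
    (hw : ∀ x y, A (T.w x y) = A' (T.w x y)) (he : A T.e = A' T.e) : A = A' := by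
  have := T.gen (LinearMap.eqLocus A A')
    (fun x q hq => by
      rw [LinearMap.mem_eqLocus] at hq ⊢
      rw [hA, hA', hq]) hw he
  exact LinearMap.ext fun q => (this ▸ Submodule.mem_top : q ∈ LinearMap.eqLocus A A')

variable (hsymm : ∀ x y, φ x y = φ y x) (hinv : ∀ x y z, φ ⁅x, y⁆ z = φ x ⁅y, z⁆) [CharZero k]

include hsymm hinv in
/-- The operators on `Q ⊕ (U(𝔤) ⊗ 𝔤)` extending those of a bimodule over `𝔤 ⋉ ε𝔤`: `lam n x` is
`ε x · n`, `eta n x` is `n · ε x`, `rho n x` is `n · x`. -/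
theorem exists_operators : ∃ (lam eta : FreeMod k 𝔤 →ₗ[k] 𝔤 →ₗ[k] Q)
    (rho : FreeMod k 𝔤 →ₗ[k] 𝔤 →ₗ[k] FreeMod k 𝔤),
    (∀ x n, lam (freeAct k 𝔤 x n) = homAct T.θ x (lam n)) ∧
    (∀ x n, eta (freeAct k 𝔤 x n) = valAct T.θ x (eta n)) ∧
    (∀ x n, rho (freeAct k 𝔤 x n) = valAct (freeAct k 𝔤) x (rho n)) ∧
    (∀ x y, lam (1 ⊗ₜ y) x = T.w x y + ((1 / 2 : k) * φ x y) • T.e) ∧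
    (∀ x y, eta (1 ⊗ₜ y) x = T.w x y - ((1 / 2 : k) * φ x y) • T.e) ∧
    (∀ x y, rho (1 ⊗ₜ y) x = freeAct k 𝔤 x (1 ⊗ₜ y) - 1 ⊗ₜ ⁅x, y⁆) ∧
    (∀ x q, lam (T.δ q) x = T.θ x q) ∧
    (∀ x q, T.δ (eta (T.δ q) x) = rho (T.δ q) x) ∧
    ∀ x y n, eta (T.δ (lam n y)) x = lam (rho n x) y := by
  have hval := valAct_lie T.θ_lie
  have hhom := homAct_lie T.θ_lie
  have hfree := valAct_lie (freeAct_lie (k := k) (𝔤 := 𝔤))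
  obtain ⟨lam, hlam, hlam1⟩ := exists_freeMod_lift hhom
    (T.w.flip + (1 / 2 : k) • (φ.flip.compr₂ (LinearMap.toSpanSingleton k Q T.e)))
  obtain ⟨eta, heta, heta1⟩ := exists_freeMod_lift hval
    (T.w.flip - (1 / 2 : k) • (φ.flip.compr₂ (LinearMap.toSpanSingleton k Q T.e)))
  obtain ⟨rho, hrho, hrho1⟩ := exists_freeMod_lift hfree
    (rightGen (freeAct k 𝔤) (TensorProduct.mk k (UniversalEnvelopingAlgebra k 𝔤) 𝔤 1))
  replace hlam1 : ∀ x y, lam (1 ⊗ₜ y) x = T.w x y + ((1 / 2 : k) * φ x y) • T.e := fun x y => by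
    rw [hlam1, mul_smul]
    rfl
  replace heta1 : ∀ x y, eta (1 ⊗ₜ y) x = T.w x y - ((1 / 2 : k) * φ x y) • T.e := fun x y => by
    rw [heta1, mul_smul]
    rfl
  replace hrho1 : ∀ x y, rho (1 ⊗ₜ y) x = freeAct k 𝔤 x (1 ⊗ₜ y) - 1 ⊗ₜ ⁅x, y⁆ := fun x y => by
    rw [hrho1]
    rfl
  have rel := T.rel
  have skew := T.w_skew
  refine ⟨lam, eta, rho, hlam, heta, hrho, hlam1, heta1, hrho1, ?_, ?_, ?_⟩
  · have : lam ∘ₗ T.δ = T.θ.flip := by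
      refine T.hom_ext (θ' := homAct T.θ) (fun x q => ?_) (fun x q => ?_) (fun b c => ?_) ?_
      · rw [LinearMap.comp_apply, T.δ_θ, hlam]
        rfl
      · refine LinearMap.ext fun a => ?_
        simp only [homAct_apply, LinearMap.flip_apply, T.θ_lie, LinearMap.sub_apply,
          Module.End.mul_apply]
        abel
      · refine LinearMap.ext fun a => ?_
        rw [LinearMap.comp_apply, T.δ_w, map_sub, map_sub, hlam, hlam]
        simp only [LinearMap.sub_apply, homAct_apply, hlam1, LinearMap.flip_apply, map_add,
          map_smul, T.θ_e, smul_zero, add_zero]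
        have h1 := rel a b c
        have e1 : φ ⁅b, a⁆ c = - φ a ⁅b, c⁆ := by
          rw [← lie_skew, map_neg, LinearMap.neg_apply, hinv]
        have e2 : φ ⁅c, a⁆ b = φ a ⁅b, c⁆ := by rw [hinv, hsymm, hinv]
        rw [e1, e2]
        rw [skew c a, map_neg] at h1
        rw [← lie_skew b a, skew a ⁅b, c⁆]
        simp only [map_neg, LinearMap.neg_apply]
        linear_combination (norm := module) -h1
      · refine LinearMap.ext fun a => ?_
        rw [LinearMap.comp_apply, T.δ_e, map_zero, LinearMap.flip_apply, T.θ_e]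
        rfl
    exact fun x q => LinearMap.congr_fun₂ this q x
  · have : (T.δ.compRight k) ∘ₗ eta ∘ₗ T.δ = rho ∘ₗ T.δ := by
      refine T.hom_ext (θ' := valAct (freeAct k 𝔤)) (fun x q => ?_) (fun x q => ?_)
        (fun b c => ?_) ?_
      · refine LinearMap.ext fun a => ?_
        change T.δ (eta (T.δ _) a) = freeAct k 𝔤 x (T.δ (eta (T.δ q) a))
        rw [T.δ_θ, heta, valAct_apply, T.δ_θ]
      · rw [LinearMap.comp_apply, T.δ_θ, hrho]
        rfl
      · refine LinearMap.ext fun a => ?_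
        change T.δ (eta (T.δ _) a) = rho (T.δ _) a
        rw [T.δ_w]
        simp only [map_sub, LinearMap.sub_apply, heta, hrho, valAct_apply, heta1, hrho1, map_smul,
          T.δ_θ, T.δ_w, T.δ_e, smul_zero, sub_zero]
        rw [freeAct_lie, LinearMap.sub_apply, Module.End.mul_apply, Module.End.mul_apply]
        abel
      · refine LinearMap.ext fun a => ?_
        change T.δ (eta (T.δ _) a) = rho (T.δ _) a
        rw [T.δ_e]
        simp
    exact fun x q => LinearMap.congr_fun₂ this q x
  · intro x y n
    have : ((eta.flip x ∘ₗ T.δ).compRight k) ∘ₗ lam = lam ∘ₗ rho.flip x := by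
      refine freeMod_hom_ext hhom (fun b n => ?_) (fun b n => ?_) (fun c => ?_)
      · refine LinearMap.ext fun y => ?_
        change eta (T.δ (lam _ y)) x = T.θ b (eta (T.δ (lam n y)) x) - eta (T.δ (lam n ⁅b, y⁆)) x
        rw [hlam, homAct_apply, map_sub, map_sub, LinearMap.sub_apply, T.δ_θ, heta, valAct_apply]
      · rw [LinearMap.comp_apply, LinearMap.flip_apply, hrho, valAct_apply, hlam]
        rfl
      · refine LinearMap.ext fun y => ?_
        change eta (T.δ (lam _ y)) x = lam (rho _ x) y
        rw [hlam1, hrho1]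
        simp only [map_sub, map_add, map_smul, T.δ_w, T.δ_e, smul_zero, add_zero, hlam, heta,
          LinearMap.sub_apply, homAct_apply, valAct_apply, hlam1, heta1, T.θ_e, sub_zero]
        have h1 := rel x y c
        rw [skew c x, map_neg, ← lie_skew c x, map_neg, LinearMap.neg_apply] at h1
        rw [skew y ⁅x, c⁆, skew x ⁅y, c⁆]
        have e1 : φ ⁅x, y⁆ c = φ x ⁅y, c⁆ := hinv x y c
        have e2 : φ y ⁅x, c⁆ = - φ x ⁅y, c⁆ := by
          rw [← hinv, ← lie_skew, map_neg, LinearMap.neg_apply, hinv]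
        rw [e1, e2]
        linear_combination (norm := module) -h1
    exact LinearMap.congr_fun₂ this n y

end CocycleExtension

end

end ExtensionModel

/-! ### The model in which `e` survives -/

section ExtensionModel

noncomputable section

open TensorProduct

variable {k : Type*} [Field k] {𝔤 : Type*} [LieRing 𝔤] [LieAlgebra k 𝔤]
  {Q : Type*} [AddCommGroup Q] [Module k Q] {φ : LinearMap.BilinForm k 𝔤} [CharZero k]

namespace CocycleExtension

variable (T : CocycleExtension φ Q)
  (hsymm : ∀ x y, φ x y = φ y x) (hinv : ∀ x y z, φ ⁅x, y⁆ z = φ x ⁅y, z⁆)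

/-- The constant power series `c`, modulo the relations `∂ q = δ(q)`. -/
def const (p : Q × FreeMod k 𝔤) : (ℕ → Q × FreeMod k 𝔤) ⧸ LinearMap.range (shiftRel T.δ) :=
  (LinearMap.range (shiftRel T.δ)).mkQ (seq₃ p 0 0)

include hsymm hinv in
/-- A cocycle extension `Q` gives a model on the quotient of the power series with coefficients in
`Q ⊕ (U(𝔤) ⊗ 𝔤)` by the relations `∂ q = δ(q)`: the generator `c` goes to `1 ⊗ c`, and `e` to
`e ∈ Q`. -/
theorem exists_model : ∃ μ : Model φ ((ℕ → Q × FreeMod k 𝔤) ⧸ LinearMap.range (shiftRel T.δ)),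
    μ.E = T.const (T.e, 0) := by
  obtain ⟨lam, eta, rho, hlam, heta, hrho, hlam1, heta1, hrho1, hlamδ, hδeta, hetalam⟩ :=
    T.exists_operators hsymm hinv
  let K := LinearMap.range (shiftRel T.δ)
  let r : 𝔤 →ₗ[k] Module.End k Q := LinearMap.flip (eta ∘ₗ T.δ)
  have hr : ∀ x q, r x q = eta (T.δ q) x := fun x q => rfl
  let ρ : Rep k 𝔤 (ℕ → Q × FreeMod k 𝔤) :=
    seqRep (diagOp T.θ (freeAct k 𝔤)) (nilOp lam) (diagOp r rho.flip) (nilOp eta)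
    (fun x y => LinearMap.ext fun p => by
      simp [diagOp_apply, T.θ_lie, freeAct_lie])
    (fun x y => LinearMap.ext fun p => by
      simp [diagOp_apply, nilOp_apply, hlam, homAct_apply])
    (fun x y => LinearMap.ext fun p => by
      simp [nilOp_apply])
    (fun x y => LinearMap.ext fun p => by
      simp [diagOp_apply, hr, T.δ_θ, heta, hrho, valAct_apply])
    (fun x y => LinearMap.ext fun p => by
      simp [diagOp_apply, nilOp_apply, hr, hetalam])
    (fun x y => LinearMap.ext fun p => by
      simp [diagOp_apply, nilOp_apply, heta, valAct_apply])
    (fun x y => LinearMap.ext fun p => by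
      simp [nilOp_apply])
  have hL : ∀ n x, K ≤ K.comap (ρ.L n x) :=
    range_shiftRel_le_comap hlamδ T.δ_θ
  have hR : ∀ n x, K ≤ K.comap (ρ.R n x) :=
    range_shiftRel_le_comap (fun x q => rfl) hδeta
  have hD : K ≤ K.comap ρ.D := by
    rintro _ ⟨p, rfl⟩
    refine ⟨seqShift k Q p, funext fun s => ?_⟩
    cases s <;> simp [ρ, seqRep, shiftRel_apply]
  -- The action on constants.
  have L0 : ∀ x p, (ρ.quot K hL hR hD).L 0 x (T.const p)
      = T.const (T.θ x p.1, freeAct k 𝔤 x p.2) := fun x p => by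
    refine congrArg K.mkQ ((seqOp_zero_seq₃ _ _ _ _ _ _).trans ?_)
    rw [map_zero, diagOp_apply]
  have R0 : ∀ x p, (ρ.quot K hL hR hD).R 0 x (T.const p)
      = T.const (eta (T.δ p.1) x, rho p.2 x) := fun x p => by
    refine congrArg K.mkQ ((seqOp_zero_seq₃ _ _ _ _ _ _).trans ?_)
    rw [map_zero, diagOp_apply]
    rfl
  have L1 : ∀ x p, (ρ.quot K hL hR hD).L 1 x (T.const p) = T.const (lam p.2 x, 0) := fun x p => by
    refine congrArg K.mkQ ((seqOp_one_seq₃ _ _ _ _ _).trans ?_)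
    rw [map_zero, map_zero, zero_add, nilOp_apply]
  have R1 : ∀ x p, (ρ.quot K hL hR hD).R 1 x (T.const p) = T.const (eta p.2 x, 0) := fun x p => by
    refine congrArg K.mkQ ((seqOp_one_seq₃ _ _ _ _ _).trans ?_)
    rw [map_zero, map_zero, zero_add, nilOp_apply]
  have hseq : seq₃ (0 : Q × FreeMod k 𝔤) 0 0 = 0 := by
    ext (_ | _ | _ | s) <;> rfl
  have L2 : ∀ n x p, 2 ≤ n → (ρ.quot K hL hR hD).L n x (T.const p) = 0 := fun n x p hn => by
    refine (congrArg K.mkQ ?_).trans (map_zero _)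
    rcases hn.eq_or_lt with rfl | hn
    · refine (seqOp_two_seq₃ _ _ _ _ _).trans ?_
      rw [map_zero, smul_zero, hseq]
    · exact seqOp_seq₃_of_three_le _ _ hn _ _ _
  have R2 : ∀ n x p, 2 ≤ n → (ρ.quot K hL hR hD).R n x (T.const p) = 0 := fun n x p hn => by
    refine (congrArg K.mkQ ?_).trans (map_zero _)
    rcases hn.eq_or_lt with rfl | hn
    · refine (seqOp_two_seq₃ _ _ _ _ _).trans ?_
      rw [map_zero, smul_zero, hseq]
    · exact seqOp_seq₃_of_three_le _ _ hn _ _ _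
  have D0 : ∀ q, (ρ.quot K hL hR hD).D (T.const (q, 0)) = T.const (0, T.δ q) := fun q => by
    refine (Submodule.Quotient.eq _).mpr ⟨seq₃ q 0 0, funext fun s => ?_⟩
    rcases s with _ | _ | _ | _ | s <;>
      simp [ρ, seqRep, shiftRel_apply, seq₃]
  have cadd : ∀ p q, T.const (p + q) = T.const p + T.const q := fun p q => by
    rw [const, const, const, ← map_add, seq₃_add, add_zero]
  have csmul : ∀ (c : k) p, T.const (c • p) = c • T.const p := fun c p => by
    rw [const, const, ← map_smul, seq₃_smul, smul_zero]
  have csub : ∀ p q, T.const (p - q) = T.const p - T.const q := fun p q => by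
    rw [const, const, const, ← map_sub, seq₃_sub, sub_zero]
  have czero : T.const (0, 0) = 0 := by
    rw [← Prod.zero_eq_mk, const, hseq, map_zero]
  refine ⟨{
    toRep := ρ.quot K hL hR hD
    X :=
      { toFun := fun x => T.const (0, 1 ⊗ₜ x)
        map_add' := fun x y => by rw [← cadd]; simp [TensorProduct.tmul_add]
        map_smul' := fun c x => by rw [← csmul]; simp }
    E := T.const (T.e, 0)
    locL := fun n x y hn => L2 n x _ (by omega)
    locR := fun n x y hn => R2 n x _ (by omega)
    L_E := fun n x => by
      rcases n with _ | _ | n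
      · rw [L0]
        simp [T.θ_e, czero]
      · rw [L1]
        simp [czero]
      · exact L2 _ x _ (by omega)
    R_E := fun n x => by
      rcases n with _ | _ | n
      · rw [R0]
        simp [T.δ_e, czero]
      · rw [R1]
        simp [czero]
      · exact R2 _ x _ (by omega)
    D_E := by
      rw [D0, T.δ_e]
      exact czero
    RL2 := fun x y => (R2 2 x _ le_rfl).trans (L2 2 y _ le_rfl).symm
    RL1 := fun x y => by
      change (ρ.quot K hL hR hD).R 1 x (T.const (0, 1 ⊗ₜ y))
        = - (ρ.quot K hL hR hD).L 1 y (T.const (0, 1 ⊗ₜ x))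
          + (ρ.quot K hL hR hD).D ((ρ.quot K hL hR hD).L 2 y (T.const (0, 1 ⊗ₜ x)))
      rw [R1, L1, L2 2 y _ le_rfl, map_zero, add_zero, heta1, hlam1, ← zero_sub, ← czero, ← csub,
        T.w_skew y x, hsymm y x]
      congr 1
      ext
      · simp
        abel
      · simp
    RL0 := fun x y => by
      change (ρ.quot K hL hR hD).R 0 x (T.const (0, 1 ⊗ₜ y))
        = (ρ.quot K hL hR hD).L 0 y (T.const (0, 1 ⊗ₜ x))
          - (ρ.quot K hL hR hD).D ((ρ.quot K hL hR hD).L 1 y (T.const (0, 1 ⊗ₜ x)))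
          + (1 / 2 : k) • (ρ.quot K hL hR hD).D ((ρ.quot K hL hR hD).D
            ((ρ.quot K hL hR hD).L 2 y (T.const (0, 1 ⊗ₜ x))))
      have e1 : T.δ (lam (1 ⊗ₜ x) y) = freeAct k 𝔤 y (1 ⊗ₜ x) - freeAct k 𝔤 x (1 ⊗ₜ y)
          + 1 ⊗ₜ ⁅x, y⁆ := by
        rw [hlam1, map_add, map_smul, T.δ_e, smul_zero, add_zero, T.δ_w, ← lie_skew y x,
          TensorProduct.tmul_neg, sub_neg_eq_add]
      rw [R0, L0, L1, L2 2 y _ le_rfl, D0]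
      simp only [map_zero, smul_zero, add_zero]
      rw [e1, ← csub, hrho1]
      congr 1
      ext
      · simp
      · simp only [Prod.snd_sub]
        abel
    comm0 := fun x y => by
      change (ρ.quot K hL hR hD).R 0 x (T.const (0, 1 ⊗ₜ y))
        = (ρ.quot K hL hR hD).L 0 x (T.const (0, 1 ⊗ₜ y)) - T.const (0, 1 ⊗ₜ ⁅x, y⁆)
      rw [R0, L0, ← csub, hrho1]
      congr 1
      ext
      · simp
      · simp
    comm1 := fun x y => by
      change (ρ.quot K hL hR hD).R 1 x (T.const (0, 1 ⊗ₜ y))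
        = (ρ.quot K hL hR hD).L 1 x (T.const (0, 1 ⊗ₜ y)) - φ x y • T.const (T.e, 0)
      rw [R1, L1, ← csmul, ← csub, heta1, hlam1]
      congr 1
      ext
      · simp only [Prod.fst_sub, Prod.smul_fst]
        module
      · simp
    comm2 := fun x y => (R2 2 x _ le_rfl).trans (L2 2 x _ le_rfl).symm }, rfl⟩

omit [CharZero k] in
theorem const_e_ne_zero (he : T.e ≠ 0) : T.const (T.e, 0) ≠ 0 := by
  intro h
  obtain ⟨p, hp⟩ := (Submodule.Quotient.mk_eq_zero _).mp h
  have := congrArg Prod.fst (congrFun hp 0)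
  rw [shiftRel_apply] at this
  exact he this.symm

end CocycleExtension

end

end ExtensionModel

section Extension

noncomputable section

variable {k : Type*} [Field k] {𝔤 : Type*} [LieRing 𝔤] [LieAlgebra k 𝔤] {ι : Type*} [LinearOrder ι]
  {B : Module.Basis ι k 𝔤} {G : Type*} {P : ι → G → (List ι × G →₀ k) → Prop}
  {V : Type*} [AddCommGroup V] [Module k V]

omit [LinearOrder ι] in
theorem eq_of_basis {f g : 𝔤 →ₗ[k] V} (h : ∀ i, f (B i) = g (B i)) (x : 𝔤) : f x = g x :=
  LinearMap.congr_fun (B.ext h) x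

theorem presented_gen {S : Submodule k (Presented B P)}
    (hS : ∀ x q, q ∈ S → pact B P x q ∈ S) (hg : ∀ g, pmk B P [] g ∈ S) : S = ⊤ := by
  have hw : ∀ w g, pmk B P w g ∈ S := fun w g => by
    induction w with
    | nil => exact hg g
    | cons i w ih =>
      rw [← pact_basis_pmk]
      exact hS _ _ ih
  have : S.mkQ = 0 := presented_hom_ext fun w g => by simpa using hw w g
  rw [← S.ker_mkQ, this, LinearMap.ker_zero]

/-- The universal property of a presented module. -/
theorem exists_presented_lift {θ : 𝔤 →ₗ[k] Module.End k V}
    (hθ : ∀ x y, θ ⁅x, y⁆ = θ x * θ y - θ y * θ x) (γ : G → V)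
    (hγ : ∀ ev : (List ι × G →₀ k) →ₗ[k] V, (∀ g, ev (Finsupp.single ([], g) 1) = γ g) →
      (∀ i f, ev (pre k [i] f) = θ (B i) (ev f)) → ∀ a g ρ, P a g ρ → θ (B a) (γ g) = ev ρ) :
    ∃ A : Presented B P →ₗ[k] V, (∀ x q, A (pact B P x q) = θ x (A q)) ∧
      ∀ g, A (pmk B P [] g) = γ g := by
  let ev : (List ι × G →₀ k) →ₗ[k] V := Finsupp.linearCombination k fun t =>
    (t.1.map fun i => θ (B i)).prod (γ t.2)
  have hev1 : ∀ w g, ev (Finsupp.single (w, g) 1) = (w.map fun i => θ (B i)).prod (γ g) :=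
    fun w g => by simp [ev]
  have hev : ∀ w f, ev (pre k w f) = (w.map fun i => θ (B i)).prod (ev f) := by
    intro w f
    have : ev ∘ₗ pre k w = (w.map fun i => θ (B i)).prod ∘ₗ ev := by
      refine Finsupp.lhom_ext' fun t => LinearMap.ext_ring ?_
      simp [hev1]
    exact LinearMap.congr_fun this f
  have hevi : ∀ i f, ev (pre k [i] f) = θ (B i) (ev f) := fun i f => by
    rw [hev]
    simp
  have hev0 : ∀ g, ev (Finsupp.single ([], g) 1) = γ g := fun g => by simp [ev]
  let A : Presented B P →ₗ[k] V := Submodule.liftQ _ ev <| by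
    refine Submodule.span_le.mpr ?_
    rintro f ⟨m, r, hr, rfl⟩
    refine LinearMap.mem_ker.mpr ((map_sub _ _ _).trans (sub_eq_zero.mpr ?_))
    cases hr with
    | comm u v a b g h =>
      rw [map_add, map_slot, hev1, hev1]
      have : ∀ x, slot B (fun w => ev (Finsupp.single (w, g) 1)) u v x
          = (u.map fun i => θ (B i)).prod (θ x ((v.map fun i => θ (B i)).prod (γ g))) := by
        intro x
        have h1 : slot B (fun w => ev (Finsupp.single (w, g) 1)) u v
            = (u.map fun i => θ (B i)).prod ∘ₗ
              θ.flip ((v.map fun i => θ (B i)).prod (γ g)) := by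
          refine B.ext fun i => ?_
          simp [hev1]
        exact LinearMap.congr_fun h1 x
      rw [this, hθ]
      simp
    | gen u a g ρ h =>
      rw [hev1, hev, ← hγ ev hev0 hevi a g ρ h]
      simp
  refine ⟨A, fun x q => ?_, fun g => hev0 g⟩
  have : (A.compRight k) ∘ₗ pact B P = (A.lcomp k V) ∘ₗ θ := by
    refine B.ext fun i => presented_hom_ext fun w g => ?_
    change A (pact B P (B i) (pmk B P w g)) = θ (B i) (A (pmk B P w g))
    rw [pact_basis_pmk]
    change ev (Finsupp.single _ 1) = θ (B i) (ev (Finsupp.single _ 1))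
    rw [hev1, hev1]
    simp
  exact LinearMap.congr_fun₂ this x q


section Construction

variable [CharZero k] (B) {φ : LinearMap.BilinForm k 𝔤}
  (hsymm : ∀ x y, φ x y = φ y x) (hinv : ∀ x y z, φ ⁅x, y⁆ z = φ x ⁅y, z⁆)

/-- Values `β x y` of a skew bilinear map on the generators. -/
def genVal (β : 𝔤 →ₗ[k] 𝔤 →ₗ[k] V) (e : V) : Option {p : ι × ι // p.2 < p.1} → V
  | none => e
  | some p => β (B p.1.1) (B p.1.2)

theorem map_extGen {β : 𝔤 →ₗ[k] 𝔤 →ₗ[k] V} (hβ : ∀ x y, β x y = - β y x) {e : V}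
    {ev : (ExtMon ι →₀ k) →ₗ[k] V} (hev : ∀ g, ev (Finsupp.single ([], g) 1) = genVal B β e g)
    (x y : 𝔤) : ev (extGen B x y) = β x y := by
  have : (extGen B).compr₂ ev = β := by
    refine B.ext fun i => B.ext fun j => ?_
    rw [LinearMap.compr₂_apply]
    rcases lt_trichotomy i j with h | rfl | h
    · rw [extGen_skew, extGen_basis B h, map_neg, hev, hβ (B i)]
      rfl
    · have h0 : extGen B (B i) (B i) = 0 := by simp [extGen]
      have h2 : (2 : k) • β (B i) (B i) = 0 := by
        rw [two_smul]
        nth_rewrite 1 [hβ]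
        exact neg_add_cancel _
      rw [h0, map_zero, (smul_eq_zero_iff_right two_ne_zero).mp h2]
    · rw [extGen_basis B h, hev]
      rfl
  exact LinearMap.congr_fun₂ this x y

omit [LinearOrder ι] [CharZero k] in
theorem pre_nil {G : Type*} (f : List ι × G →₀ k) : pre k [] f = f := by
  have : pre k ([] : List ι) = (LinearMap.id : (List ι × G →₀ k) →ₗ[k] _) := by
    ext t : 2
    simp
  exact LinearMap.congr_fun this f

/-- The differential of the Chevalley–Eilenberg complex in degree two. -/
def koszulGen (θ : 𝔤 →ₗ[k] Module.End k V) (g : 𝔤 →ₗ[k] V) : 𝔤 →ₗ[k] 𝔤 →ₗ[k] V :=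
  LinearMap.mk₂ k (fun x y => θ x (g y) - θ y (g x) - g ⁅x, y⁆)
    (fun x y z => by simp; abel) (fun c x y => by simp [smul_sub])
    (fun x y z => by simp; abel) (fun c x y => by simp [smul_sub])

omit [CharZero k] in
theorem koszulGen_apply (θ : 𝔤 →ₗ[k] Module.End k V) (g : 𝔤 →ₗ[k] V) (x y : 𝔤) :
    koszulGen θ g x y = θ x (g y) - θ y (g x) - g ⁅x, y⁆ := rfl

omit [CharZero k] in
theorem koszulGen_skew (θ : 𝔤 →ₗ[k] Module.End k V) (g : 𝔤 →ₗ[k] V) (x y : 𝔤) :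
    koszulGen θ g x y = - koszulGen θ g y x := by
  rw [koszulGen_apply, koszulGen_apply, ← lie_skew, map_neg]
  abel

omit [CharZero k] in
/-- The composite of two differentials of the Chevalley–Eilenberg complex is zero. -/
theorem koszulGen_rel {θ : 𝔤 →ₗ[k] Module.End k V}
    (hθ : ∀ x y, θ ⁅x, y⁆ = θ x * θ y - θ y * θ x) (g : 𝔤 →ₗ[k] V) (x y z : 𝔤) :
    θ x (koszulGen θ g y z) + θ y (koszulGen θ g z x) + θ z (koszulGen θ g x y)
      = koszulGen θ g ⁅y, z⁆ x + koszulGen θ g ⁅z, x⁆ y + koszulGen θ g ⁅x, y⁆ z := by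
  have J : g ⁅⁅y, z⁆, x⁆ + g ⁅⁅z, x⁆, y⁆ + g ⁅⁅x, y⁆, z⁆ = 0 := by
    rw [← map_add, ← map_add, ← lie_skew ⁅y, z⁆ x, ← lie_skew ⁅z, x⁆ y, ← lie_skew ⁅x, y⁆ z,
      ← neg_add, ← neg_add, lie_jacobi, neg_zero, map_zero]
  simp only [koszulGen_apply, map_sub, hθ, LinearMap.sub_apply, Module.End.mul_apply]
  linear_combination (norm := abel) J

open TensorProduct in
include hsymm hinv in
/-- The module presented by `ExtRule` is a cocycle extension with `e ≠ 0`. -/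
theorem exists_cocycleExtension [WellFoundedLT ι] :
    ∃ T : CocycleExtension φ (Presented B (ExtRule φ B)), T.e ≠ 0 := by
  let Q := Presented B (ExtRule φ B)
  let q : (ExtMon ι →₀ k) →ₗ[k] Q := (relSpan (PRule B (ExtRule φ B))).mkQ
  let w : 𝔤 →ₗ[k] 𝔤 →ₗ[k] Q := (extGen B).compr₂ q
  let e : Q := pmk B (ExtRule φ B) [] none
  have hq : ∀ i f, q (pre k [i] f) = pact B _ (B i) (q f) := fun i f =>
    (pact_basis_mkQ B _ i f).symm
  have hw' : ∀ x y, q (extGen B x y) = w x y := fun x y => rfl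
  have hw : ∀ x y, w x y = - w y x := fun x y => by
    rw [← hw', ← hw', extGen_skew, map_neg]
  have he : ∀ x, pact B (ExtRule φ B) x e = 0 := by
    intro x
    refine (eq_of_basis (B := B) (f := (pact B (ExtRule φ B)).flip e) (g := 0) (fun i => ?_) x)
    rw [LinearMap.flip_apply, pact_basis_pmk]
    refine (mkQ_rule (PRule.gen [] i none 0 (.e i))).trans ?_
    rw [map_zero, map_zero, LinearMap.zero_apply]
  have hT : ∀ x y z, extTri B q [] x y z = pact B _ x (w y z) := by
    intro x y z
    refine eq_of_basis (B := B) (f := (extTri B q []).flip y |>.flip z)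
      (g := (pact B (ExtRule φ B)).flip (w y z)) (fun i => ?_) x
    rw [LinearMap.flip_apply, LinearMap.flip_apply, extTri_basis]
    exact hq i _
  have hrel := cocycleDefect_eq_zero hsymm hinv (B := B) (T := extTri B q []) (Ω := w) (c := e)
    (extTri_skew B q []) (fun a b c hcb hba => by
      have h1 := mkQ_rule (PRule.gen (B := B) (P := ExtRule φ B) [] a _ _
        (ExtRule.w (φ := φ) (B := B) a b c hcb hba))
      change q _ = q _ at h1
      have h2 := hq a (extGen B (B b) (B c))
      rw [extGen_basis B hcb, pre_single, List.append_nil] at h2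
      rw [← extGen_basis B hcb, hw'] at h2
      have h3 := h2.symm.trans h1
      simp only [pre_nil, map_add, map_sub, map_smul, hq, hw'] at h3
      rw [cocycleDefect, hT, hT, hT, h3, hw (B c) (B a), map_neg]
      change _ - ((1 / 2 : k) * φ (B a) ⁅B b, B c⁆) • q _ = 0
      abel)
  let γ : 𝔤 →ₗ[k] 𝔤 →ₗ[k] FreeMod k 𝔤 :=
    koszulGen (freeAct k 𝔤) (TensorProduct.mk k (UniversalEnvelopingAlgebra k 𝔤) 𝔤 1)
  have hγ : ∀ x y, γ x y = - γ y x := koszulGen_skew _ _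
  obtain ⟨δ, hδ, hδ1⟩ := exists_presented_lift (B := B) (P := ExtRule φ B)
    (freeAct_lie (k := k) (𝔤 := 𝔤)) (genVal B γ 0) (by
      intro ev hev hev' a g ρ h
      cases h with
      | e =>
        rw [map_zero]
        exact map_zero _
      | w b c hcb hba =>
        simp only [map_add, map_sub, map_smul, hev', map_extGen B hγ hev, hev]
        have h1 := koszulGen_rel (freeAct_lie (k := k) (𝔤 := 𝔤))
          (TensorProduct.mk k (UniversalEnvelopingAlgebra k 𝔤) 𝔤 1) (B a) (B b) (B c)
        change freeAct k 𝔤 (B a) (γ (B b) (B c)) + freeAct k 𝔤 (B b) (γ (B c) (B a))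
          + freeAct k 𝔤 (B c) (γ (B a) (B b)) = γ _ _ + γ _ _ + γ _ _ at h1
        rw [hγ (B c) (B a), map_neg] at h1
        have h0 : genVal B γ 0 none = 0 := rfl
        rw [h0, smul_zero, add_zero]
        change freeAct k 𝔤 (B a) (γ (B b) (B c)) = _
        linear_combination (norm := abel) h1)
  exact ⟨{
    θ := pact B _
    w := w
    e := e
    θ_lie := pact_lie B _
    θ_e := he
    w_skew := hw
    rel := fun x y z => by
      have := hrel x y z
      rw [cocycleDefect, hT, hT, hT] at this
      exact sub_eq_zero.mp this
    δ := δ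
    δ_θ := hδ
    δ_w := map_extGen (ev := δ ∘ₗ q) B hγ hδ1
    δ_e := hδ1 none
    gen := fun S hS hw he => presented_gen hS fun g => by
      rcases g with _ | ⟨⟨b, c⟩, h⟩
      · exact he
      · have := hw (B b) (B c)
        rwa [← hw', extGen_basis B h] at this }, pmk_none_ne_zero hsymm hinv B⟩

include hsymm hinv in
/-- The generator `e` is not zero in the envelope. -/
theorem toEnvelope_e_ne_zero [WellFoundedLT ι] :
    toEnvelope B φ (Finsupp.single ([], KacMoodyEnv.e) 1) ≠ 0 := by
  obtain ⟨T, hT⟩ := exists_cocycleExtension B hsymm hinv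
  obtain ⟨μ, hμ⟩ := T.exists_model hsymm hinv
  obtain ⟨F, hF⟩ := μ.exists_lift B
  intro h
  have h1 := hF [] KacMoodyEnv.e
  rw [h, map_zero] at h1
  exact T.const_e_ne_zero hT (hμ ▸ h1.symm)

end Construction

end

end Extension

/-! ### Validity of the rules in the envelope -/

section Soundness

noncomputable section

variable {k : Type*} [Field k] [CharZero k] {𝔤 : Type*} [LieRing 𝔤] [LieAlgebra k 𝔤]
  {V : Type*} [AddCommGroup V] [Module k V] {φ : LinearMap.BilinForm k 𝔤} (μ : Model φ V)
  {ι : Type*} (b : Module.Basis ι k 𝔤)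

namespace Model

/-- The image of a polynomial in a model. -/
def lin : (Mon ι →₀ k) →ₗ[k] V := Finsupp.linearCombination k (μ.eval b)

/-- The operator of an element of the free algebra. -/
def opLin : (List (Letter ι) →₀ k) →ₗ[k] Module.End k V :=
  Finsupp.linearCombination k fun w => (w.map (μ.op b)).prod

omit [CharZero k]

theorem lin_single (w : List (Letter ι)) (y : Gen ι) :
    μ.lin b (Finsupp.single (w, y) 1) = (w.map (μ.op b)).prod (μ.gen b y) := by
  simp [lin, eval]

theorem lin_mon (w : List (Letter ι)) (y : Gen ι) :
    μ.lin b (mon k w y) = (w.map (μ.op b)).prod (μ.gen b y) := μ.lin_single b w y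

theorem lin_monV (w : List (Letter ι)) (v : 𝔤) :
    μ.lin b (monV b w v) = (w.map (μ.op b)).prod (μ.X v) := by
  rw [monV, Finsupp.sum, map_sum, ← LinearMap.comp_apply, ← basis_sum_map b (_ ∘ₗ μ.X) v,
    Finsupp.sum]
  refine Finset.sum_congr rfl fun i _ => ?_
  rw [map_smul, lin_mon]
  rfl

theorem lin_monL (n : ℕ) (v : 𝔤) (y : Gen ι) :
    μ.lin b (monL b n v y) = μ.L n v (μ.gen b y) := by
  have h := basis_sum_map b ((μ.L n).flip (μ.gen b y)) v
  rw [LinearMap.flip_apply] at h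
  rw [monL, Finsupp.sum, map_sum, ← h, Finsupp.sum]
  refine Finset.sum_congr rfl fun i _ => ?_
  rw [map_smul, lin_mon]
  simp [Rep.op]

theorem opLin_word (w : List (Letter ι)) : μ.opLin b (word k w) = (w.map (μ.op b)).prod := by
  simp [opLin, word]

theorem opLin_wordL (n : ℕ) (v : 𝔤) : μ.opLin b (wordL b n v) = μ.L n v := by
  rw [wordL, Finsupp.sum, map_sum, ← basis_sum_map b (μ.L n) v, Finsupp.sum]
  refine Finset.sum_congr rfl fun i _ => ?_
  rw [map_smul, opLin_word]
  simp [Rep.op]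

theorem lin_mapDomain (u : List (Letter ι)) (r : Mon ι →₀ k) :
    μ.lin b (r.mapDomain fun t => (u ++ t.1, t.2)) = (u.map (μ.op b)).prod (μ.lin b r) := by
  have : μ.lin b ∘ₗ Finsupp.lmapDomain k k (fun t : Mon ι => (u ++ t.1, t.2))
      = (u.map (μ.op b)).prod ∘ₗ μ.lin b := by
    refine Finsupp.lhom_ext' fun t => LinearMap.ext_ring ?_
    change μ.lin b (Finsupp.mapDomain _ (Finsupp.single (t.1, t.2) 1))
      = (u.map (μ.op b)).prod (μ.lin b (Finsupp.single (t.1, t.2) 1))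
    rw [Finsupp.mapDomain_single, lin_single, lin_single]
    simp
  exact LinearMap.congr_fun this r

theorem lin_mapDomain_word (u v : List (Letter ι)) (y : Gen ι) (r : List (Letter ι) →₀ k) :
    μ.lin b (r.mapDomain fun t => (u ++ t ++ v, y))
      = (u.map (μ.op b)).prod (μ.opLin b r ((v.map (μ.op b)).prod (μ.gen b y))) := by
  have : μ.lin b ∘ₗ Finsupp.lmapDomain k k (fun t => (u ++ t ++ v, y))
      = (u.map (μ.op b)).prod ∘ₗ (LinearMap.applyₗ ((v.map (μ.op b)).prod (μ.gen b y))) ∘ₗ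
        μ.opLin b := by
    refine Finsupp.lhom_ext' fun t => LinearMap.ext_ring ?_
    simp [lin_single, opLin]
  exact LinearMap.congr_fun this r

end Model

variable [LinearOrder ι]

omit [CharZero k] in
theorem AlgRule.opLin_eq {w : List (Letter ι)} {r : List (Letter ι) →₀ k} (h : AlgRule b w r) :
    (w.map (μ.op b)).prod = μ.opLin b r := by
  refine LinearMap.ext fun v => ?_
  cases h with
  | d_L0 a =>
    have := μ.L_D 0 (b a) v
    simp [Model.opLin_word, Rep.op, this]
  | d_L1 a =>
    have := μ.L_D 1 (b a) v
    simp [Model.opLin_word, Rep.op, this]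
  | L_d n a hn => simp [Model.opLin_word, Rep.op, μ.L_D n (b a) v]
  | R_d n a => simp [Model.opLin_word, Rep.op, μ.R_D n (b a) v]
  | R_L m n a c => simp [Model.opLin_word, Rep.op, μ.R_L m n (b a) (b c) v]
  | L_L n m a c h =>
    simp [Model.opLin_word, Model.opLin_wordL, Rep.op, μ.L_L n m (b a) (b c) v]

theorem ModRule.lin_eq (hsymm : ∀ u v : 𝔤, φ u v = φ v u)
    (hinv : ∀ u v w : 𝔤, φ ⁅u, v⁆ w = φ u ⁅v, w⁆)
    {w : List (Letter ι)} {y : Gen ι} {r : Mon ι →₀ k} (h : ModRule b φ (w, y) r) :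
    (w.map (μ.op b)).prod (μ.gen b y) = μ.lin b r := by
  have X : ∀ a : ι, μ.gen b (x a) = μ.X (b a) := fun a => rfl
  have E : μ.gen b (e : Gen ι) = μ.E := rfl
  have op0 : ∀ n a, μ.op b (Letter.L n a) = μ.L n (b a) := fun n a => rfl
  have op1 : ∀ n a, μ.op b (Letter.R n a) = μ.R n (b a) := fun n a => rfl
  have op2 : μ.op b Letter.d = μ.D := rfl
  cases h <;>
    simp only [map_zero, map_add, map_sub, map_smul, Model.lin_mon, Model.lin_monV, Model.lin_monL,
      List.map_cons, List.map_nil, List.prod_cons, List.prod_nil, List.map_replicate,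
      List.prod_replicate, mul_one, Module.End.mul_apply, Module.End.one_apply, X, E, op0, op1, op2]
  case locL n a c hn => exact μ.locL n _ _ hn
  case locR n a c hn => exact μ.locR n _ _ hn
  case L_e n a => exact μ.L_E n _
  case R_e n a => exact μ.R_E n _
  case d_e => exact μ.D_E
  case R2 a c => exact μ.comm2 _ _
  case R1 a c => exact μ.comm1 _ _
  case R0 a c => exact μ.comm0 _ _
  case L2 a c h => exact μ.L2_symm _ _
  case d_L2 a c => exact μ.D_L2 _ _
  case L1_d a c h => exact μ.L1_D_X _ _
  case L1_ds s a c hs h =>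
    obtain ⟨s, rfl⟩ := Nat.exists_eq_add_of_le' (show 1 ≤ s by omega)
    have := μ.L1_D_pow_X (b a) (b c) s
    rw [Nat.add_sub_cancel, this]
    push_cast
    module
  case L2_L2 a c d => exact μ.L2_L2 _ _ _
  case L1_L2 a c d h₁ h₂ =>
    rw [μ.L2_symm (b c), μ.L1_L2_comm, μ.L2_symm (b a), μ.L1_L2_comm]
  case L1_L2' a c d h₁ h₂ => exact μ.L1_L2_comm _ _ _
  case L1_L1 a c d h₁ h₂ =>
    have h := μ.L1_L1_sub (b a) (b c) (b d)
    rw [μ.L2_symm ⁅b a, b c⁆, μ.L2_symm ⁅b a, b d⁆, ← lie_skew (b a) (b d),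
      ← lie_skew (b c) (b d)] at h
    simp only [map_neg] at h
    linear_combination (norm := module) h
  case L1_L1' a c d h₁ h₂ =>
    have h := μ.L1_L1_sub (b a) (b c) (b d)
    have h2 := μ.L_L 1 1 (b a) (b d) (μ.X (b c))
    rw [μ.L2_symm ⁅b a, b c⁆, ← lie_skew (b c) (b d), map_neg, map_neg, μ.L2_symm (b a) (b d)] at h
    linear_combination (norm := module) h + h2
  case L0_L1 a c d h₁ h₂ => exact μ.L0_L1_cyclic hsymm hinv _ _ _

/-- Every rule is a relation in every model. -/
theorem Rule.lin_eq (hsymm : ∀ u v : 𝔤, φ u v = φ v u)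
    (hinv : ∀ u v w : 𝔤, φ ⁅u, v⁆ w = φ u ⁅v, w⁆) {m : Mon ι} {r : Mon ι →₀ k}
    (h : Rule b φ m r) : μ.lin b (Finsupp.single m 1) = μ.lin b r := by
  cases h with
  | alg u v w y r h =>
    rw [Model.lin_single, Model.lin_mapDomain_word, ← h.opLin_eq μ b]
    simp
  | mod u w y r h =>
    rw [Model.lin_single, Model.lin_mapDomain, ← h.lin_eq μ b hsymm hinv]
    simp

omit [CharZero k] [LinearOrder ι] in
theorem lin_envModel : (envModel b φ).lin b = toEnvelope b φ := by
  refine Finsupp.lhom_ext' fun t => LinearMap.ext_ring ?_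
  change (envModel b φ).lin b (Finsupp.single (t.1, t.2) 1)
    = toEnvelope b φ (Finsupp.single (t.1, t.2) 1)
  rw [Model.lin_single, toEnvelope_single]

end

end Soundness

/-! ### The monomial order -/

section Order

variable {ι : Type*} [LinearOrder ι]

/-- An order embedding of the letters into a lexicographic product. -/
def Letter.key : Letter ι → ℕ ×ₗ (ℕ ×ₗ WithBot ι)
  | .L n a => toLex (0, toLex (if n ≤ 1 then n else n + 1, (a : WithBot ι)))
  | .d => toLex (0, toLex (2, ⊥))
  | .R n a => toLex (1, toLex (n, (a : WithBot ι)))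

omit [LinearOrder ι] in
theorem Letter.key_injective : Function.Injective (Letter.key (ι := ι)) := by
  rintro (⟨n, a⟩ | _ | ⟨n, a⟩) (⟨m, c⟩ | _ | ⟨m, c⟩) h <;>
    simp [Letter.key, Prod.ext_iff] at h ⊢
  · refine ⟨?_, h.2⟩
    have := h.1
    split_ifs at this <;> omega
  · exact h

theorem Letter.lt_iff_key {p q : Letter ι} : p.lt q ↔ p.key < q.key := by
  rcases p with (⟨n, a⟩ | _ | ⟨n, a⟩) <;> rcases q with (⟨m, c⟩ | _ | ⟨m, c⟩) <;>
    simp [Letter.key, Letter.lt, Prod.Lex.toLex_lt_toLex]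
  · split_ifs <;> constructor <;> rintro (h | ⟨h, h'⟩) <;> first
      | exact Or.inl (by omega)
      | exact Or.inr ⟨by omega, h'⟩
  · split_ifs <;> omega
  · split_ifs <;> omega

instance : IsTrans (Letter ι) Letter.lt :=
  ⟨fun _ _ _ h h' => Letter.lt_iff_key.mpr
    ((Letter.lt_iff_key.mp h).trans (Letter.lt_iff_key.mp h'))⟩

instance : Std.Trichotomous (Letter.lt (ι := ι)) :=
  ⟨fun _ _ h h' => Letter.key_injective (le_antisymm
    (not_lt.mp fun h1 => h' (Letter.lt_iff_key.mpr h1))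
    (not_lt.mp fun h1 => h (Letter.lt_iff_key.mpr h1)))⟩

theorem Letter.wellFounded_lt [WellFoundedLT ι] : WellFounded (Letter.lt (ι := ι)) := by
  have : (Letter.lt (ι := ι)) = InvImage (· < ·) Letter.key :=
    funext fun p => funext fun q => propext Letter.lt_iff_key
  rw [this]
  exact InvImage.wf _ _root_.wellFounded_lt

theorem Mon.wellFounded_lt [WellFoundedLT ι] : WellFounded (Mon.lt (ι := ι)) :=
  WellFounded.prod_lex (List.Shortlex.wf Letter.wellFounded_lt) _root_.wellFounded_lt

theorem shortlex_trans {α : Type*} {r : α → α → Prop} [IsTrans α r] {s t u : List α}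
    (h : List.Shortlex r s t) (h' : List.Shortlex r t u) : List.Shortlex r s u := by
  rw [List.shortlex_def] at h h' ⊢
  rcases h with h | ⟨h, hl⟩ <;> rcases h' with h' | ⟨h', hl'⟩
  · exact Or.inl (by omega)
  · exact Or.inl (by omega)
  · exact Or.inl (by omega)
  · exact Or.inr ⟨h.trans h', List.lex_trans (fun {_ _ _} h h' => _root_.trans h h') hl hl'⟩

instance : IsTrans (Mon ι) Mon.lt := by
  refine ⟨fun p q r h h' => ?_⟩
  rw [Mon.lt, Prod.lex_def] at *
  rcases h with h | ⟨h, hl⟩ <;> rcases h' with h' | ⟨h', hl'⟩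
  · exact Or.inl (shortlex_trans h h')
  · exact Or.inl (h' ▸ h)
  · exact Or.inl (h ▸ h')
  · exact Or.inr ⟨h.trans h', hl.trans hl'⟩

theorem Mon.lt_trichotomy (p q : Mon ι) : Mon.lt p q ∨ p = q ∨ Mon.lt q p := by
  simp only [Mon.lt, Prod.lex_def]
  rcases trichotomous_of (List.Shortlex Letter.lt) p.1 q.1 with h | h | h
  · exact Or.inl (Or.inl h)
  · rcases _root_.lt_trichotomy p.2 q.2 with h' | h' | h'
    · exact Or.inl (Or.inr ⟨h, h'⟩)
    · exact Or.inr (Or.inl (Prod.ext h h'))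
    · exact Or.inr (Or.inr (Or.inr ⟨h.symm, h'⟩))
  · exact Or.inr (Or.inr (Or.inl h))

/-- The deg-lex order is compatible with contexts on both sides. -/
theorem shortlex_context {s w : List (Letter ι)} (h : List.Shortlex Letter.lt s w)
    (u v : List (Letter ι)) : List.Shortlex Letter.lt (u ++ s ++ v) (u ++ w ++ v) := by
  rw [List.append_assoc, List.append_assoc]
  refine List.Shortlex.append_left ?_ u
  rw [List.shortlex_def] at h ⊢
  rcases h with h | ⟨h, hl⟩
  · exact Or.inl (by simpa using h)
  · refine Or.inr ⟨by simp [h], ?_⟩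
    clear u
    induction hl with
    | nil => simp at h
    | cons _ ih => exact .cons (ih (by simpa using h))
    | rel h' => exact .rel h'

variable {k : Type*} [Field k] {𝔤 : Type*} [LieRing 𝔤] [LieAlgebra k 𝔤]
  {b : Module.Basis ι k 𝔤} {φ : LinearMap.BilinForm k 𝔤}

/-- Polynomials all of whose monomials are less than `m`. -/
def lowerSpace (k : Type*) [Field k] (m : Mon ι) : Submodule k (Mon ι →₀ k) :=
  Finsupp.supported k k {t | Mon.lt t m}

theorem mon_mem_lowerSpace {w w' : List (Letter ι)} {y y' : Gen ι}
    (h : Mon.lt (w', y') (w, y)) : mon k w' y' ∈ lowerSpace k (w, y) :=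
  Finsupp.single_mem_supported k _ h

theorem monV_mem_lowerSpace {w w' : List (Letter ι)} {y : Gen ι}
    (h : List.Shortlex Letter.lt w' w) (v : 𝔤) : monV b w' v ∈ lowerSpace k (w, y) :=
  Submodule.sum_mem _ fun _ _ => Submodule.smul_mem _ _ (mon_mem_lowerSpace (.left _ _ h))

theorem monL_mem_lowerSpace {w : List (Letter ι)} {y y' : Gen ι} (n : ℕ)
    (h : ∀ i, List.Shortlex Letter.lt [Letter.L n i] w) (v : 𝔤) :
    monL b n v y' ∈ lowerSpace k (w, y) :=
  Submodule.sum_mem _ fun i _ => Submodule.smul_mem _ _ (mon_mem_lowerSpace (.left _ _ (h i)))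

theorem AlgRule.lt {w : List (Letter ι)} {r : List (Letter ι) →₀ k} (h : AlgRule b w r) :
    ∀ t ∈ r.support, List.Shortlex Letter.lt t w := by
  suffices hr : r ∈ Finsupp.supported k k {t | List.Shortlex Letter.lt t w} from
    fun t ht => (Finsupp.mem_supported k _).mp hr ht
  have hw : ∀ t, List.Shortlex Letter.lt t w →
      word k t ∈ Finsupp.supported k k {t | List.Shortlex Letter.lt t w} := fun t ht =>
    Finsupp.single_mem_supported k _ ht
  cases h with
  | d_L0 a => exact hw _ (.of_lex (by simp) (.rel (by simp [Letter.lt])))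
  | d_L1 a =>
    exact Submodule.sub_mem _ (hw _ (.of_lex (by simp) (.rel (by simp [Letter.lt]))))
      (hw _ (.of_length_lt (by simp)))
  | L_d n a hn =>
    exact Submodule.add_mem _ (hw _ (.of_lex (by simp) (.rel (by simp [Letter.lt, hn]))))
      (Submodule.smul_mem _ _ (hw _ (.of_length_lt (by simp))))
  | R_d n a =>
    exact Submodule.add_mem _ (hw _ (.of_lex (by simp) (.rel (by simp [Letter.lt]))))
      (Submodule.smul_mem _ _ (hw _ (.of_length_lt (by simp))))
  | R_L m n a c => exact hw _ (.of_lex (by simp) (.rel (by simp [Letter.lt])))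
  | L_L n m a c h =>
    exact Submodule.add_mem _ (hw _ (.of_lex (by simp) (.rel h)))
      (Submodule.sum_mem _ fun i _ => Submodule.smul_mem _ _ (hw _ (.of_length_lt (by simp))))

theorem ModRule.lt {w : List (Letter ι)} {y : Gen ι} {r : Mon ι →₀ k} (h : ModRule b φ (w, y) r) :
    r ∈ lowerSpace k (w, y) := by
  -- Shorter words, words with a smaller letter in first or second place.
  have short : ∀ {w w' : List (Letter ι)} {y y' : Gen ι}, w'.length < w.length →
      mon k w' y' ∈ lowerSpace k (w, y) := fun h =>
    mon_mem_lowerSpace (.left _ _ (.of_length_lt h))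
  have first : ∀ {l l' : Letter ι} {w w' : List (Letter ι)} {y y' : Gen ι}, w'.length = w.length →
      l'.lt l → mon k (l' :: w') y' ∈ lowerSpace k (l :: w, y) := fun h h' =>
    mon_mem_lowerSpace (.left _ _ (.of_lex (by simp [h]) (.rel h')))
  have second : ∀ {l m m' : Letter ι} {y y' : Gen ι}, m'.lt m →
      mon k [l, m'] y' ∈ lowerSpace k ([l, m], y) := fun h' =>
    mon_mem_lowerSpace (.left _ _ (.of_lex (by simp) (.cons (.rel h'))))
  cases h
  case locL | locR | L_e | R_e | d_e | L2_L2 => exact Submodule.zero_mem _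
  case R2 a c => exact first rfl (by simp [Letter.lt])
  case R1 a c =>
    exact Submodule.sub_mem _ (first rfl (by simp [Letter.lt]))
      (Submodule.smul_mem _ _ (short (by simp)))
  case R0 a c =>
    exact Submodule.sub_mem _ (first rfl (by simp [Letter.lt]))
      (monV_mem_lowerSpace (.of_length_lt (by simp)) _)
  case L2 a c h => exact first rfl (Or.inr ⟨rfl, h⟩)
  case d_L2 a c =>
    exact Submodule.sub_mem _ (Submodule.add_mem _ (short (by simp)) (short (by simp)))
      (Submodule.smul_mem _ _ (short (by simp)))
  case L1_d a c h =>
    exact Submodule.sub_mem _ (Submodule.sub_mem _ (Submodule.add_mem _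
      (first rfl (Or.inr ⟨rfl, h⟩)) (Submodule.smul_mem _ _ (short (by simp))))
      (Submodule.smul_mem _ _ (short (by simp))))
      (Submodule.smul_mem _ _ (monV_mem_lowerSpace (.of_length_lt (by simp)) _))
  case L1_ds s a c hs h =>
    exact Submodule.sub_mem _ (Submodule.add_mem _ (Submodule.sub_mem _
      (first rfl (Or.inr ⟨rfl, h⟩)) (Submodule.smul_mem _ _ (short (by simp; omega))))
      (Submodule.smul_mem _ _ (short (by simp; omega))))
      (Submodule.smul_mem _ _ (monV_mem_lowerSpace (.of_length_lt (by simp)) _))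
  case L1_L2 a c d h₁ h₂ => exact first rfl (Or.inr ⟨rfl, h₁.trans_lt h₂⟩)
  case L1_L2' a c d h₁ h₂ => exact first rfl (Or.inr ⟨rfl, h₁⟩)
  case L1_L1 a c d h₁ h₂ =>
    exact Submodule.add_mem _ (Submodule.add_mem _ (Submodule.add_mem _ (Submodule.sub_mem _
      (Submodule.add_mem _ (second (Or.inr ⟨rfl, h₂⟩)) (first rfl (by simp [Letter.lt])))
      (first rfl (by simp [Letter.lt]))) (monV_mem_lowerSpace (.of_length_lt (by simp)) _))
      (monV_mem_lowerSpace (.of_length_lt (by simp)) _))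
      (monV_mem_lowerSpace (.of_length_lt (by simp)) _)
  case L1_L1' a c d h₁ h₂ =>
    exact Submodule.add_mem _ (Submodule.add_mem _ (Submodule.sub_mem _
      (Submodule.add_mem _ (first rfl (Or.inr ⟨rfl, h₁⟩)) (first rfl (by simp [Letter.lt])))
      (first rfl (by simp [Letter.lt]))) (monV_mem_lowerSpace (.of_length_lt (by simp)) _))
      (monV_mem_lowerSpace (.of_length_lt (by simp)) _)
  case L0_L1 a c d h₁ h₂ =>
    have h₃ := h₁.trans h₂
    exact Submodule.add_mem _ (Submodule.sub_mem _ (Submodule.sub_mem _ (Submodule.sub_mem _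
      (Submodule.add_mem _ (Submodule.add_mem _ (Submodule.add_mem _ (Submodule.sub_mem _
      (Submodule.sub_mem _ (Submodule.add_mem _ (Submodule.add_mem _
      (second (Or.inr ⟨rfl, h₁⟩)) (first rfl (Or.inr ⟨rfl, h₂⟩))) (first rfl (Or.inr ⟨rfl, h₃⟩)))
      (first rfl (Or.inr ⟨rfl, h₂⟩))) (first rfl (Or.inr ⟨rfl, h₃⟩)))
      (monL_mem_lowerSpace _ (fun i => .of_length_lt (by simp)) _))
      (monL_mem_lowerSpace _ (fun i => .of_length_lt (by simp)) _))
      (monL_mem_lowerSpace _ (fun i => .of_length_lt (by simp)) _))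
      (monV_mem_lowerSpace (.of_length_lt (by simp)) _))
      (monV_mem_lowerSpace (.of_length_lt (by simp)) _))
      (monV_mem_lowerSpace (.of_length_lt (by simp)) _)) (Submodule.smul_mem _ _ (short (by simp)))

/-- The left-hand side of every rule is greater than the monomials of the right-hand side. -/
theorem Rule.lt {m : Mon ι} {r : Mon ι →₀ k} (h : Rule b φ m r) :
    ∀ t ∈ r.support, Mon.lt t m := by
  classical
  intro t ht
  cases h with
  | alg u v w y r h =>
    obtain ⟨s, hs, rfl⟩ := Finset.mem_image.mp (Finsupp.mapDomain_support ht)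
    exact .left _ _ (shortlex_context (h.lt s hs) u v)
  | mod u w y r h =>
    obtain ⟨s, hs, rfl⟩ := Finset.mem_image.mp (Finsupp.mapDomain_support ht)
    have := (Finsupp.mem_supported k _).mp h.lt hs
    rcases Prod.lex_def.mp this with h' | ⟨h', h''⟩
    · exact .left _ _ (h'.append_left u)
    · exact Prod.lex_def.mpr (Or.inr ⟨congrArg (u ++ ·) h', h''⟩)

end Order

end KacMoodyEnv

/-! ### The Gröbner–Shirshov basis of the envelope -/

theorem mainTheorem1 {k : Type*} [Field k] [CharZero k]
    {𝔤 : Type*} [LieRing 𝔤] [LieAlgebra k 𝔤]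
    (φ : LinearMap.BilinForm k 𝔤)
    (hsymm : ∀ u v : 𝔤, φ u v = φ v u)
    (hinv : ∀ u v w : 𝔤, φ ⁅u, v⁆ w = φ u ⁅v, w⁆)
    {ι : Type*} [LinearOrder ι] [WellFoundedLT ι] (b : Module.Basis ι k 𝔤) :
    KacMoodyEnv.IsGroebnerShirshovBasis KacMoodyEnv.Mon.lt
        (KacMoodyEnv.toEnvelope b φ) (KacMoodyEnv.Rule b φ) ∧
      KacMoodyEnv.IsTerminating (KacMoodyEnv.Rule b φ) ∧
      KacMoodyEnv.IsConfluent (KacMoodyEnv.Rule b φ) := by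
  open KacMoodyEnv in
  refine groebner_of_irreducible_independent Mon.wellFounded_lt Mon.lt_trichotomy _
    (toEnvelope_surjective b φ) (fun m r h => h.lt)
    (fun m r h => by
      rw [← lin_envModel]
      exact h.lin_eq _ b hsymm hinv) ?_
  classical
  intro p hp hirr
  have hLI := linearIndependent_eval_takModel b φ
  have hinj : Function.Injective fun n : {n : NormalForm ι // n.Valid} => n.1.mon :=
    fun n n' h => hLI.injective (congrArg ((takModel k 𝔤 φ).eval b) h)
  obtain ⟨F, hF⟩ := (takModel k 𝔤 φ).exists_lift b
  have hlin : ∀ f, F (toEnvelope b φ f) = (takModel k 𝔤 φ).lin b f := by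
    intro f
    have : F ∘ₗ toEnvelope b φ = (takModel k 𝔤 φ).lin b :=
      Finsupp.lhom_ext' fun t => LinearMap.ext_ring <|
        (hF t.1 t.2).trans ((takModel k 𝔤 φ).lin_single b t.1 t.2).symm
    exact LinearMap.congr_fun this f
  have hsplit : Finsupp.single ([], e) (p ([], e)) + p.erase ([], e) = p :=
    Finsupp.single_add_erase _ p
  -- The model over the Takiff algebra sends `e` to zero and separates the other normal forms.
  have herase : p.erase ([], e) = 0 := by
    have hrange : ((p.erase ([], e)).support : Set (Mon ι))
        ⊆ Set.range fun n : {n : NormalForm ι // n.Valid} => n.1.mon := by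
      intro t ht
      rw [Finset.mem_coe, Finsupp.support_erase, Finset.mem_erase] at ht
      rcases exists_normalForm_of_irreducible b φ t (hirr t ht.2) with h | ⟨n, hn, h⟩
      · exact absurd h ht.1
      · exact ⟨⟨n, hn⟩, h⟩
    have hmap := Finsupp.mapDomain_comapDomain _ hinj (p.erase ([], e)) hrange
    have h0 : (takModel k 𝔤 φ).lin b (p.erase ([], e)) = 0 := by
      have h1 := hlin p
      have h2 : (takModel k 𝔤 φ).lin b (Finsupp.single ([], e) (p ([], e))) = 0 := by
        rw [← mul_one (p ([], e)), ← smul_eq_mul, ← Finsupp.smul_single, map_smul,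
          Model.lin_single]
        exact smul_zero _
      rw [hp, map_zero, ← hsplit, map_add, h2, zero_add] at h1
      exact h1.symm
    rw [← hmap, Model.lin, Finsupp.linearCombination_mapDomain] at h0
    rw [← hmap, linearIndependent_iff.mp hLI _ h0, Finsupp.mapDomain_zero]
  rw [herase, add_zero] at hsplit
  rw [← hsplit, ← mul_one (p ([], e)), ← smul_eq_mul, ← Finsupp.smul_single, map_smul] at hp
  have hpe := (smul_eq_zero.mp hp).resolve_right (toEnvelope_e_ne_zero b hsymm hinv)
  rw [← hsplit, hpe, Finsupp.single_zero]
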